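/- Let $n\ge 1$ and $q\in(0,1)$. All algebras are unital over $\mathbb C$, and $\mathbb Z_+=\{0,1,2,\dots\}$. **Algebras.** $\mathrm{Pol}(\mathrm{Mat}_n)_q$ is the $*$-algebra with generators $z_a^\alpha$, $1\le a,\alpha\le n$, and the relations $$z_a^\alpha z_b^\beta=q\,z_b^\beta z_a^\alpha\ \ (a=b,\ \alpha<\beta\ \text{ or }\ a<b,\ \alpha=\beta),\qquad z_a^\alpha z_b^\beta=z_b^\beta z_a^\alpha\ \ (\alpha<\beta,\ a>b),$$ $$z_a^\alpha z_b^\beta-z_b^\beta z_a^\alpha=(q-q^{-1})\,z_a^\beta z_b^\alpha\ \ (\alpha<\beta,\ a<b),$$ their adjoints, and $$(z_b^\beta)^*z_a^\alpha=q^2\sum_{a',b',\alpha',\beta'=1}^n R_{ba}^{b'a'}R_{\beta\alpha}^{\beta'\alpha'}\,z_{a'}^{\alpha'}(z_{b'}^{\beta'})^*+(1-q^2)\delta_{ab}\delta^{\alpha\beta},$$ where $R_{ij}^{kl}$ equals $q^{-1}$ if $i\ne j$, $i=k$, $j=l$; equals $1$ if $i=j=k=l$; equals $-(q^{-2}-1)$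 if $i=j$, $k=l$, $l>j$; and is $0$ otherwise. $\mathbb C[SU_N]_q$ is the $*$-algebra with generators $t_{\alpha,a}$, $1\le\alpha,a\le N$, subject to the first three families of relations with $z_a^\alpha$ replaced by $t_{\alpha,a}$, to $\det_q\mathbf t=1$, and with the involution $t_{i,j}^{*}=(-q)^{j-i}\det_q\mathbf t_{ij}$. Here $\det_q\mathbf t=\sum_{s\in S_N}(-q)^{l(s)}t_{s(1),1}\cdots t_{s(N),N}$, $l(s)$ is the number of inversions of $s$, and $\mathbf t_{ij}$ is $\mathbf t$ without its $i$-th row and $j$-th column. **The representation $\pi_u$.** On $\ell^2(\mathbb Z_+)$ with standard basis $(e_k)$ put $Se_k=e_{k+1}$, $C_qe_k=\sqrt{1-q^{2k}}\,e_k$, $d(q)e_k=q^ke_k$. For the transposition $s_l=(l,l+1)$, $1\le l<N$, let $\pi_{s_l}$ be the $*$-representation of $\mathbb C[SU_N]_q$ on $\ell^2(\mathbb Z_+)$ with $$t_{l,l}\mapsto S^*C_q,\quad t_{l,l+1}\mapsto q\,d(q),\quad t_{l+1,l}\mapsto-d(q),\quad t_{l+1,l+1}\mapsto C_qS,$$ and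 $t_{a,b}\mapsto\delta_{ab}I$ for all other $a,b$. Let $u\in S_{2n}$ be the permutation with $u(i)=n+i$, $u(n+i)=i$ for $1\le i\le n$, and consider its reduced decomposition $u=c_1c_2\cdots c_n$ with $c_k=s_{k+n-1}s_{k+n-2}\cdots s_k$, written out as $u=\sigma_1\sigma_2\cdots\sigma_{n^2}$. Let $\pi_u=\pi_{\sigma_1}\otimes\cdots\otimes\pi_{\sigma_{n^2}}$ be the corresponding $*$-representation of $\mathbb C[SU_{2n}]_q$ on $\ell^2(\mathbb Z_+)^{\otimes n^2}$, that is, $$\pi_u(t_{i,j})=\sum_{k_1,\dots,k_{n^2-1}=1}^{2n}\pi_{\sigma_1}(t_{i,k_1})\otimes\pi_{\sigma_2}(t_{k_1,k_2})\otimes\cdots\otimes\pi_{\sigma_{n^2}}(t_{k_{n^2-1},j}).$$ **The Fock representation.** Let $\mathcal H_{F,n}$ be the left $\mathrm{Pol}(\mathrm{Mat}_n)_q$-module with one generator $v_0$ and the defining relations $(z_j^i)^*v_0=0$, $1\le i,j\le n$. The Fock representation $\pi_{F,n}$ is the bounded $*$-representation of $\mathrm{Pol}(\mathrm{Mat}_n)_q$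 that extends the module action to the completion of $\mathcal H_{F,n}$ with respect to the positive definite sesquilinear form $(\cdot,\cdot)$ on $\mathcal H_{F,n}$ with $(v_0,v_0)=1$ and $(fu,v)=(u,f^*v)$ for all $f\in\mathrm{Pol}(\mathrm{Mat}_n)_q$, $u,v\in\mathcal H_{F,n}$. **Theorem.** There is exactly one $*$-representation $\pi_u$ of $\mathbb C[SU_{2n}]_q$ on $\ell^2(\mathbb Z_+)^{\otimes n^2}$ with the values on the generators given above; there is exactly one $*$-homomorphism $\iota:\mathrm{Pol}(\mathrm{Mat}_n)_q\to\mathbb C[SU_{2n}]_q$ with $\iota(z_j^i)=q^{i-n}t_{n+i,n+j}$ for $1\le i,j\le n$; the Fock representation exists; and the $*$-representation $\mathcal T=\pi_u\circ\iota$ of $\mathrm{Pol}(\mathrm{Mat}_n)_q$ on $\ell^2(\mathbb Z_+)^{\otimes n^2}$ is unitarily equivalent to $\pi_{F,n}$. -/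

import Mathlib

/-!
The `*`-algebras `Pol(Mat_n)_q` and `ℂ[SU_N]_q`, the representation `π_u` of `ℂ[SU_{2n}]_q` on
`ℓ²(ℤ₊)^{⊗ n²} = ℓ²(ℤ₊^{n²})`, and the Fock representation of `Pol(Mat_n)_q`.
-/

open scoped lp

noncomputable section

namespace QMatBall

/-! ### Unital `*`-algebras given by generators and relations -/

/-- The free unital `*`-algebra over `ℂ` on `X`: the free algebra on the letters `x` (`Sum.inl x`)
and `x*` (`Sum.inr x`). -/
def FreeStarAlgebra (X : Type) : Type := FreeAlgebra ℂ (X ⊕ X)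

namespace FreeStarAlgebra

variable {X : Type}

instance : Ring (FreeStarAlgebra X) := inferInstanceAs (Ring (FreeAlgebra ℂ (X ⊕ X)))
instance : Algebra ℂ (FreeStarAlgebra X) := inferInstanceAs (Algebra ℂ (FreeAlgebra ℂ (X ⊕ X)))

/-- The letter `x` or `x*` as an element of the free `*`-algebra. -/
def letter (y : X ⊕ X) : FreeStarAlgebra X := FreeAlgebra.ι ℂ y

/-- The generator `x`. -/
def gen (x : X) : FreeStarAlgebra X := letter (Sum.inl x)

/-- The opposite algebra with scalars acting through complex conjugation. -/
abbrev conjOpAlgebra : Algebra ℂ (FreeStarAlgebra X)ᵐᵒᵖ :=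
  RingHom.toAlgebra' ((algebraMap ℂ (FreeStarAlgebra X)ᵐᵒᵖ).comp (starRingEnd ℂ))
    (fun c x => Algebra.commutes (starRingEnd ℂ c) x)

/-- The involution, as a ring homomorphism to the opposite ring: it is conjugate linear and
interchanges `x` and `x*`. -/
def starHom : FreeStarAlgebra X →+* (FreeStarAlgebra X)ᵐᵒᵖ :=
  @AlgHom.toRingHom ℂ (FreeAlgebra ℂ (X ⊕ X)) (FreeStarAlgebra X)ᵐᵒᵖ _ _ _ _ conjOpAlgebra
    (@FreeAlgebra.lift ℂ (X ⊕ X) _ (FreeStarAlgebra X)ᵐᵒᵖ _ conjOpAlgebra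
      (fun y => MulOpposite.op (letter y.swap)))

theorem starHom_letter (y : X ⊕ X) : starHom (letter y) = MulOpposite.op (letter y.swap) :=
  @FreeAlgebra.lift_ι_apply ℂ (X ⊕ X) _ (FreeStarAlgebra X)ᵐᵒᵖ _ conjOpAlgebra
    (fun y => MulOpposite.op (letter y.swap)) y

theorem starHom_algebraMap (c : ℂ) : starHom (algebraMap ℂ (FreeStarAlgebra X) c) =
    MulOpposite.op (algebraMap ℂ (FreeStarAlgebra X) (starRingEnd ℂ c)) :=
  @AlgHom.commutes ℂ (FreeAlgebra ℂ (X ⊕ X)) (FreeStarAlgebra X)ᵐᵒᵖ _ _ _ _ conjOpAlgebra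
    (@FreeAlgebra.lift ℂ (X ⊕ X) _ (FreeStarAlgebra X)ᵐᵒᵖ _ conjOpAlgebra
      (fun y => MulOpposite.op (letter y.swap))) c

theorem starHom_starHom (a : FreeStarAlgebra X) : (starHom (starHom a).unop).unop = a := by
  refine FreeAlgebra.induction ℂ (X ⊕ X)
    (motive := fun a => (starHom (starHom (X := X) a).unop).unop = a) ?_ ?_ ?_ ?_ a
  · intro c
    have h := starHom_algebraMap (X := X) c
    have h2 := starHom_algebraMap (X := X) (starRingEnd ℂ c)
    rw [Complex.conj_conj] at h2
    refine (congrArg (fun b => (starHom (MulOpposite.unop b)).unop) h).trans ?_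
    exact congrArg MulOpposite.unop h2
  · intro y
    have h := starHom_letter y
    have h2 := starHom_letter y.swap
    rw [Sum.swap_swap] at h2
    refine (congrArg (fun b => (starHom (MulOpposite.unop b)).unop) h).trans ?_
    exact congrArg MulOpposite.unop h2
  · intro a b ha hb
    have : (starHom (starHom (X := X) (a * b)).unop).unop =
        (starHom (starHom (X := X) a).unop).unop * (starHom (starHom (X := X) b).unop).unop := by
      erw [map_mul, MulOpposite.unop_mul, map_mul, MulOpposite.unop_mul]
    exact this.trans (by rw [ha, hb]; rfl)
  · intro a b ha hb
    have : (starHom (starHom (X := X) (a + b)).unop).unop =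
        (starHom (starHom (X := X) a).unop).unop + (starHom (starHom (X := X) b).unop).unop := by
      erw [map_add, MulOpposite.unop_add, map_add, MulOpposite.unop_add]
    exact this.trans (by rw [ha, hb]; rfl)

instance : StarRing (FreeStarAlgebra X) where
  star a := (starHom a).unop
  star_involutive := starHom_starHom
  star_mul a b := by
    change (starHom (a * b)).unop = (starHom b).unop * (starHom a).unop
    rw [map_mul, MulOpposite.unop_mul]
  star_add a b := by
    change (starHom (a + b)).unop = (starHom a).unop + (starHom b).unop
    rw [map_add, MulOpposite.unop_add]

theorem star_letter (y : X ⊕ X) : star (letter y) = letter y.swap :=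
  congrArg MulOpposite.unop (starHom_letter y)

theorem star_algebraMap (c : ℂ) : star (algebraMap ℂ (FreeStarAlgebra X) c) =
    algebraMap ℂ (FreeStarAlgebra X) (star c) :=
  congrArg MulOpposite.unop (starHom_algebraMap c)

instance : StarModule ℂ (FreeStarAlgebra X) where
  star_smul c a := by
    rw [Algebra.smul_def, star_mul, star_algebraMap, Algebra.smul_def, Algebra.commutes]

end FreeStarAlgebra

/-- The relations `r` together with their adjoints. -/
def starClosure {X : Type} (r : FreeStarAlgebra X → FreeStarAlgebra X → Prop)
    (a b : FreeStarAlgebra X) : Prop := r a b ∨ r (star a) (star b)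

/-- The unital `*`-algebra over `ℂ` with generators `X` and defining relations `r` (the adjoint of
a relation being, necessarily, a relation too). -/
def StarPresented {X : Type} (r : FreeStarAlgebra X → FreeStarAlgebra X → Prop) : Type :=
  RingQuot (starClosure r)

namespace StarPresented

variable {X : Type} (r : FreeStarAlgebra X → FreeStarAlgebra X → Prop)

instance : Ring (StarPresented r) := inferInstanceAs (Ring (RingQuot (starClosure r)))
instance : Algebra ℂ (StarPresented r) := inferInstanceAs (Algebra ℂ (RingQuot (starClosure r)))
instance : StarRing (StarPresented r) :=
  RingQuot.starRing (starClosure r) (fun a b h => by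
    rcases h with h | h
    · exact Or.inr (by simpa using h)
    · exact Or.inl h)

/-- The quotient map. -/
def mk : FreeStarAlgebra X →ₐ[ℂ] StarPresented r := RingQuot.mkAlgHom ℂ (starClosure r)

/-- The generator `x`. -/
def gen (x : X) : StarPresented r := mk r (FreeStarAlgebra.gen x)

theorem mk_surjective : Function.Surjective (mk r) :=
  RingQuot.mkAlgHom_surjective ℂ (starClosure r)

theorem star_mk (a : FreeStarAlgebra X) : star (mk r a) = mk r (star a) := by
  have h : ∀ b : FreeStarAlgebra X, mk r b = (⟨Quot.mk _ b⟩ : RingQuot (starClosure r)) := by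
    intro b
    simp [mk, RingQuot.mkAlgHom_def, RingQuot.mkRingHom_def]
    rfl
  rw [h, h]
  rfl

instance : StarModule ℂ (StarPresented r) where
  star_smul c a := by
    obtain ⟨a, rfl⟩ := mk_surjective r a
    rw [← map_smul, star_mk, star_smul, map_smul, star_mk]

end StarPresented

/-! ### The relations of the quantum matrix algebra and the `q`-determinant -/

section QuantumMatrices

variable {A : Type} [Ring A] [Algebra ℂ A]

/-- The relations of `ℂ[Mat_N]_q` between the entries of a matrix `M`, where `M α a` stands for
`z_a^α` (or `t_{α,a}`). -/
inductive QMatrixRel (q : ℝ) {N : ℕ} (M : Matrix (Fin N) (Fin N) A) : A → A → Prop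
  | qComm (α β a b : Fin N) (h : (a = b ∧ α < β) ∨ (a < b ∧ α = β)) :
      QMatrixRel q M (M α a * M β b - (q : ℂ) • (M β b * M α a)) 0
  | comm (α β a b : Fin N) (h : α < β ∧ b < a) :
      QMatrixRel q M (M α a * M β b - M β b * M α a) 0
  | cross (α β a b : Fin N) (h : α < β ∧ a < b) :
      QMatrixRel q M
        (M α a * M β b - M β b * M α a - ((q : ℂ) - (q : ℂ)⁻¹) • (M β a * M α b)) 0

/-- The length `l(s)` of a permutation: its number of inversions. -/
def permLength {N : ℕ} (s : Equiv.Perm (Fin N)) : ℕ :=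
  (Finset.univ.filter fun p : Fin N × Fin N => p.1 < p.2 ∧ s p.2 < s p.1).card

/-- `det_q M = ∑_s (-q)^{l(s)} M_{s(1),1} M_{s(2),2} ⋯ M_{s(N),N}`. -/
def qDet (q : ℝ) {N : ℕ} (M : Matrix (Fin N) (Fin N) A) : A :=
  ∑ s : Equiv.Perm (Fin N), (-(q : ℂ)) ^ permLength s • (List.ofFn fun j => M (s j) j).prod

/-- `det_q` of the matrix `M` with its `i`-th row and `j`-th column deleted. -/
def qMinor (q : ℝ) : {N : ℕ} → Matrix (Fin N) (Fin N) A → Fin N → Fin N → A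
  | 0, _, i, _ => i.elim0
  | _ + 1, M, i, j => qDet q (M.submatrix i.succAbove j.succAbove)

end QuantumMatrices

/-! ### The `*`-algebra `Pol(Mat_n)_q` -/

/-- The coefficients `R_{ij}^{kl}`. -/
def rCoeff (q : ℝ) {n : ℕ} (i j k l : Fin n) : ℂ :=
  if i ≠ j ∧ i = k ∧ j = l then (q : ℂ)⁻¹
  else if i = j ∧ j = k ∧ k = l then 1
  else if i = j ∧ k = l ∧ j < l then -(((q : ℂ) ^ 2)⁻¹ - 1)
  else 0

/-- The matrix of generators: its `(i, j)` entry is `x_{(i, j)}`. -/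
def genMatrix (N : ℕ) : Matrix (Fin N) (Fin N) (FreeStarAlgebra (Fin N × Fin N)) :=
  fun i j => FreeStarAlgebra.gen (i, j)

/-- The defining relations of `Pol(Mat_n)_q`, up to adjoints; `genMatrix n α a` is `z_a^α`. -/
inductive PolRel (n : ℕ) (q : ℝ) :
    FreeStarAlgebra (Fin n × Fin n) → FreeStarAlgebra (Fin n × Fin n) → Prop
  | hol {x y : FreeStarAlgebra (Fin n × Fin n)} (h : QMatrixRel q (genMatrix n) x y) : PolRel n q x y
  | mixed (α β a b : Fin n) :
      PolRel n q (star (genMatrix n β b) * genMatrix n α a)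
        ((q : ℂ) ^ 2 • (∑ a' : Fin n, ∑ b' : Fin n, ∑ α' : Fin n, ∑ β' : Fin n,
            (rCoeff q b a b' a' * rCoeff q β α β' α') •
              (genMatrix n α' a' * star (genMatrix n β' b'))) +
          if a = b ∧ α = β then (1 - (q : ℂ) ^ 2) • 1 else 0)

/-- The `*`-algebra `Pol(Mat_n)_q`. -/
abbrev PolMat (n : ℕ) (q : ℝ) : Type := StarPresented (PolRel n q)

/-- The generator `z_j^i` (upper index first). -/
def zGen (n : ℕ) (q : ℝ) (i j : Fin n) : PolMat n q := StarPresented.gen (PolRel n q) (i, j)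

/-! ### The `*`-algebra `ℂ[SU_N]_q` -/

/-- The defining relations of `ℂ[SU_N]_q`, up to adjoints: those of `ℂ[SL_N]_q`, and the formula
`t_{i,j}^⋆ = (-q)^{j-i} det_q t_{ij}` for the involution. -/
inductive SURel (N : ℕ) (q : ℝ) :
    FreeStarAlgebra (Fin N × Fin N) → FreeStarAlgebra (Fin N × Fin N) → Prop
  | hol {x y : FreeStarAlgebra (Fin N × Fin N)} (h : QMatrixRel q (genMatrix N) x y) : SURel N q x y
  | det : SURel N q (qDet q (genMatrix N)) 1
  | invol (i j : Fin N) :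
      SURel N q (star (genMatrix N i j))
        ((-(q : ℂ)) ^ ((j : ℤ) - (i : ℤ)) • qMinor q (genMatrix N) i j)

/-- The `*`-algebra `ℂ[SU_N]_q`. -/
abbrev CSU (N : ℕ) (q : ℝ) : Type := StarPresented (SURel N q)

/-- The generator `t_{i,j}`. -/
def tGen (N : ℕ) (q : ℝ) (i j : Fin N) : CSU N q := StarPresented.gen (SURel N q) (i, j)

/-! ### Operators on `ℓ²` -/

/-- A linear map from `ℓ²(α)` to functions on `β` which is bounded for the `ℓ²` norm, as a bounded
operator. -/
def l2Op {α β : Type} (F : ℓ²(α, ℂ) →ₗ[ℂ] (β → ℂ)) (C : ℝ) (hC : 0 ≤ C)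
    (h : ∀ (f : ℓ²(α, ℂ)) (s : Finset β), ∑ b ∈ s, ‖F f b‖ ^ 2 ≤ (C * ‖f‖) ^ 2) :
    ℓ²(α, ℂ) →L[ℂ] ℓ²(β, ℂ) :=
  LinearMap.mkContinuous
    { toFun := fun f => ⟨F f, memℓp_gen' (C := (C * ‖f‖) ^ 2) (by simpa using h f)⟩
      map_add' := fun f g => by ext b; simp; rfl
      map_smul' := fun c f => by ext b; simp } C
    (fun f => lp.norm_le_of_forall_sum_le (by simp) (by positivity) (by simpa using h f))

theorem l2Op_apply {α β : Type} (F : ℓ²(α, ℂ) →ₗ[ℂ] (β → ℂ)) (C : ℝ) (hC : 0 ≤ C)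
    (h : ∀ (f : ℓ²(α, ℂ)) (s : Finset β), ∑ b ∈ s, ‖F f b‖ ^ 2 ≤ (C * ‖f‖) ^ 2)
    (f : ℓ²(α, ℂ)) (b : β) : l2Op F C hC h f b = F f b := rfl

theorem hasSum_sq {α : Type} (f : ℓ²(α, ℂ)) : HasSum (fun a => ‖f a‖ ^ 2) (‖f‖ ^ 2) := by
  simpa using lp.hasSum_norm (p := 2) (by simp) f

theorem sum_sq_le {α : Type} (f : ℓ²(α, ℂ)) (s : Finset α) : ∑ a ∈ s, ‖f a‖ ^ 2 ≤ ‖f‖ ^ 2 :=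
  sum_le_hasSum s (fun _ _ => by positivity) (hasSum_sq f)

/-- The diagonal operator `e_k ↦ w_k e_k`. -/
def diagOp (w : ℕ → ℂ) (hw : ∀ k, ‖w k‖ ≤ 1) : ℓ²(ℕ, ℂ) →L[ℂ] ℓ²(ℕ, ℂ) :=
  l2Op
    { toFun := fun f k => w k * f k
      map_add' := fun f g => by ext k; simp [mul_add]
      map_smul' := fun c f => by ext k; simp; ring } 1 zero_le_one
    (fun f s => by
      rw [one_mul]
      refine le_trans (Finset.sum_le_sum fun k _ => ?_) (sum_sq_le f s)
      have h1 : ‖w k * f k‖ ≤ ‖f k‖ := by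
        rw [norm_mul]; exact mul_le_of_le_one_left (norm_nonneg _) (hw k)
      exact pow_le_pow_left₀ (norm_nonneg _) h1 2)

/-- The unilateral shift `e_k ↦ e_{k+1}`. -/
def shiftOp : ℓ²(ℕ, ℂ) →L[ℂ] ℓ²(ℕ, ℂ) :=
  l2Op
    { toFun := fun f k => if k = 0 then 0 else f (k - 1)
      map_add' := fun f g => by ext k; by_cases hk : k = 0 <;> simp [hk]
      map_smul' := fun c f => by ext k; by_cases hk : k = 0 <;> simp [hk] } 1 zero_le_one
    (fun f s => by
      rw [one_mul]
      have h0 : ∑ k ∈ s, ‖(if k = 0 then 0 else f (k - 1) : ℂ)‖ ^ 2 ≤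
          ∑ k ∈ s.filter (· ≠ 0), ‖f (k - 1)‖ ^ 2 := by
        rw [Finset.sum_filter]
        refine Finset.sum_le_sum fun k _ => ?_
        by_cases hk : k = 0 <;> simp [hk]
      refine le_trans h0 (le_trans (le_of_eq ?_)
        (sum_sq_le f ((s.filter (· ≠ 0)).image (· - 1))))
      rw [Finset.sum_image]
      intro x hx y hy hxy
      simp only [ne_eq, Finset.coe_filter, Set.mem_ofPred_eq] at hx hy hxy
      omega)

variable {q : ℝ}

/-- `C_q e_k = √(1 - q^{2k}) e_k`. -/
def cOp (hq : q ∈ Set.Ioo (0 : ℝ) 1) : ℓ²(ℕ, ℂ) →L[ℂ] ℓ²(ℕ, ℂ) :=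
  diagOp (fun k => (Real.sqrt (1 - q ^ (2 * k)) : ℂ)) (fun k => by
    have h : 0 ≤ q ^ (2 * k) := pow_nonneg hq.1.le _
    rw [Complex.norm_real, Real.norm_of_nonneg (Real.sqrt_nonneg _)]
    exact Real.sqrt_le_one.mpr (by linarith))

/-- `d(q) e_k = q^k e_k`. -/
def dOp (hq : q ∈ Set.Ioo (0 : ℝ) 1) : ℓ²(ℕ, ℂ) →L[ℂ] ℓ²(ℕ, ℂ) :=
  diagOp (fun k => ((q ^ k : ℝ) : ℂ)) (fun k => by
    rw [Complex.norm_real, Real.norm_of_nonneg (pow_nonneg hq.1.le _)]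
    exact pow_le_one₀ hq.1.le hq.2.le)

/-- The matrix `(Π(t_{a,b}))` of the representation `Π` of `ℂ[SU_2]_q`:
`Π(t_{1,1}) = S* C_q`, `Π(t_{1,2}) = q d(q)`, `Π(t_{2,1}) = -d(q)`, `Π(t_{2,2}) = C_q S`. -/
def suTwoMatrix (hq : q ∈ Set.Ioo (0 : ℝ) 1) :
    Matrix (Fin 2) (Fin 2) (ℓ²(ℕ, ℂ) →L[ℂ] ℓ²(ℕ, ℂ)) :=
  !![star shiftOp * cOp hq, (q : ℂ) • dOp hq; -dOp hq, cOp hq * shiftOp]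

/-- The matrix `(π_{s}(t_{a,b}))` of the representation `π_s = Π ∘ ψ` of `ℂ[SU_N]_q` attached to
the transposition `s` of the (zero-based) indices `l` and `l + 1`. -/
def simpleMatrix (hq : q ∈ Set.Ioo (0 : ℝ) 1) (N l : ℕ) :
    Matrix (Fin N) (Fin N) (ℓ²(ℕ, ℂ) →L[ℂ] ℓ²(ℕ, ℂ)) :=
  fun a b =>
    if h : (l ≤ (a : ℕ) ∧ (a : ℕ) ≤ l + 1) ∧ (l ≤ (b : ℕ) ∧ (b : ℕ) ≤ l + 1) then
      suTwoMatrix hq ⟨(a : ℕ) - l, by omega⟩ ⟨(b : ℕ) - l, by omega⟩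
    else if a = b then 1 else 0

/-- The vector `∑_l f(k_1, …, l, …, k_m) e_l` (with `l` in the `r`-th place) of `ℓ²(ℤ₊)`. -/
def slice {m : ℕ} (r : Fin m) (f : ℓ²(Fin m → ℕ, ℂ)) (k : Fin m → ℕ) : ℓ²(ℕ, ℂ) :=
  ⟨fun l => f (Function.update k r l), memℓp_gen (by
    have h := (hasSum_sq f).summable.comp_injective (Function.update_injective k r)
    simpa [Function.comp_def] using h)⟩

theorem slice_bound {m : ℕ} (r : Fin m) (A : ℓ²(ℕ, ℂ) →L[ℂ] ℓ²(ℕ, ℂ)) (f : ℓ²(Fin m → ℕ, ℂ))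
    (s : Finset (Fin m → ℕ)) : ∑ k ∈ s, ‖A (slice r f k) (k r)‖ ^ 2 ≤ (‖A‖ * ‖f‖) ^ 2 := by
  classical
  let e := Equiv.funSplitAt r ℕ
  let g : ({j // j ≠ r} → ℕ) → ℓ²(ℕ, ℂ) := fun y => slice r f (e.symm (0, y))
  have hupd : ∀ (y : {j // j ≠ r} → ℕ) (l : ℕ),
      Function.update (e.symm (0, y)) r l = e.symm (l, y) := by
    intro y l
    ext j
    by_cases hj : j = r
    · subst hj; simp [e]
    · simp [e, hj]
  have hg : ∀ k, slice r f k = g (e k).2 := by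
    intro k
    ext l
    have : Function.update (e.symm (0, (e k).2)) r l = Function.update k r l := by
      ext j
      by_cases hj : j = r
      · subst hj; simp
      · simp [e, hj]
    simp only [g, slice, this]
  have hsum : HasSum (fun y => ‖g y‖ ^ 2) (‖f‖ ^ 2) := by
    have h1 : HasSum (fun p : ({j // j ≠ r} → ℕ) × ℕ => ‖f (e.symm (p.2, p.1))‖ ^ 2)
        (‖f‖ ^ 2) :=
      (((Equiv.prodComm _ _).trans e.symm).hasSum_iff (f := fun k => ‖f k‖ ^ 2)).mpr (hasSum_sq f)
    refine h1.prod_fiberwise (fun y => ?_)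
    have h2 := hasSum_sq (g y)
    have h3 : ∀ l, g y l = f (e.symm (l, y)) := fun l => congrArg (fun k => f k) (hupd y l)
    simpa only [h3] using h2
  have hle : ∑ k ∈ s, ‖A (slice r f k) (k r)‖ ^ 2 ≤
      ∑ y ∈ s.image (fun k => (e k).2), ∑ l ∈ s.image (fun k => k r), ‖A (g y) l‖ ^ 2 := by
    rw [← Finset.sum_product']
    have h3 : ∑ k ∈ s, ‖A (slice r f k) (k r)‖ ^ 2 =
        ∑ p ∈ s.image (fun k => ((e k).2, k r)), ‖A (g p.1) p.2‖ ^ 2 := by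
      rw [Finset.sum_image]
      · exact Finset.sum_congr rfl fun k _ => by rw [hg]
      · intro k _ k' _ hkk
        apply e.injective
        exact Prod.ext (by simpa [e] using congrArg Prod.snd hkk)
          (by simpa using congrArg Prod.fst hkk)
    rw [h3]
    refine Finset.sum_le_sum_of_subset_of_nonneg ?_ (fun _ _ _ => by positivity)
    intro p hp
    obtain ⟨k, hk, rfl⟩ := Finset.mem_image.mp hp
    exact Finset.mem_product.mpr
      ⟨Finset.mem_image_of_mem (fun k => (e k).2) hk, Finset.mem_image_of_mem (fun k => k r) hk⟩
  calc _ ≤ _ := hle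
    _ ≤ ∑ y ∈ s.image (fun k => (e k).2), ‖A‖ ^ 2 * ‖g y‖ ^ 2 := by
        refine Finset.sum_le_sum fun y _ => (sum_sq_le (A (g y)) _).trans ?_
        rw [← mul_pow]
        exact pow_le_pow_left₀ (norm_nonneg _) (A.le_opNorm _) 2
    _ ≤ ‖A‖ ^ 2 * ‖f‖ ^ 2 := by
        rw [← Finset.mul_sum]
        exact mul_le_mul_of_nonneg_left
          (sum_le_hasSum _ (fun _ _ => by positivity) hsum) (by positivity)
    _ = _ := by rw [mul_pow]

/-- The operator `I ⊗ ⋯ ⊗ A ⊗ ⋯ ⊗ I` on `ℓ²(ℤ₊)^{⊗ m} = ℓ²(ℤ₊^m)`, with `A` in the `r`-th place. -/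
def slotOp {m : ℕ} (r : Fin m) (A : ℓ²(ℕ, ℂ) →L[ℂ] ℓ²(ℕ, ℂ)) :
    ℓ²(Fin m → ℕ, ℂ) →L[ℂ] ℓ²(Fin m → ℕ, ℂ) :=
  l2Op
    { toFun := fun f k => A (slice r f k) (k r)
      map_add' := fun f g => by
        ext k
        have h : slice r (f + g) k = slice r f k + slice r g k := by ext l; simp [slice]; rfl
        simp [h]
      map_smul' := fun c f => by
        ext k
        have h : slice r (c • f) k = c • slice r f k := by ext l; simp [slice]
        simp [h] } ‖A‖ (norm_nonneg _) (slice_bound r A)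

/-- `A_1 ⊗ ⋯ ⊗ A_m` on `ℓ²(ℤ₊)^{⊗ m} = ℓ²(ℤ₊^m)`. -/
def tensorOp {m : ℕ} (A : Fin m → (ℓ²(ℕ, ℂ) →L[ℂ] ℓ²(ℕ, ℂ))) :
    ℓ²(Fin m → ℕ, ℂ) →L[ℂ] ℓ²(Fin m → ℕ, ℂ) :=
  (List.ofFn fun r => slotOp r (A r)).prod

/-! ### The representation `π_u` -/

/-- The operator by which `π_{σ_1} ⊗ ⋯ ⊗ π_{σ_m}` represents `t_{i,j}`, for the word
`σ_1 ⋯ σ_m` of simple transpositions with (zero-based) labels `w`: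
`∑ π_{σ_1}(t_{i,k_1}) ⊗ π_{σ_2}(t_{k_1,k_2}) ⊗ ⋯ ⊗ π_{σ_m}(t_{k_{m-1},j})`, the sum being over all
sequences `k_0 = i, k_1, …, k_{m-1}, k_m = j`. -/
def wordOp (hq : q ∈ Set.Ioo (0 : ℝ) 1) (N : ℕ) {m : ℕ} (w : Fin m → ℕ) (i j : Fin N) :
    ℓ²(Fin m → ℕ, ℂ) →L[ℂ] ℓ²(Fin m → ℕ, ℂ) :=
  ∑ k : Fin (m + 1) → Fin N with k 0 = i ∧ k (Fin.last m) = j,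
    tensorOp fun r => simpleMatrix hq N (w r) (k r.castSucc) (k r.succ)

/-- The reduced word `c_1 c_2 ⋯ c_n`, `c_k = s_{k+n-1} s_{k+n-2} ⋯ s_k`, of the permutation `u` of
`{1, …, 2n}` which interchanges the two halves. The transposition `s_l = (l, l+1)` has the
zero-based label `l - 1`, so that the cycle with zero-based number `k = r / n` contributes the labels
`k + n - 1, …, k + 1, k`. -/
def halfSwapWord (n : ℕ) (r : Fin (n ^ 2)) : ℕ :=
  (r : ℕ) / n + (n - 1 - (r : ℕ) % n)

/-- The operator `π_u(t_{i,j})`. -/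
def piUOp (hq : q ∈ Set.Ioo (0 : ℝ) 1) (n : ℕ) (i j : Fin (n + n)) :
    ℓ²(Fin (n ^ 2) → ℕ, ℂ) →L[ℂ] ℓ²(Fin (n ^ 2) → ℕ, ℂ) :=
  wordOp hq (n + n) (halfSwapWord n) i j

/-! ### The Fock representation -/

/-- The `Pol(Mat_n)_q`-module with one generator `v_0` and the relations `(z_j^i)* v_0 = 0`. -/
abbrev FockModule (n : ℕ) (q : ℝ) : Type :=
  PolMat n q ⧸ Submodule.span (PolMat n q)
    (Set.range fun p : Fin n × Fin n => star (zGen n q p.1 p.2))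

/-- The generator `v_0`. -/
def fockVacuum (n : ℕ) (q : ℝ) : FockModule n q := Submodule.Quotient.mk 1

/-- A sesquilinear form (conjugate linear in the first variable) on the Fock module for which
`(v_0, v_0) = 1` and `(f u, v) = (u, f* v)`. -/
def IsFockForm {n : ℕ} {q : ℝ} (B : FockModule n q →ₗ⋆[ℂ] FockModule n q →ₗ[ℂ] ℂ) : Prop :=
  B (fockVacuum n q) (fockVacuum n q) = 1 ∧
    ∀ (f : PolMat n q) (u v : FockModule n q), B (f • u) v = B u (star f • v)

/-- `π` is the Fock representation: it acts on the completion `H` of the Fock module with respect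
to its positive definite form, extending the module action. -/
def IsFockRepresentation {n : ℕ} {q : ℝ} {H : Type*} [NormedAddCommGroup H]
    [InnerProductSpace ℂ H] [CompleteSpace H] (π : PolMat n q →⋆ₐ[ℂ] (H →L[ℂ] H)) : Prop :=
  ∃ B : FockModule n q →ₗ⋆[ℂ] FockModule n q →ₗ[ℂ] ℂ,
    IsFockForm B ∧ (∀ u, u ≠ 0 → 0 < (B u u).re) ∧
    ∃ J : FockModule n q →ₗ[ℂ] H,
      DenseRange J ∧ (∀ u v, inner ℂ (J u) (J v) = B u v) ∧
      ∀ (f : PolMat n q) (u : FockModule n q), π f (J u) = J (f • u)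

/-- Unitary equivalence of `*`-representations. -/
def UnitarilyEquivalent {A : Type*} [Ring A] [Algebra ℂ A] [Star A]
    {H₁ : Type*} [NormedAddCommGroup H₁] [InnerProductSpace ℂ H₁] [CompleteSpace H₁]
    {H₂ : Type*} [NormedAddCommGroup H₂] [InnerProductSpace ℂ H₂] [CompleteSpace H₂]
    (π₁ : A →⋆ₐ[ℂ] (H₁ →L[ℂ] H₁)) (π₂ : A →⋆ₐ[ℂ] (H₂ →L[ℂ] H₂)) : Prop :=
  ∃ U : H₁ ≃ₗᵢ[ℂ] H₂, ∀ (a : A) (x : H₁), U (π₁ a x) = π₂ a (U x)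

end QMatBall

end

/-! Both `*`-homomorphisms come from checking relations on matrices, and the equivalence comes from
following basis vectors through the word for `u`.

The quantum matrix relations have an `R`-matrix form (`IsQMatrix.rtt`), which passes to products of
matrices with mutually commuting entries (`IsQMatrix.mul`), and the `q`-determinant is
multiplicative on such products (`IsQMatrix.qDet_mul`). By the Laplace expansions the cofactor
matrix inverts a quantum matrix of determinant one, so the formula for `t*` may be replaced by
unitarity (`IsSUMatrix.star_eq_qCofactor`). Hence `π_u` exists as soon as the matrix of a single
simple transposition is of this type (`isSUMatrix_simpleMatrix`).

For `ι`, the `R`-matrix relation is multiplied by adjoints on both sides and contracted by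
unitarity, which gives commutation rules between entries and adjoints
(`IsSUMatrix.star_mul_relation`). In the lower right corner the sum over the upper rows is removed
by unitarity of the columns. A triangular system in the row index remains, and the weights `q^{i-n}`
are those for which its solution has the coefficients of `Pol(Mat_n)_q`
(`weighted_triangular_solution`, `IsSUMatrix.isPolMatrix_corner`).

The operator `π_u(t_{n+i,n+j})` is a sum over paths of states through the word. On a basis vector
whose coordinates vanish in all rows of index greater than `i`, only one path survives; it raises
the coordinate in row `i` and reversed column `j`, with a nonzero coefficient (`piUOp_basisVec`).
Monomials ordered by rows therefore send `e_0` to nonzero multiples of the basis vectors, each hit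
exactly once. The adjoints annihilate `e_0` (`star_piUOp_basisVec_zero`), so there is a module map
from the Fock module to `ℓ²`. Ordered monomials span the Fock module by a normal ordering argument
(`span_ordered_eq_top`), so this map is injective with dense image, and the inner product pulls back
to a positive definite Fock form: `π_u ∘ ι` is itself a Fock representation. The form is unique
because `v_0` is orthogonal to every `z v` (`IsFockForm.unique`), so in any Fock representation the
same monomials give an orthonormal basis, and matching the bases is the unitary equivalence. -/

noncomputable section

namespace QMatBall

/-! ### Inversions of functions -/

/-- The number of inversions of a function. -/
def invCount {N N' : ℕ} (k : Fin N → Fin N') : ℕ :=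
  (Finset.univ.filter fun p : Fin N × Fin N => p.1 < p.2 ∧ k p.2 < k p.1).card

theorem permLength_eq_invCount {N : ℕ} (s : Equiv.Perm (Fin N)) : permLength s = invCount s := rfl

/-- Exchanging two neighbouring positions preserves the order of every pair of positions except that
pair, so it carries the inversions of `k` bijectively to those of the new function other than `(a,
b)`. -/
theorem invCount_comp_swap {N N' : ℕ} (k : Fin N → Fin N') {a b : Fin N} (hab : (a : ℕ) + 1 = b)
    (h : k a < k b) : invCount (k ∘ Equiv.swap a b) = invCount k + 1 := by
  classical
  set τ := Equiv.swap a b with hτ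
  have hlt : a < b := by rw [Fin.lt_def]; omega
  have hne : a ≠ b := hlt.ne
  have hτa : τ a = b := Equiv.swap_apply_left a b
  have hτb : τ b = a := Equiv.swap_apply_right a b
  have hττ : ∀ x, τ (τ x) = x := fun x => Equiv.swap_apply_self a b x
  have hmono : ∀ x y : Fin N, ¬ (x = a ∧ y = b) → x < y → τ x < τ y := by
    intro x y hxy hlt'
    rw [hτ, Equiv.swap_apply_def, Equiv.swap_apply_def]
    simp only [Fin.lt_def, Fin.ext_iff] at *
    split_ifs <;> omega
  have hset : (Finset.univ.filter fun p : Fin N × Fin N =>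
        p.1 < p.2 ∧ (k ∘ τ) p.2 < (k ∘ τ) p.1) =
      insert (a, b) ((Finset.univ.filter fun p : Fin N × Fin N => p.1 < p.2 ∧ k p.2 < k p.1).image
        (Prod.map τ τ)) := by
    ext ⟨x, y⟩
    simp only [Finset.mem_filter, Finset.mem_univ, true_and, Function.comp_apply,
      Finset.mem_insert, Prod.mk.injEq, Finset.mem_image, Prod.exists, Prod.map_apply]
    constructor
    · rintro ⟨h1, h2⟩
      by_cases hxy : x = a ∧ y = b
      · exact Or.inl hxy
      · exact Or.inr ⟨τ x, τ y, ⟨hmono x y hxy h1, h2⟩, hττ x, hττ y⟩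
    · rintro (⟨rfl, rfl⟩ | ⟨u, v, ⟨h1, h2⟩, rfl, rfl⟩)
      · exact ⟨hlt, by rw [hτa, hτb]; exact h⟩
      · rw [hττ, hττ]
        refine ⟨hmono u v ?_ h1, h2⟩
        rintro ⟨rfl, rfl⟩
        exact absurd h h2.asymm
  have hnot : (a, b) ∉ ((Finset.univ.filter fun p : Fin N × Fin N =>
      p.1 < p.2 ∧ k p.2 < k p.1).image (Prod.map τ τ)) := by
    simp only [Finset.mem_image, Finset.mem_filter, Finset.mem_univ, true_and, Prod.exists,
      Prod.map_apply, Prod.mk.injEq, not_exists, not_and, and_imp]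
    intro u v h1 _ hu hv
    have hu' : u = b := by rw [← hττ u, hu, hτa]
    have hv' : v = a := by rw [← hττ v, hv, hτb]
    subst hu' hv'
    exact absurd h1 hlt.asymm
  rw [invCount, hset, Finset.card_insert_of_notMem hnot,
    Finset.card_image_of_injective _ (τ.injective.prodMap τ.injective), invCount]

/-- Functions on `Fin N` can be sorted by adjacent transpositions. -/
theorem sort_induction {N N' : ℕ} {P : (Fin N → Fin N') → Prop}
    (mono : ∀ k, Monotone k → P k)
    (swap : ∀ k (a b : Fin N), (a : ℕ) + 1 = b → k a < k b → P k → P (k ∘ Equiv.swap a b))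
    (k : Fin N → Fin N') : P k := by
  induction hn : invCount k using Nat.strong_induction_on generalizing k with
  | _ n ih =>
    by_cases hk : ∀ a b : Fin N, (a : ℕ) + 1 = b → k a ≤ k b
    · refine mono k ?_
      intro a b hab
      obtain ⟨d, hd⟩ := Nat.exists_eq_add_of_le (Fin.le_def.mp hab)
      induction d generalizing b with
      | zero => rw [show b = a from Fin.ext (by omega)]
      | succ d ihd =>
        have h1 : (a : ℕ) + d < N := by omega
        exact (ihd (b := ⟨a + d, h1⟩) (Fin.le_def.mpr (Nat.le_add_right _ _)) rfl).trans
          (hk (⟨a + d, h1⟩ : Fin N) b (by rw [hd, add_assoc]))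
    · push Not at hk
      obtain ⟨a, b, hab, hlt⟩ := hk
      -- A function that is not monotone descends at some pair of neighbours; undoing this descent
      -- removes exactly one inversion.
      have h1 : (k ∘ Equiv.swap a b) a < (k ∘ Equiv.swap a b) b := by simpa using hlt
      have h2 := invCount_comp_swap _ hab h1
      have h3 : (k ∘ Equiv.swap a b) ∘ Equiv.swap a b = k := by ext x; simp
      rw [h3] at h2
      rw [← h3]
      exact swap _ a b hab h1 (ih (invCount (k ∘ Equiv.swap a b)) (by omega) _ rfl)

/-! ### Ordered products -/

/-- `P` and `Q` are fixed before `g`, so the same outer factors serve all products that differ only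
at the places `a` and `b`. -/
theorem ofFn_prod_split {A : Type*} [Monoid A] : ∀ {N : ℕ} (f : Fin N → A) (a b : Fin N),
    (a : ℕ) + 1 = b → ∃ P Q : A, ∀ g : Fin N → A, (∀ i, i ≠ a → i ≠ b → g i = f i) →
      (List.ofFn g).prod = P * (g a * g b) * Q := by
  intro N
  induction N with
  | zero => intro f a; exact a.elim0
  | succ N ih =>
    intro f a b hab
    induction a using Fin.cases with
    | zero =>
      cases N with
      | zero => exact absurd hab (by have := b.isLt; simp at *)
      | succ N =>
        have hb : b = Fin.succ 0 := Fin.ext (by simpa using hab.symm)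
        subst hb
        refine ⟨1, (List.ofFn fun i : Fin N => f i.succ.succ).prod, fun g hg => ?_⟩
        rw [List.ofFn_succ, List.ofFn_succ, List.prod_cons, List.prod_cons, one_mul, mul_assoc]
        congr 4
        funext i
        exact hg _ (Fin.succ_ne_zero _) (fun h => Fin.succ_ne_zero i (Fin.succ_injective _ h))
    | succ a =>
      induction b using Fin.cases with
      | zero => simp at hab
      | succ b =>
        obtain ⟨P, Q, h⟩ := ih (fun i => f i.succ) a b (by simpa using hab)
        refine ⟨f 0 * P, Q, fun g hg => ?_⟩
        rw [List.ofFn_succ, List.prod_cons, h (fun i => g i.succ)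
          (fun i h1 h2 => hg _ (fun h => h1 (Fin.succ_injective _ h))
            (fun h => h2 (Fin.succ_injective _ h))),
          hg 0 (Fin.succ_ne_zero _).symm (Fin.succ_ne_zero _).symm]
        simp only [mul_assoc]

theorem ofFn_prod_mul {A : Type*} [Monoid A] : ∀ {N : ℕ} (f g : Fin N → A),
    (∀ i j, Commute (f i) (g j)) →
      (List.ofFn fun i => f i * g i).prod = (List.ofFn f).prod * (List.ofFn g).prod := by
  intro N
  induction N with
  | zero => intro f g _; simp
  | succ N ih =>
    intro f g h
    have h2 : Commute (g 0) (List.ofFn fun i => f i.succ).prod := by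
      refine Commute.list_prod_right _ _ fun x hx => ?_
      obtain ⟨i, rfl⟩ := (List.mem_ofFn' _ _).mp hx
      exact (h _ _).symm
    simp only [List.ofFn_succ, List.prod_cons]
    rw [ih _ _ fun i j => h i.succ j.succ]
    simp only [mul_assoc]
    rw [← mul_assoc (g 0), h2.eq, mul_assoc]

theorem ofFn_prod_sum {A : Type*} [Semiring A] {ι : Type*} [Fintype ι] : ∀ {N : ℕ}
    (f : Fin N → ι → A), (List.ofFn fun j => ∑ i, f j i).prod =
      ∑ k : Fin N → ι, (List.ofFn fun j => f j (k j)).prod := by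
  intro N
  induction N with
  | zero => intro f; simp
  | succ N ih =>
    intro f
    rw [← (Fin.consEquiv fun _ : Fin (N + 1) => ι).sum_comp, Fintype.sum_prod_type]
    simp only [List.ofFn_succ, List.prod_cons, ih, Fin.consEquiv_apply, Fin.cons_zero,
      Fin.cons_succ, Finset.sum_mul, Finset.mul_sum]
    rw [Finset.sum_comm]

/-! ### Quantum matrices -/

section QMatrix

variable {A : Type} [Ring A] [Algebra ℂ A] {q : ℝ} {N : ℕ}

/-- The matrix `M` satisfies the relations of the quantum matrix algebra. -/
def IsQMatrix (q : ℝ) (M : Matrix (Fin N) (Fin N) A) : Prop := ∀ x y, QMatrixRel q M x y → x = y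

namespace IsQMatrix

variable {M : Matrix (Fin N) (Fin N) A}

theorem row (h : IsQMatrix q M) (α : Fin N) {a b : Fin N} (hab : a < b) :
    M α a * M α b = (q : ℂ) • (M α b * M α a) :=
  sub_eq_zero.mp (h _ _ (.qComm α α a b (Or.inr ⟨hab, rfl⟩)))

theorem col (h : IsQMatrix q M) (a : Fin N) {α β : Fin N} (hαβ : α < β) :
    M α a * M β a = (q : ℂ) • (M β a * M α a) :=
  sub_eq_zero.mp (h _ _ (.qComm α β a a (Or.inl ⟨rfl, hαβ⟩)))

theorem comm (h : IsQMatrix q M) {α β a b : Fin N} (hαβ : α < β) (hab : b < a) :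
    M α a * M β b = M β b * M α a :=
  sub_eq_zero.mp (h _ _ (.comm α β a b ⟨hαβ, hab⟩))

theorem cross (h : IsQMatrix q M) {α β a b : Fin N} (hαβ : α < β) (hab : a < b) :
    M α a * M β b = M β b * M α a + ((q : ℂ) - (q : ℂ)⁻¹) • (M β a * M α b) := by
  have := sub_eq_zero.mp (h _ _ (.cross α β a b ⟨hαβ, hab⟩))
  rw [← this]; abel

theorem of_relations (row : ∀ α a b, a < b → M α a * M α b = (q : ℂ) • (M α b * M α a))
    (col : ∀ a α β, α < β → M α a * M β a = (q : ℂ) • (M β a * M α a))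
    (comm : ∀ α β a b, α < β → b < a → M α a * M β b = M β b * M α a)
    (cross : ∀ α β a b, α < β → a < b →
      M α a * M β b = M β b * M α a + ((q : ℂ) - (q : ℂ)⁻¹) • (M β a * M α b)) :
    IsQMatrix q M := by
  rintro _ _ (⟨α, β, a, b, ⟨rfl, h⟩ | ⟨h, rfl⟩⟩ | ⟨α, β, a, b, h⟩ | ⟨α, β, a, b, h⟩)
  · exact sub_eq_zero.mpr (col _ _ _ h)
  · exact sub_eq_zero.mpr (row _ _ _ h)
  · exact sub_eq_zero.mpr (comm _ _ _ _ h.1 h.2)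
  · rw [cross _ _ _ _ h.1 h.2]; abel

/-- The cross relation is invariant under transposition because the two entries in its correction
term commute. -/
theorem transpose (h : IsQMatrix q M) : IsQMatrix q M.transpose :=
  of_relations (fun α _ _ hab => h.col α hab) (fun a _ _ hab => h.row a hab)
    (fun _ _ _ _ h1 h2 => (h.comm h2 h1).symm)
    (fun α β a b h1 h2 => by
      simp only [Matrix.transpose_apply]
      rw [h.cross h2 h1, h.comm h2 h1])

theorem submatrix (h : IsQMatrix q M) {N' : ℕ} {f g : Fin N' → Fin N} (hf : StrictMono f)
    (hg : StrictMono g) : IsQMatrix q (M.submatrix f g) :=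
  of_relations (fun _ _ _ hab => h.row _ (hg hab)) (fun _ _ _ hab => h.col _ (hf hab))
    (fun _ _ _ _ h1 h2 => h.comm (hf h1) (hg h2)) (fun _ _ _ _ h1 h2 => h.cross (hf h1) (hg h2))

end IsQMatrix

/-- Pairing of the terms of a `q`-determinant which differ by an adjacent transposition. -/
theorem exists_qDet_pairing (q : ℝ) (M : Matrix (Fin N) (Fin N) A) {a b : Fin N}
    (hab : (a : ℕ) + 1 = b) (k : Fin N → Fin N) :
    ∃ P Q : Equiv.Perm (Fin N) → A, ∀ k' : Fin N → Fin N, (∀ i, i ≠ a → i ≠ b → k' i = k i) →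
      qDet q (M.submatrix id k') = ∑ s : Equiv.Perm (Fin N) with s a < s b,
        (-(q : ℂ)) ^ permLength s • (P s *
          (M (s a) (k' a) * M (s b) (k' b) - (q : ℂ) • (M (s b) (k' a) * M (s a) (k' b))) * Q s) := by
  classical
  have hne : a ≠ b := by rintro rfl; omega
  choose P Q h using fun s : Equiv.Perm (Fin N) =>
    ofFn_prod_split (fun j => M (s j) (k j)) a b hab
  refine ⟨P, Q, fun k' hk' => ?_⟩
  -- Composition with the transposition matches the permutations that descend at `a, b` with those
  -- that ascend there.
  have hsplit : ∀ F : Equiv.Perm (Fin N) → A, ∑ s, F s =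
      ∑ s : Equiv.Perm (Fin N) with s a < s b, (F s + F (s * Equiv.swap a b)) := by
    intro F
    rw [← Finset.sum_filter_add_sum_filter_not Finset.univ
      (fun s : Equiv.Perm (Fin N) => s a < s b), Finset.sum_add_distrib]
    congr 1
    refine Finset.sum_bij (fun s _ => s * Equiv.swap a b) ?_ ?_ ?_ ?_
    · intro s hs
      simp only [Finset.mem_filter, Finset.mem_univ, true_and, not_lt] at hs
      simp only [Finset.mem_filter, Finset.mem_univ, true_and, Equiv.Perm.mul_apply,
        Equiv.swap_apply_left, Equiv.swap_apply_right]
      exact lt_of_le_of_ne hs fun h => hne (s.injective h.symm)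
    · intro s _ t _ hst
      exact mul_right_cancel hst
    · intro s hs
      refine ⟨s * Equiv.swap a b, ?_, by simp [mul_assoc]⟩
      simp only [Finset.mem_filter, Finset.mem_univ, true_and] at hs
      simp [hs.le]
    · intro s _
      simp [mul_assoc]
  rw [qDet, hsplit]
  refine Finset.sum_congr rfl fun s hs => ?_
  simp only [Finset.mem_filter, Finset.mem_univ, true_and] at hs
  have h1 := h s (fun j => M (s j) (k' j)) (fun i h1 h2 => by rw [hk' i h1 h2])
  have h2 := h s (fun j => M ((s * Equiv.swap a b) j) (k' j)) (fun i h1 h2 => by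
    rw [hk' i h1 h2, Equiv.Perm.mul_apply, Equiv.swap_apply_of_ne_of_ne h1 h2])
  have h3 : permLength (s * Equiv.swap a b) = permLength s + 1 := by
    rw [permLength_eq_invCount, permLength_eq_invCount, Equiv.Perm.coe_mul]
    exact invCount_comp_swap s hab hs
  simp only [Matrix.submatrix_apply, id_eq]
  rw [h1, h2, h3]
  simp only [Equiv.Perm.mul_apply, Equiv.swap_apply_left, Equiv.swap_apply_right]
  rw [mul_sub, sub_mul, smul_sub, mul_smul_comm, smul_mul_assoc, smul_smul, sub_eq_add_neg,
    ← neg_smul, pow_succ, mul_neg]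

/-- After the pairing only two rows and two columns matter: `key` says that the bracket
`M(α,a)M(β,b) - q M(β,a)M(α,b)` is multiplied by `-q` when its columns are exchanged, which is the
cross relation combined with `comm`. -/
theorem IsQMatrix.qDet_submatrix_swap {M : Matrix (Fin N) (Fin N) A} (h : IsQMatrix q M)
    (hq : q ≠ 0) (k : Fin N → Fin N) {a b : Fin N} (hab : (a : ℕ) + 1 = b) (hk : k a < k b) :
    qDet q (M.submatrix id (k ∘ Equiv.swap a b)) = -(q : ℂ) • qDet q (M.submatrix id k) := by
  have hq' : (q : ℂ) ≠ 0 := by exact_mod_cast hq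
  obtain ⟨P, Q, hPQ⟩ := exists_qDet_pairing q M hab k
  rw [hPQ k fun _ _ _ => rfl, hPQ _ fun i h1 h2 => by
    rw [Function.comp_apply, Equiv.swap_apply_of_ne_of_ne h1 h2], Finset.smul_sum]
  refine Finset.sum_congr rfl fun s hs => ?_
  simp only [Finset.mem_filter, Finset.mem_univ, true_and] at hs
  simp only [Function.comp_apply, Equiv.swap_apply_left, Equiv.swap_apply_right]
  have key : M (s a) (k b) * M (s b) (k a) - (q : ℂ) • (M (s b) (k b) * M (s a) (k a)) =
      -(q : ℂ) • (M (s a) (k a) * M (s b) (k b) - (q : ℂ) • (M (s b) (k a) * M (s a) (k b))) := by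
    rw [h.cross hs hk, h.comm hs hk, smul_sub, smul_add, smul_smul, smul_smul,
      show -(q : ℂ) * ((q : ℂ) - (q : ℂ)⁻¹) = 1 - (q : ℂ) * q by field_simp; ring]
    module
  rw [key, mul_smul_comm, smul_mul_assoc, smul_comm (-(q : ℂ))]

/-- With equal neighbouring columns each paired bracket vanishes by the column relation. -/
theorem IsQMatrix.qDet_submatrix_eq_zero {M : Matrix (Fin N) (Fin N) A} (h : IsQMatrix q M)
    (k : Fin N → Fin N) {a b : Fin N} (hab : (a : ℕ) + 1 = b) (hk : k a = k b) :
    qDet q (M.submatrix id k) = 0 := by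
  obtain ⟨P, Q, hPQ⟩ := exists_qDet_pairing q M hab k
  rw [hPQ k fun _ _ _ => rfl]
  refine Finset.sum_eq_zero fun s hs => ?_
  simp only [Finset.mem_filter, Finset.mem_univ, true_and] at hs
  rw [hk, h.col _ hs, sub_self, mul_zero, zero_mul, smul_zero]

/-- Sorting induction, for both cases at once since an exchange of positions does not affect
injectivity. A monotone `k` is the identity if it is injective, and otherwise has equal values at
two neighbours. -/
theorem IsQMatrix.qDet_submatrix_aux {M : Matrix (Fin N) (Fin N) A} (h : IsQMatrix q M)
    (hq : q ≠ 0) (k : Fin N → Fin N) :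
    (Function.Injective k → qDet q (M.submatrix id k) = (-(q : ℂ)) ^ invCount k • qDet q M) ∧
      (¬ Function.Injective k → qDet q (M.submatrix id k) = 0) := by
  refine sort_induction (P := fun k => (Function.Injective k →
    qDet q (M.submatrix id k) = (-(q : ℂ)) ^ invCount k • qDet q M) ∧
      (¬ Function.Injective k → qDet q (M.submatrix id k) = 0)) ?_ ?_ k
  · intro k hk
    constructor
    · intro hinj
      have h1 : k = id := by
        have := hk.strictMono_of_injective hinj
        exact (this.range_inj strictMono_id).mp
          ((Finite.injective_iff_surjective.mp hinj).range_eq.trans (by simp))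
      subst h1
      have : invCount (id : Fin N → Fin N) = 0 := by
        rw [invCount, Finset.card_eq_zero, Finset.filter_eq_empty_iff]
        rintro ⟨x, y⟩ _ ⟨h1, h2⟩
        exact absurd h1 (lt_asymm h2)
      rw [this, pow_zero, one_smul, Matrix.submatrix_id_id]
    · intro hinj
      have : ∃ a b : Fin N, (a : ℕ) + 1 = b ∧ k a = k b := by
        by_contra! hne
        apply hinj
        refine StrictMono.injective ?_
        intro a b hab
        have h1 : (a : ℕ) + 1 < N := by have := Fin.lt_def.mp hab; omega
        have h2 : a ≤ (⟨a + 1, h1⟩ : Fin N) := by simp [Fin.le_def]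
        have h3 : (⟨a + 1, h1⟩ : Fin N) ≤ b := by
          have := Fin.lt_def.mp hab; simp only [Fin.le_def]; omega
        exact (lt_of_le_of_ne (hk h2) (hne _ _ rfl)).trans_le (hk h3)
      obtain ⟨a, b, hab, hk'⟩ := this
      exact h.qDet_submatrix_eq_zero k hab hk'
  · intro k a b hab hlt ⟨ih1, ih2⟩
    have hinj : Function.Injective (k ∘ Equiv.swap a b) ↔ Function.Injective k :=
      Equiv.injective_comp (Equiv.swap a b) k
    rw [hinj, h.qDet_submatrix_swap hq k hab hlt, invCount_comp_swap k hab hlt]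
    refine ⟨fun hi => ?_, fun hi => by rw [ih2 hi, smul_zero]⟩
    rw [ih1 hi, smul_smul, pow_succ']

theorem IsQMatrix.qDet_submatrix_of_injective {M : Matrix (Fin N) (Fin N) A} (h : IsQMatrix q M)
    (hq : q ≠ 0) {k : Fin N → Fin N} (hk : Function.Injective k) :
    qDet q (M.submatrix id k) = (-(q : ℂ)) ^ invCount k • qDet q M :=
  (h.qDet_submatrix_aux hq k).1 hk

theorem IsQMatrix.qDet_submatrix_of_not_injective {M : Matrix (Fin N) (Fin N) A}
    (h : IsQMatrix q M) (hq : q ≠ 0) {k : Fin N → Fin N} (hk : ¬ Function.Injective k) :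
    qDet q (M.submatrix id k) = 0 :=
  (h.qDet_submatrix_aux hq k).2 hk

/-- A sum over functions which vanishes off the permutations. -/
theorem sum_fun_eq_sum_perm {A : Type*} [AddCommMonoid A] {N : ℕ} (F : (Fin N → Fin N) → A)
    (hF : ∀ k, ¬ Function.Injective k → F k = 0) :
    ∑ k, F k = ∑ s : Equiv.Perm (Fin N), F s := by
  classical
  rw [← Finset.sum_filter_add_sum_filter_not Finset.univ (fun k : Fin N → Fin N =>
    Function.Bijective k), Finset.sum_eq_zero (s := Finset.filter (fun k => ¬ _) _) (f := F),
    add_zero]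
  · refine (Finset.sum_bij (fun (s : Equiv.Perm (Fin N)) _ => (s : Fin N → Fin N)) ?_ ?_ ?_ ?_).symm
    · intro s _; exact Finset.mem_filter.mpr ⟨Finset.mem_univ _, s.bijective⟩
    · intro s _ t _ h; exact DFunLike.coe_injective h
    · intro k hk
      simp only [Finset.mem_filter, Finset.mem_univ, true_and] at hk
      exact ⟨Equiv.ofBijective k hk, Finset.mem_univ _, rfl⟩
    · intro s _; rfl
  · intro k hk
    simp only [Finset.mem_filter, Finset.mem_univ, true_and] at hk
    exact hF k fun h => hk (Finite.injective_iff_bijective.mp h)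

/-- The `q`-determinant is multiplicative for matrices with commuting entries. -/
theorem IsQMatrix.qDet_mul {M M' : Matrix (Fin N) (Fin N) A} (h : IsQMatrix q M)
    (hq : q ≠ 0) (hc : ∀ i j k l, Commute (M i j) (M' k l)) :
    qDet q (M * M') = qDet q M * qDet q M' := by
  have h1 : ∀ s : Equiv.Perm (Fin N), (List.ofFn fun j => (M * M') (s j) j).prod =
      ∑ k : Fin N → Fin N, (List.ofFn fun j => M (s j) (k j)).prod *
        (List.ofFn fun j => M' (k j) j).prod := by
    intro s
    simp only [Matrix.mul_apply]
    rw [ofFn_prod_sum]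
    refine Finset.sum_congr rfl fun k _ => ?_
    exact ofFn_prod_mul _ _ fun i j => hc _ _ _ _
  -- Expanding the entries of the product lets an arbitrary function `k` choose the columns of `M`;
  -- the sum over `s` is then the determinant of `M` with these columns, which vanishes unless `k`
  -- is a permutation.
  calc qDet q (M * M') = ∑ k : Fin N → Fin N, qDet q (M.submatrix id k) *
        (List.ofFn fun j => M' (k j) j).prod := by
        simp only [qDet, h1, Finset.smul_sum, Finset.sum_mul, Matrix.submatrix_apply, id_eq,
          smul_mul_assoc]
        rw [Finset.sum_comm]
    _ = ∑ s : Equiv.Perm (Fin N), qDet q (M.submatrix id s) *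
        (List.ofFn fun j => M' (s j) j).prod :=
        sum_fun_eq_sum_perm _ fun k hk => by
          rw [h.qDet_submatrix_of_not_injective hq hk, zero_mul]
    _ = _ := by
        rw [qDet, qDet, Finset.mul_sum]
        refine Finset.sum_congr rfl fun s _ => ?_
        rw [h.qDet_submatrix_of_injective hq s.injective, ← permLength_eq_invCount, smul_mul_assoc,
          mul_smul_comm, qDet]

/-- The sum over pairs `(r, s)` of `(-q)^{l(r)+l(s)} ∏ M_{s(j),r(j)}` equals `c · det_q M`, because
permuting the columns by `r` gives the factor `(-q)^{l(r)}` a second time. Exchanging `r` and `s`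
transposes `M`, and `c`, a sum of squares of nonzero reals, can be cancelled. -/
theorem IsQMatrix.qDet_transpose {M : Matrix (Fin N) (Fin N) A} (h : IsQMatrix q M)
    (hq : q ≠ 0) : qDet q M.transpose = qDet q M := by
  set c : ℂ := ∑ s : Equiv.Perm (Fin N), (-(q : ℂ)) ^ permLength s * (-(q : ℂ)) ^ permLength s
  have hc : c ≠ 0 := by
    have h1 : c = ((∑ s : Equiv.Perm (Fin N), (q ^ permLength s) ^ 2 : ℝ) : ℂ) := by
      push_cast
      refine Finset.sum_congr rfl fun s _ => ?_
      rw [← mul_pow, neg_mul_neg, ← pow_two, pow_right_comm]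
    rw [h1]
    norm_cast
    have : (0 : ℝ) < ∑ s : Equiv.Perm (Fin N), (q ^ permLength s) ^ 2 :=
      Finset.sum_pos (fun s _ => by positivity) ⟨1, Finset.mem_univ _⟩
    exact this.ne'
  have key : ∀ M : Matrix (Fin N) (Fin N) A, IsQMatrix q M →
      ∑ r : Equiv.Perm (Fin N), ∑ s : Equiv.Perm (Fin N),
        ((-(q : ℂ)) ^ permLength r * (-(q : ℂ)) ^ permLength s) •
          (List.ofFn fun j => M (s j) (r j)).prod = c • qDet q M := by
    intro M h
    rw [Finset.sum_smul]
    refine Finset.sum_congr rfl fun r _ => ?_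
    have := h.qDet_submatrix_of_injective hq r.injective
    rw [← permLength_eq_invCount, qDet] at this
    simp only [mul_smul, ← Finset.smul_sum]
    rw [← this]
    rfl
  have h1 := key M h
  have h2 := key _ h.transpose
  rw [Finset.sum_comm] at h2
  simp only [Matrix.transpose_apply] at h2
  refine smul_right_injective A hc ?_
  simp only
  rw [← h1, ← h2]
  refine Finset.sum_congr rfl fun r _ => Finset.sum_congr rfl fun s _ => ?_
  rw [mul_comm]

end QMatrix

/-! ### Laplace expansions -/

/-- The permutation which sends `p` to `i` and is given by `s` on the complements. -/
def permInsert {N : ℕ} (p i : Fin (N + 1)) (s : Equiv.Perm (Fin N)) : Equiv.Perm (Fin (N + 1)) :=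
  (finSuccEquiv' p).trans ((Equiv.optionCongr s).trans (finSuccEquiv' i).symm)

theorem permInsert_apply_self {N : ℕ} (p i : Fin (N + 1)) (s : Equiv.Perm (Fin N)) :
    permInsert p i s p = i := by
  simp [permInsert]

theorem permInsert_apply_succAbove {N : ℕ} (p i : Fin (N + 1)) (s : Equiv.Perm (Fin N))
    (j : Fin N) : permInsert p i s (p.succAbove j) = i.succAbove (s j) := by
  simp [permInsert]

theorem permInsert_bijective {N : ℕ} (p : Fin (N + 1)) :
    Function.Bijective fun x : Fin (N + 1) × Equiv.Perm (Fin N) => permInsert p x.1 x.2 := by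
  classical
  rw [Fintype.bijective_iff_injective_and_card]
  constructor
  · rintro ⟨i, s⟩ ⟨i', s'⟩ h
    simp only at h
    have h1 : i = i' := by
      rw [← permInsert_apply_self p i s, h, permInsert_apply_self]
    subst h1
    refine Prod.ext rfl (Equiv.ext fun j => ?_)
    have h2 := permInsert_apply_succAbove p i s j
    rw [h, permInsert_apply_succAbove] at h2
    exact (Fin.succAbove_right_injective h2).symm
  · rw [Fintype.card_prod, Fintype.card_perm, Fintype.card_perm, Fintype.card_fin,
      Fintype.card_fin, Nat.factorial_succ]

theorem invCount_eq_sum {N N' : ℕ} (k : Fin N → Fin N') :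
    invCount k = ∑ a, ∑ b, if a < b ∧ k b < k a then 1 else 0 := by
  rw [invCount, Finset.card_filter, Fintype.sum_prod_type]

/-- Position `0` precedes all the others, and its value `i` exceeds exactly `i` of the remaining
values. -/
theorem invCount_permInsert_zero {N : ℕ} (i : Fin (N + 1)) (s : Equiv.Perm (Fin N)) :
    invCount (permInsert 0 i s) = invCount s + i := by
  have h1 : ∑ b : Fin N, (if i.succAbove (s b) < i then 1 else 0) = (i : ℕ) := by
    rw [Equiv.sum_comp s fun b => if i.succAbove b < i then 1 else 0]
    simp only [Fin.succAbove_lt_iff_castSucc_lt]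
    simp only [Fin.lt_def, Fin.val_castSucc]
    rw [← Finset.card_filter, Fin.card_filter_val_lt]
    exact min_eq_right (by omega)
  have h0 : ∀ j : Fin N, permInsert 0 i s j.succ = i.succAbove (s j) := fun j => by
    rw [← permInsert_apply_succAbove 0 i s j, Fin.zero_succAbove]
  rw [invCount_eq_sum, invCount_eq_sum, Fin.sum_univ_succ, Fin.sum_univ_succ, add_comm]
  simp only [Fin.sum_univ_succ, permInsert_apply_self, h0, Fin.succ_pos, true_and,
    Fin.not_lt_zero, false_and, if_false, zero_add, Fin.succ_lt_succ_iff,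
    Fin.succAbove_lt_succAbove_iff, lt_irrefl, h1]

/-- The last position follows all the others, and exactly `N - i` of the remaining values exceed its
value `i`. -/
theorem invCount_permInsert_last {N : ℕ} (i : Fin (N + 1)) (s : Equiv.Perm (Fin N)) :
    invCount (permInsert (Fin.last N) i s) = invCount s + (N - i) := by
  have h1 : ∑ b : Fin N, (if i < i.succAbove (s b) then 1 else 0) = N - (i : ℕ) := by
    rw [Equiv.sum_comp s fun b => if i < i.succAbove b then 1 else 0]
    simp only [Fin.lt_succAbove_iff_le_castSucc]
    simp only [Fin.le_def, Fin.val_castSucc]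
    have h2 := Finset.card_filter_add_card_filter_not (s := Finset.univ (α := Fin N))
      (fun x => (x : ℕ) < i)
    rw [Fin.card_filter_val_lt, min_eq_right (by omega), Finset.card_univ, Fintype.card_fin] at h2
    simp only [not_lt] at h2
    rw [← Finset.card_filter]
    omega
  have h0 : ∀ j : Fin N, permInsert (Fin.last N) i s j.castSucc = i.succAbove (s j) := fun j => by
    rw [← permInsert_apply_succAbove (Fin.last N) i s j, Fin.succAbove_last]
  have h3 : ∀ j : Fin N, ¬ Fin.last N < j.castSucc := fun j => (Fin.castSucc_lt_last j).asymm
  rw [invCount_eq_sum, invCount_eq_sum, Fin.sum_univ_castSucc]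
  simp only [Fin.sum_univ_castSucc, permInsert_apply_self, h0, Fin.castSucc_lt_last, true_and,
    h3, false_and, if_false, add_zero, Fin.castSucc_lt_castSucc_iff,
    Fin.succAbove_lt_succAbove_iff, lt_irrefl, Finset.sum_add_distrib, Finset.sum_const_zero, h1]

section QMatrix

variable {A : Type} [Ring A] [Algebra ℂ A] {q : ℝ} {N : ℕ}

/-- The permutations are grouped by the row `i` assigned to the first column. The columns are picked
by an arbitrary `k`, repetitions allowed, so that the expansion also applies to cofactors of a
different column. -/
theorem qDet_expand_first (q : ℝ) (M : Matrix (Fin (N + 1)) (Fin (N + 1)) A)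
    (k : Fin (N + 1) → Fin (N + 1)) :
    qDet q (M.submatrix id k) = ∑ i : Fin (N + 1), (-(q : ℂ)) ^ (i : ℕ) • (M i (k 0) *
      qDet q (M.submatrix i.succAbove fun j => k j.succ)) := by
  have h0 : ∀ i s (j : Fin N), permInsert 0 i s j.succ = i.succAbove (s j) := fun i s j => by
    rw [← permInsert_apply_succAbove 0 i s j, Fin.zero_succAbove]
  rw [qDet, ← (permInsert_bijective 0).sum_comp, Fintype.sum_prod_type]
  refine Finset.sum_congr rfl fun i _ => ?_
  rw [qDet, Finset.mul_sum, Finset.smul_sum]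
  refine Finset.sum_congr rfl fun s _ => ?_
  rw [permLength_eq_invCount, invCount_permInsert_zero, List.ofFn_succ, List.prod_cons]
  simp only [Matrix.submatrix_apply, id_eq, permInsert_apply_self, h0]
  rw [mul_smul_comm, smul_smul, ← pow_add, add_comm, ← permLength_eq_invCount]

theorem qDet_expand_last (q : ℝ) (M : Matrix (Fin (N + 1)) (Fin (N + 1)) A)
    (k : Fin (N + 1) → Fin (N + 1)) :
    qDet q (M.submatrix id k) = ∑ i : Fin (N + 1), (-(q : ℂ)) ^ (N - (i : ℕ)) •
      (qDet q (M.submatrix i.succAbove fun j => k j.castSucc) * M i (k (Fin.last N))) := by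
  have h0 : ∀ i s (j : Fin N), permInsert (Fin.last N) i s j.castSucc = i.succAbove (s j) :=
    fun i s j => by rw [← permInsert_apply_succAbove (Fin.last N) i s j, Fin.succAbove_last]
  rw [qDet, ← (permInsert_bijective (Fin.last N)).sum_comp, Fintype.sum_prod_type]
  refine Finset.sum_congr rfl fun i _ => ?_
  rw [qDet, Finset.sum_mul, Finset.smul_sum]
  refine Finset.sum_congr rfl fun s _ => ?_
  rw [permLength_eq_invCount, invCount_permInsert_last, List.ofFn_succ', List.concat_eq_append,
    List.prod_append, List.prod_singleton]
  simp only [Matrix.submatrix_apply, id_eq, permInsert_apply_self, h0]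
  rw [smul_mul_assoc, smul_smul, ← pow_add, add_comm, ← permLength_eq_invCount]

/-- The quantum cofactor `(-q)^{j-i} det_q M_{ij}`. -/
def qCofactor (q : ℝ) (M : Matrix (Fin N) (Fin N) A) (i j : Fin N) : A :=
  (-(q : ℂ)) ^ ((j : ℤ) - (i : ℤ)) • qMinor q M i j

/-- The sum is, up to a power of `-q`, the expansion along the last column of the matrix whose
columns are those other than `d`, followed by `c`. If `c = d` this is a permutation of columns with
`N - c` inversions; otherwise column `c` is repeated. -/
theorem IsQMatrix.sum_qCofactor_mul {M : Matrix (Fin N) (Fin N) A} (h : IsQMatrix q M)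
    (hq : q ≠ 0) (c d : Fin N) :
    ∑ i, qCofactor q M i d * M i c = if c = d then qDet q M else 0 := by
  have hq' : (-(q : ℂ)) ≠ 0 := by simpa using hq
  cases N with
  | zero => exact c.elim0
  | succ N =>
    set k : Fin (N + 1) → Fin (N + 1) := Fin.snoc (α := fun _ => Fin (N + 1)) d.succAbove c with hk
    have hk1 : ∀ j : Fin N, k j.castSucc = d.succAbove j := fun j => by simp [hk]
    have hk2 : k (Fin.last N) = c := by simp [hk]
    have h1 := qDet_expand_last q M k
    simp only [hk1, hk2] at h1
    have h2 : ∑ i, qCofactor q M i d * M i c =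
        (-(q : ℂ)) ^ ((d : ℤ) - N) • qDet q (M.submatrix id k) := by
      rw [h1, Finset.smul_sum]
      refine Finset.sum_congr rfl fun i _ => ?_
      rw [qCofactor, smul_smul, smul_mul_assoc, ← zpow_natCast, ← zpow_add₀ hq',
        Nat.cast_sub (by omega)]
      congr 2
      ring
    rw [h2]
    split_ifs with hcd
    · subst hcd
      have h3 : k = permInsert (Fin.last N) c 1 := by
        funext x
        refine Fin.lastCases ?_ (fun j => ?_) x
        · rw [hk2, permInsert_apply_self]
        · rw [hk1, ← Fin.succAbove_last, permInsert_apply_succAbove]; rfl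
      have h4 : invCount ((1 : Equiv.Perm (Fin N)) : Fin N → Fin N) = 0 := by
        rw [invCount, Finset.card_eq_zero, Finset.filter_eq_empty_iff]
        rintro ⟨x, y⟩ _ ⟨h1, h2⟩
        exact absurd h1 (lt_asymm h2)
      rw [h3, h.qDet_submatrix_of_injective hq (Equiv.injective _), invCount_permInsert_last, h4,
        smul_smul, ← zpow_natCast, ← zpow_add₀ hq', zero_add, Nat.cast_sub (by omega)]
      simp
    · rw [h.qDet_submatrix_of_not_injective hq, smul_zero]
      intro hinj
      obtain ⟨j, hj⟩ := Fin.exists_succAbove_eq hcd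
      have := @hinj j.castSucc (Fin.last N) (by rw [hk1, hk2, hj])
      exact (Fin.castSucc_lt_last j).ne this

theorem qMinor_transpose {M : Matrix (Fin N) (Fin N) A} (h : IsQMatrix q M) (hq : q ≠ 0)
    (i j : Fin N) : qMinor q M.transpose i j = qMinor q M j i := by
  cases N with
  | zero => exact i.elim0
  | succ N =>
    exact (h.submatrix (Fin.strictMono_succAbove j) (Fin.strictMono_succAbove i)).qDet_transpose hq

/-- The expansions above are along columns; the row version is the expansion of the transpose, which
has the same determinant and minors. -/
theorem IsQMatrix.sum_mul_qCofactor {M : Matrix (Fin N) (Fin N) A} (h : IsQMatrix q M)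
    (hq : q ≠ 0) (c d : Fin N) :
    ∑ i, M c i * qCofactor q M d i = if c = d then qDet q M else 0 := by
  have hq' : (-(q : ℂ)) ≠ 0 := by simpa using hq
  cases N with
  | zero => exact c.elim0
  | succ N =>
    set k : Fin (N + 1) → Fin (N + 1) := Fin.cons (α := fun _ => Fin (N + 1)) c d.succAbove with hk
    have hk1 : ∀ j : Fin N, k j.succ = d.succAbove j := fun j => by simp [hk]
    have hk2 : k 0 = c := by simp [hk]
    have h1 := qDet_expand_first q M.transpose k
    simp only [hk1, hk2] at h1
    have h2 : ∑ i, M c i * qCofactor q M d i =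
        (-(q : ℂ)) ^ (-(d : ℤ)) • qDet q (M.transpose.submatrix id k) := by
      rw [h1, Finset.smul_sum]
      refine Finset.sum_congr rfl fun i _ => ?_
      rw [qCofactor, smul_smul, mul_smul_comm, ← zpow_natCast, ← zpow_add₀ hq',
        ← qMinor_transpose h hq]
      congr 2
      ring
    rw [h2]
    split_ifs with hcd
    · subst hcd
      have h3 : k = permInsert 0 c 1 := by
        funext x
        refine Fin.cases ?_ (fun j => ?_) x
        · rw [hk2, permInsert_apply_self]
        · rw [hk1, ← Fin.zero_succAbove, permInsert_apply_succAbove]; rfl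
      have h4 : invCount ((1 : Equiv.Perm (Fin N)) : Fin N → Fin N) = 0 := by
        rw [invCount, Finset.card_eq_zero, Finset.filter_eq_empty_iff]
        rintro ⟨x, y⟩ _ ⟨h1, h2⟩
        exact absurd h1 (lt_asymm h2)
      rw [h3, h.transpose.qDet_submatrix_of_injective hq (Equiv.injective _),
        invCount_permInsert_zero, h4, smul_smul, ← zpow_natCast, ← zpow_add₀ hq', zero_add,
        h.qDet_transpose hq]
      simp
    · rw [h.transpose.qDet_submatrix_of_not_injective hq, smul_zero]
      intro hinj
      obtain ⟨j, hj⟩ := Fin.exists_succAbove_eq hcd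
      have := @hinj j.succ 0 (by rw [hk1, hk2, hj])
      exact Fin.succ_ne_zero j this

end QMatrix

/-! ### The universal properties of the presented `*`-algebras -/

section Lift

variable {X : Type} {E : Type*} [Ring E] [Algebra ℂ E] [StarRing E]

/-- The homomorphism of the free `*`-algebra with given values on the generators. -/
def FreeStarAlgebra.lift (f : X → E) : FreeStarAlgebra X →ₐ[ℂ] E :=
  FreeAlgebra.lift ℂ (Sum.elim f (star ∘ f))

theorem FreeStarAlgebra.lift_letter (f : X → E) (y : X ⊕ X) :
    FreeStarAlgebra.lift f (letter y) = Sum.elim f (star ∘ f) y :=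
  FreeAlgebra.lift_ι_apply _ _

theorem FreeStarAlgebra.lift_gen (f : X → E) (x : X) : FreeStarAlgebra.lift f (gen x) = f x :=
  FreeStarAlgebra.lift_letter f _

theorem FreeStarAlgebra.induction {P : FreeStarAlgebra X → Prop}
    (algebraMap : ∀ c, P (algebraMap ℂ _ c)) (letter : ∀ y, P (letter y))
    (mul : ∀ a b, P a → P b → P (a * b)) (add : ∀ a b, P a → P b → P (a + b))
    (a : FreeStarAlgebra X) : P a :=
  FreeAlgebra.induction ℂ (X ⊕ X) (motive := P) algebraMap letter mul add a

theorem FreeStarAlgebra.lift_star [StarModule ℂ E] (f : X → E) (a : FreeStarAlgebra X) :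
    FreeStarAlgebra.lift f (star a) = star (FreeStarAlgebra.lift f a) := by
  refine FreeStarAlgebra.induction (P := fun a => FreeStarAlgebra.lift f (star a) =
    star (FreeStarAlgebra.lift f a)) ?_ ?_ ?_ ?_ a
  · intro c
    rw [FreeStarAlgebra.star_algebraMap, AlgHom.commutes, AlgHom.commutes, algebraMap_star_comm]
  · rintro (x | x)
    · rw [FreeStarAlgebra.star_letter, lift_letter, lift_letter]; rfl
    · rw [FreeStarAlgebra.star_letter, lift_letter, lift_letter]; simp
  · intro a b ha hb
    rw [star_mul, map_mul, map_mul, star_mul, ha, hb]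
  · intro a b ha hb
    rw [star_add, map_add, map_add, star_add, ha, hb]

namespace StarPresented

variable {r : FreeStarAlgebra X → FreeStarAlgebra X → Prop}

/-- The `*`-homomorphism with values on the generators that satisfy the relations. -/
def lift [StarModule ℂ E] (f : X → E)
    (h : ∀ a b, r a b → FreeStarAlgebra.lift f a = FreeStarAlgebra.lift f b) :
    StarPresented r →⋆ₐ[ℂ] E :=
  have h' : ∀ ⦃a b⦄, starClosure r a b → FreeStarAlgebra.lift f a = FreeStarAlgebra.lift f b := by
    rintro a b (hab | hab)
    · exact h a b hab
    · have := h _ _ hab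
      rw [FreeStarAlgebra.lift_star, FreeStarAlgebra.lift_star] at this
      exact star_injective this
  { RingQuot.liftAlgHom ℂ ⟨FreeStarAlgebra.lift f, h'⟩ with
    map_star' := fun a => by
      obtain ⟨a, rfl⟩ := mk_surjective r a
      have h2 : ∀ b, (RingQuot.liftAlgHom ℂ ⟨FreeStarAlgebra.lift f, h'⟩ :
          StarPresented r →ₐ[ℂ] E) (mk r b) = FreeStarAlgebra.lift f b :=
        fun b => RingQuot.liftAlgHom_mkAlgHom_apply ℂ _ _ b
      rw [star_mk]
      exact (h2 _).trans ((FreeStarAlgebra.lift_star f a).trans (congrArg star (h2 a).symm)) }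

theorem lift_gen [StarModule ℂ E] (f : X → E)
    (h : ∀ a b, r a b → FreeStarAlgebra.lift f a = FreeStarAlgebra.lift f b) (x : X) :
    lift f h (gen r x) = f x :=
  (RingQuot.liftAlgHom_mkAlgHom_apply ℂ _ _ _).trans (FreeStarAlgebra.lift_gen f x)

theorem induction {P : StarPresented r → Prop} (algebraMap : ∀ c, P (algebraMap ℂ _ c))
    (gen : ∀ x, P (gen r x)) (star_gen : ∀ x, P (star (StarPresented.gen r x)))
    (mul : ∀ a b, P a → P b → P (a * b)) (add : ∀ a b, P a → P b → P (a + b))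
    (a : StarPresented r) : P a := by
  obtain ⟨a, rfl⟩ := mk_surjective r a
  refine FreeStarAlgebra.induction (P := fun a => P (mk r a)) ?_ ?_ ?_ ?_ a
  · intro c; rw [AlgHom.commutes]; exact algebraMap c
  · rintro (x | x)
    · exact gen x
    · have := star_gen x
      rwa [StarPresented.gen, star_mk, FreeStarAlgebra.gen, FreeStarAlgebra.star_letter] at this
  · intro a b ha hb; rw [map_mul]; exact mul _ _ ha hb
  · intro a b ha hb; rw [map_add]; exact add _ _ ha hb

theorem hom_ext {f g : StarPresented r →⋆ₐ[ℂ] E} (h : ∀ x, f (gen r x) = g (gen r x)) : f = g := by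
  ext a
  refine induction (P := fun a => f a = g a) ?_ h ?_ ?_ ?_ a
  · intro c; rw [AlgHomClass.commutes, AlgHomClass.commutes]
  · intro x; rw [map_star, map_star, h]
  · intro a b ha hb; rw [map_mul, map_mul, ha, hb]
  · intro a b ha hb; rw [map_add, map_add, ha, hb]

theorem mk_eq_of_rel {a b : FreeStarAlgebra X} (h : r a b) : mk r a = mk r b :=
  RingQuot.mkAlgHom_rel ℂ (Or.inl h)

end StarPresented

end Lift

/-! ### Functoriality of the relations -/

section Map

variable {A B : Type} [Ring A] [Algebra ℂ A] [Ring B] [Algebra ℂ B] {q : ℝ} {N : ℕ}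

theorem QMatrixRel.map {M : Matrix (Fin N) (Fin N) A} (F : A →ₐ[ℂ] B) {x y : A}
    (h : QMatrixRel q M x y) : QMatrixRel q (M.map F) (F x) (F y) := by
  cases h with
  | qComm α β a b h =>
    rw [map_sub, map_smul, map_mul, map_mul, map_zero]
    exact .qComm (M := M.map F) α β a b h
  | comm α β a b h =>
    rw [map_sub, map_mul, map_mul, map_zero]
    exact .comm (M := M.map F) α β a b h
  | cross α β a b h =>
    rw [map_sub, map_sub, map_smul, map_mul, map_mul, map_mul, map_zero]
    exact .cross (M := M.map F) α β a b h

/-- `M` need not be a quantum matrix: for the matrix of free generators this expresses that a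
homomorphism respects the relations. -/
theorem isQMatrix_map_iff {M : Matrix (Fin N) (Fin N) A} (F : A →ₐ[ℂ] B) :
    IsQMatrix q (M.map F) ↔ ∀ x y, QMatrixRel q M x y → F x = F y := by
  refine ⟨fun h x y hxy => h _ _ (hxy.map F), fun h => ?_⟩
  rintro _ _ (⟨α, β, a, b, h1⟩ | ⟨α, β, a, b, h1⟩ | ⟨α, β, a, b, h1⟩)
  · have := h _ _ (.qComm α β a b h1)
    rwa [map_sub, map_smul, map_mul, map_mul, map_zero] at this
  · have := h _ _ (.comm α β a b h1)
    rwa [map_sub, map_mul, map_mul, map_zero] at this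
  · have := h _ _ (.cross α β a b h1)
    rwa [map_sub, map_sub, map_smul, map_mul, map_mul, map_mul, map_zero] at this

theorem IsQMatrix.map {M : Matrix (Fin N) (Fin N) A} (h : IsQMatrix q M) (F : A →ₐ[ℂ] B) :
    IsQMatrix q (M.map F) :=
  (isQMatrix_map_iff F).mpr fun x y hxy => by rw [h x y hxy]

theorem map_qDet (F : A →ₐ[ℂ] B) (M : Matrix (Fin N) (Fin N) A) :
    F (qDet q M) = qDet q (M.map F) := by
  simp only [qDet, map_sum, map_smul, map_list_prod, List.map_ofFn, Matrix.map_apply]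
  rfl

theorem map_qMinor (F : A →ₐ[ℂ] B) (M : Matrix (Fin N) (Fin N) A) (i j : Fin N) :
    F (qMinor q M i j) = qMinor q (M.map F) i j := by
  cases N with
  | zero => exact i.elim0
  | succ N => exact map_qDet F _

end Map

/-! ### The relations in `R`-matrix form -/

section FRT

variable {A : Type} [Ring A] [Algebra ℂ A] {q : ℝ} {N : ℕ}

/-- Coefficients of the flip in the `R`-matrix. -/
def flipCoeff (q : ℝ) (i j : Fin N) : ℂ := if i = j then (q : ℂ) else 1

/-- Coefficients of the identity in the `R`-matrix. -/
def idCoeff (q : ℝ) (i j : Fin N) : ℂ := if i < j then (q : ℂ) - (q : ℂ)⁻¹ else 0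

theorem flipCoeff_comm (i j : Fin N) : flipCoeff q i j = flipCoeff q j i := by
  simp only [flipCoeff, eq_comm]

/-- All the relations as one family in four unrestricted indices. The coefficients depend only on
the rows on the left and only on the columns on the right, which makes the stability under products
formal. The proof runs through the nine orders of `i, j` and `k, l`. -/
theorem IsQMatrix.rtt {M : Matrix (Fin N) (Fin N) A} (h : IsQMatrix q M) (hq : q ≠ 0)
    (i j k l : Fin N) :
    flipCoeff q i j • (M j k * M i l) + idCoeff q i j • (M i k * M j l) =
      flipCoeff q k l • (M i l * M j k) + idCoeff q k l • (M i k * M j l) := by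
  have hq' : (q : ℂ) ≠ 0 := by exact_mod_cast hq
  rcases lt_trichotomy i j with hij | rfl | hij <;> rcases lt_trichotomy k l with hkl | rfl | hkl
  · simp only [flipCoeff, idCoeff, hij, hkl, hij.ne, hkl.ne, if_true, if_false]
    rw [h.comm hij hkl]
  · simp only [flipCoeff, idCoeff, hij, hij.ne, if_true, if_false, lt_irrefl]
    rw [h.col k hij, smul_smul, smul_smul, ← add_smul, zero_smul, add_zero, sub_mul,
      inv_mul_cancel₀ hq']
    congr 1; ring
  · simp only [flipCoeff, idCoeff, hij, hkl.asymm, hij.ne, hkl.ne', if_true, if_false]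
    rw [h.cross hij hkl, h.comm hij hkl]; module
  · simp only [flipCoeff, idCoeff, hkl, hkl.ne, if_true, if_false, lt_irrefl]
    rw [h.row i hkl, zero_smul, add_zero, smul_smul, smul_smul, ← add_smul, sub_mul,
      inv_mul_cancel₀ hq']
    congr 1; ring
  · simp only [flipCoeff, idCoeff, lt_irrefl]
  · simp only [flipCoeff, idCoeff, hkl.asymm, hkl.ne', if_true, if_false, lt_irrefl]
    rw [h.row i hkl]; module
  · simp only [flipCoeff, idCoeff, hij.asymm, hkl, hij.ne', hkl.ne, if_true, if_false]
    rw [h.cross hij hkl]; module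
  · simp only [flipCoeff, idCoeff, hij.asymm, hij.ne', if_true, if_false, lt_irrefl]
    rw [h.col k hij]; module
  · simp only [flipCoeff, idCoeff, hij.asymm, hkl.asymm, hij.ne', hkl.ne', if_false]
    rw [h.comm hij hkl]

theorem IsQMatrix.of_rtt {M : Matrix (Fin N) (Fin N) A}
    (h : ∀ i j k l, flipCoeff q i j • (M j k * M i l) + idCoeff q i j • (M i k * M j l) =
      flipCoeff q k l • (M i l * M j k) + idCoeff q k l • (M i k * M j l)) :
    IsQMatrix q M := by
  have comm : ∀ α β a b, α < β → b < a → M α a * M β b = M β b * M α a := by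
    intro α β a b hαβ hab
    have := h α β b a
    simp only [flipCoeff, idCoeff, hαβ, hab, hαβ.ne, hab.ne, if_true, if_false, one_smul,
      add_left_inj] at this
    exact this.symm
  refine of_relations ?_ ?_ comm ?_
  · intro α a b hab
    have := h α α b a
    simp only [flipCoeff, idCoeff, hab.asymm, hab.ne', if_true, if_false, one_smul, zero_smul,
      add_zero, lt_irrefl] at this
    exact this.symm
  · intro a α β hαβ
    have := h β α a a
    simp only [flipCoeff, idCoeff, hαβ.asymm, hαβ.ne', if_true, if_false, one_smul, zero_smul,
      add_zero, lt_irrefl] at this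
    exact this
  · intro α β a b hαβ hab
    have := h β α a b
    simp only [flipCoeff, idCoeff, hαβ.asymm, hαβ.ne', hab, hab.ne, if_true, if_false, one_smul,
      zero_smul, add_zero] at this
    rw [this]

/-- The row coefficients are carried through `M` to the summation indices `a, b`, and from there
through `M'` to the columns. -/
theorem IsQMatrix.mul {M M' : Matrix (Fin N) (Fin N) A} (h : IsQMatrix q M)
    (h' : IsQMatrix q M') (hq : q ≠ 0) (hc : ∀ i j k l, Commute (M i j) (M' k l)) :
    IsQMatrix q (M * M') := by
  refine of_rtt fun i j k l => ?_
  have e : ∀ i j k l, (M * M') i k * (M * M') j l =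
      ∑ a, ∑ b, (M i a * M j b) * (M' a k * M' b l) := by
    intro i j k l
    rw [Matrix.mul_apply, Matrix.mul_apply, Finset.sum_mul_sum]
    refine Finset.sum_congr rfl fun a _ => Finset.sum_congr rfl fun b _ => ?_
    rw [mul_assoc, ← mul_assoc (M' a k), ← (hc j b a k).eq, mul_assoc, mul_assoc]
  have e1 : flipCoeff q i j • ((M * M') j k * (M * M') i l) +
      idCoeff q i j • ((M * M') i k * (M * M') j l) =
      ∑ a, ∑ b, (flipCoeff q a b • (M i b * M j a) + idCoeff q a b • (M i a * M j b)) *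
        (M' a k * M' b l) := by
    rw [e, e]
    simp only [← h.rtt hq i j, add_mul, smul_mul_assoc, Finset.smul_sum, Finset.sum_add_distrib]
  have e2 : flipCoeff q k l • ((M * M') i l * (M * M') j k) +
      idCoeff q k l • ((M * M') i k * (M * M') j l) =
      ∑ a, ∑ b, (M i a * M j b) *
        (flipCoeff q a b • (M' b k * M' a l) + idCoeff q a b • (M' a k * M' b l)) := by
    rw [e, e]
    simp only [h'.rtt hq _ _ k l, mul_add, mul_smul_comm, Finset.smul_sum, Finset.sum_add_distrib]
  rw [e1, e2]
  -- The flip terms agree after renaming `a` and `b`, the others term by term.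
  simp only [add_mul, mul_add, Finset.sum_add_distrib]
  congr 1
  · rw [Finset.sum_comm]
    refine Finset.sum_congr rfl fun a _ => Finset.sum_congr rfl fun b _ => ?_
    rw [flipCoeff_comm, smul_mul_assoc, mul_smul_comm]
  · refine Finset.sum_congr rfl fun a _ => Finset.sum_congr rfl fun b _ => ?_
    rw [smul_mul_assoc, mul_smul_comm]

/-- Every term of a relation contains one entry from each of the two rows involved, so the row
scalars factor out. -/
theorem IsQMatrix.smul_rows {M : Matrix (Fin N) (Fin N) A} (h : IsQMatrix q M) (c : Fin N → ℂ) :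
    IsQMatrix q (fun i j => c i • M i j : Matrix (Fin N) (Fin N) A) := by
  refine of_relations ?_ ?_ ?_ ?_
  · intro α a b hab
    simp only [smul_mul_smul_comm, h.row α hab, smul_comm (q : ℂ)]
  · intro a α β hab
    simp only [smul_mul_smul_comm, h.col a hab, smul_comm (q : ℂ), mul_comm (c β)]
  · intro α β a b h1 h2
    simp only [smul_mul_smul_comm, h.comm h1 h2, mul_comm (c β)]
  · intro α β a b h1 h2
    simp only [smul_mul_smul_comm, h.cross h1 h2, mul_comm (c β), smul_add]
    rw [smul_comm]

end FRT

/-! ### Matrices of `SU_N` type -/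

section SU

variable {A : Type} [Ring A] [Algebra ℂ A] [StarRing A] {q : ℝ} {N : ℕ}

/-- The matrix satisfies the relations of `ℂ[SU_N]_q`, with the involution expressed by
unitarity. -/
structure IsSUMatrix (q : ℝ) (M : Matrix (Fin N) (Fin N) A) : Prop where
  isQMatrix : IsQMatrix q M
  qDet_eq_one : qDet q M = 1
  mul_conjTranspose : M * M.conjTranspose = 1

namespace IsSUMatrix

variable {M M' : Matrix (Fin N) (Fin N) A}

/-- The cofactor matrix is a left inverse of `M` and the conjugate transpose is a right inverse, so
the two coincide. -/
theorem star_eq_qCofactor (h : IsSUMatrix q M) (hq : q ≠ 0) (i j : Fin N) :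
    star (M i j) = qCofactor q M i j := by
  have h1 : (Matrix.of fun d i => qCofactor q M i d) * M = 1 := by
    ext d c
    rw [Matrix.mul_apply, Matrix.one_apply]
    simp only [Matrix.of_apply]
    rw [h.isQMatrix.sum_qCofactor_mul hq, h.qDet_eq_one]
    simp only [eq_comm]
  have h2 : M.conjTranspose = Matrix.of fun d i => qCofactor q M i d := by
    rw [← one_mul M.conjTranspose, ← h1, mul_assoc, h.mul_conjTranspose, mul_one]
  have h3 := congrFun (congrFun h2 j) i
  rwa [Matrix.conjTranspose_apply, Matrix.of_apply] at h3

/-- With unitarity in place of the cofactor formula, no minors of a product have to be computed. -/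
theorem mul (h : IsSUMatrix q M) (h' : IsSUMatrix q M') (hq : q ≠ 0)
    (hc : ∀ i j k l, Commute (M i j) (M' k l)) : IsSUMatrix q (M * M') where
  isQMatrix := h.isQMatrix.mul h'.isQMatrix hq hc
  qDet_eq_one := by rw [h.isQMatrix.qDet_mul hq hc, h.qDet_eq_one, h'.qDet_eq_one, one_mul]
  mul_conjTranspose := by
    rw [Matrix.conjTranspose_mul, mul_assoc, ← mul_assoc M', h'.mul_conjTranspose, one_mul,
      h.mul_conjTranspose]

theorem map {B : Type} [Ring B] [Algebra ℂ B] [StarRing B] (h : IsSUMatrix q M)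
    (F : A →⋆ₐ[ℂ] B) : IsSUMatrix q (M.map F) where
  isQMatrix := h.isQMatrix.map F.toAlgHom
  qDet_eq_one := by
    have := map_qDet (q := q) F.toAlgHom M
    rw [h.qDet_eq_one, map_one] at this
    exact this.symm
  mul_conjTranspose := by
    rw [← Matrix.conjTranspose_map F (fun a => map_star F a), ← Matrix.map_mul,
      h.mul_conjTranspose, Matrix.map_one F (map_zero F) (map_one F)]

end IsSUMatrix

/-- The matrix of generators of `ℂ[SU_N]_q`. -/
def tMatrix (N : ℕ) (q : ℝ) : Matrix (Fin N) (Fin N) (CSU N q) := Matrix.of (tGen N q)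

theorem genMatrix_map_mk (N : ℕ) (q : ℝ) :
    (genMatrix N).map (StarPresented.mk (SURel N q)) = tMatrix N q := rfl

theorem isQMatrix_tMatrix (N : ℕ) (q : ℝ) : IsQMatrix q (tMatrix N q) := by
  rw [← genMatrix_map_mk]
  exact (isQMatrix_map_iff (StarPresented.mk (SURel N q))).mpr fun x y hxy =>
    StarPresented.mk_eq_of_rel (SURel.hol hxy)

theorem qDet_tMatrix (N : ℕ) (q : ℝ) : qDet q (tMatrix N q) = 1 := by
  have := StarPresented.mk_eq_of_rel (SURel.det (N := N) (q := q))
  rwa [map_qDet, genMatrix_map_mk, map_one] at this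

theorem star_tMatrix (N : ℕ) (q : ℝ) (i j : Fin N) :
    star (tMatrix N q i j) = qCofactor q (tMatrix N q) i j := by
  have := StarPresented.mk_eq_of_rel (SURel.invol (N := N) (q := q) i j)
  rw [← StarPresented.star_mk, map_smul, map_qMinor, genMatrix_map_mk] at this
  exact this

theorem isSUMatrix_tMatrix (N : ℕ) {q : ℝ} (hq : q ≠ 0) : IsSUMatrix q (tMatrix N q) where
  isQMatrix := isQMatrix_tMatrix N q
  qDet_eq_one := qDet_tMatrix N q
  mul_conjTranspose := by
    ext c d
    simp only [Matrix.mul_apply, Matrix.one_apply, Matrix.conjTranspose_apply, star_tMatrix]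
    rw [(isQMatrix_tMatrix N q).sum_mul_qCofactor hq, qDet_tMatrix]

/-- The other half of unitarity, not part of `IsSUMatrix`, is needed to contract the row index in
`IsSUMatrix.star_mul_relation`. -/
theorem conjTranspose_mul_tMatrix (N : ℕ) {q : ℝ} (hq : q ≠ 0) :
    (tMatrix N q).conjTranspose * tMatrix N q = 1 := by
  ext d c
  simp only [Matrix.mul_apply, Matrix.one_apply, Matrix.conjTranspose_apply, star_tMatrix]
  rw [(isQMatrix_tMatrix N q).sum_qCofactor_mul hq, qDet_tMatrix]
  simp only [eq_comm]

variable [StarModule ℂ A]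

/-- The `*`-homomorphism of `ℂ[SU_N]_q` defined by a matrix of `SU_N` type. -/
theorem IsSUMatrix.exists_hom {M : Matrix (Fin N) (Fin N) A} (h : IsSUMatrix q M) (hq : q ≠ 0) :
    ∃ F : CSU N q →⋆ₐ[ℂ] A, ∀ i j, F (tGen N q i j) = M i j := by
  have hM : (genMatrix N).map (FreeStarAlgebra.lift fun p : Fin N × Fin N => M p.1 p.2) = M := by
    ext i j
    exact FreeStarAlgebra.lift_gen _ _
  refine ⟨StarPresented.lift (fun p => M p.1 p.2) ?_, fun i j => StarPresented.lift_gen _ _ _⟩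
  rintro _ _ (hxy | _ | ⟨i, j⟩)
  · refine (isQMatrix_map_iff _).mp ?_ _ _ hxy
    rw [hM]; exact h.isQMatrix
  · rw [map_qDet, hM, map_one, h.qDet_eq_one]
  · rw [FreeStarAlgebra.lift_star, map_smul, map_qMinor, hM]
    exact (congrArg star (FreeStarAlgebra.lift_gen _ _)).trans (h.star_eq_qCofactor hq i j)

end SU

/-! ### The embedding of `Pol(Mat_n)_q` -/

section RCoeff

variable {E : Type*} [AddCommGroup E] [Module ℂ E] {n : ℕ} {q : ℝ}

/-- The contraction of a matrix with the coefficients `R_{ba}^{b'a'}`. -/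
def rContract (q : ℝ) (a b : Fin n) (F : Fin n → Fin n → E) : E :=
  if a = b then F a a + ∑ c, (if a < c then 1 - ((q : ℂ) ^ 2)⁻¹ else 0) • F c c
  else (q : ℂ)⁻¹ • F a b

/-- For `a ≠ b` only `(a', b') = (a, b)` contributes; for `a = b` only the diagonal terms `a' = b' ≥
a` do. -/
theorem sum_rCoeff_smul (a b : Fin n) (F : Fin n → Fin n → E) :
    ∑ a', ∑ b', rCoeff q b a b' a' • F a' b' = rContract q a b F := by
  have h : ∀ a' b', rCoeff q b a b' a' • F a' b' =
      if b' = (if a = b then a' else b) then (if a = b then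
        (if a' = a then 1 else 0) + (if a < a' then 1 - ((q : ℂ) ^ 2)⁻¹ else 0) else
        if a' = a then (q : ℂ)⁻¹ else 0) • F a' b' else 0 := by
    intro a' b'
    rcases eq_or_ne a b with rfl | hab
    · rcases eq_or_ne b' a' with rfl | hb
      · rcases eq_or_ne b' a with rfl | ha
        · simp [rCoeff]
        · rcases lt_or_ge a b' with hlt | hge
          · simp [rCoeff, ha, ha.symm, hlt]
          · simp [rCoeff, ha, ha.symm, hge.not_gt]
      · simp [rCoeff, hb]
    · rcases eq_or_ne b' b with rfl | hb
      · rcases eq_or_ne a' a with rfl | ha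
        · simp [rCoeff, hab, hab.symm]
        · simp [rCoeff, hab, hab.symm, ha, ha.symm]
      · simp [rCoeff, hab, hab.symm, hb, hb.symm]
  simp only [h, Finset.sum_ite_eq', Finset.mem_univ, if_true]
  rw [rContract]
  split_ifs with hab
  · simp only [add_smul, Finset.sum_add_distrib, ite_smul, one_smul, zero_smul, Finset.sum_ite_eq',
      Finset.mem_univ, if_true]
  · simp only [ite_smul, zero_smul, Finset.sum_ite_eq', Finset.mem_univ, if_true]

theorem rContract_smul (a b : Fin n) (c : ℂ) (F : Fin n → Fin n → E) :
    rContract q a b (fun i j => c • F i j) = c • rContract q a b F := by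
  unfold rContract
  split_ifs
  · rw [smul_add, Finset.smul_sum]
    simp only [smul_comm c]
  · rw [smul_comm]

/-- Inversion of a triangular system of equations. -/
theorem weighted_triangular_solution (hq : q ≠ 0) (A Y : Fin n → E) (δ : E)
    (h : ∀ j, A j + (1 - (q : ℂ) ^ 2) • ∑ i, (if j < i then A i else 0) =
      (q : ℂ) ^ 2 • Y j + (1 - (q : ℂ) ^ 2) • δ) (j : Fin n) :
    ((q : ℂ) ^ (((j : ℤ) + 1) - n)) ^ 2 • A j = (q : ℂ) ^ 2 •
        (((q : ℂ) ^ (((j : ℤ) + 1) - n)) ^ 2 • Y j + ∑ i, (if j < i then 1 - ((q : ℂ) ^ 2)⁻¹ else 0) •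
          ((q : ℂ) ^ (((i : ℤ) + 1) - n)) ^ 2 • Y i) + (1 - (q : ℂ) ^ 2) • δ := by
  have hq' : (q : ℂ) ≠ 0 := by exact_mod_cast hq
  set W : Fin n → ℂ := fun i => ((q : ℂ) ^ (((i : ℤ) + 1) - n)) ^ 2 with hW
  have hstep : ∀ (f : Fin n → E) (j j' : Fin n), (j : ℕ) + 1 = j' →
      ∑ i, (if j < i then f i else 0) = f j' + ∑ i, (if j' < i then f i else 0) := by
    intro f j j' hjj
    have : ∀ i, (if j < i then f i else 0) =
        (if i = j' then f i else 0) + (if j' < i then f i else 0) := by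
      intro i
      simp only [Fin.lt_def, Fin.ext_iff]
      split_ifs <;> first | omega | simp
    simp only [this, Finset.sum_add_distrib, Finset.sum_ite_eq', Finset.mem_univ, if_true]
  -- Descending induction on `j`, with `m = n - 1 - j`. The system says that passing from `j + 1` to
  -- `j` turns the remainder `δ - ∑_{i>j+1} A i` into `q² (δ - ∑_{i>j+1} A i - Y (j+1))`; since `W j
  -- · q² = W (j+1)`, the weighted remainders telescope.
  have key : ∀ (m : ℕ) (j : Fin n), (j : ℕ) + m + 1 = n →
      W j • (δ - ∑ i, (if j < i then A i else 0)) =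
        δ - ∑ i, (if j < i then W i • Y i else 0) := by
    intro m
    induction m with
    | zero =>
      intro j hj
      have h0 : ∀ i, ¬ j < i := fun i hi => by have := Fin.lt_def.mp hi; omega
      have h1 : W j = 1 := by
        have : ((j : ℤ) + 1) - n = 0 := by omega
        simp only [hW, this, zpow_zero, one_pow]
      simp only [h0, if_false, Finset.sum_const_zero, h1, one_smul]
    | succ m ih =>
      intro j hj
      obtain ⟨j', hj'⟩ : ∃ j' : Fin n, (j : ℕ) + 1 = j' := ⟨⟨j + 1, by omega⟩, rfl⟩
      have h1 := ih j' (by omega)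
      have h2 := h j'
      have h3 : W j * (q : ℂ) ^ 2 = W j' := by
        simp only [hW, ← hj', ← mul_pow, ← zpow_add_one₀ hq']
        congr 2
        push_cast
        ring
      rw [hstep _ j j' hj', hstep _ j j' hj']
      set G := ∑ i, (if j' < i then A i else 0)
      have h4 : A j' = (q : ℂ) ^ 2 • Y j' + (1 - (q : ℂ) ^ 2) • δ - (1 - (q : ℂ) ^ 2) • G := by
        rw [← h2]; abel
      have h5 : δ - (A j' + G) = (q : ℂ) ^ 2 • (δ - G - Y j') := by
        rw [h4]; module
      rw [h5, smul_smul, h3, smul_sub, h1]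
      abel
  have h1 := key (n - 1 - j) j (by omega)
  have h2 := h j
  have h3 : A j = (q : ℂ) ^ 2 • Y j + (1 - (q : ℂ) ^ 2) •
      (δ - ∑ i, (if j < i then A i else 0)) := by
    rw [smul_sub, ← add_sub_assoc, ← h2, add_sub_cancel_right]
  have h4 : ∀ i, (if j < i then 1 - ((q : ℂ) ^ 2)⁻¹ else 0) • W i • Y i =
      (1 - ((q : ℂ) ^ 2)⁻¹) • (if j < i then W i • Y i else 0) := by
    intro i; split_ifs <;> simp
  change W j • A j = (q : ℂ) ^ 2 • (W j • Y j + ∑ i, _ • W i • Y i) + _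
  rw [h3, smul_add, smul_comm (W j) (1 - (q : ℂ) ^ 2), h1, Finset.sum_congr rfl fun i _ => h4 i,
    ← Finset.smul_sum]
  simp only [smul_add, smul_sub, smul_smul, mul_inv_cancel₀ (pow_ne_zero 2 hq'),
    sub_smul, one_smul, mul_comm (W j)]
  abel

end RCoeff

/-! ### The relations of `Pol(Mat_n)_q` in the corner of a unitary quantum matrix -/

section Pol

variable {A : Type} [Ring A] [Algebra ℂ A] [StarRing A] [StarModule ℂ A] {q : ℝ} {n : ℕ}

/-- The matrix satisfies the relations of `Pol(Mat_n)_q`. -/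
structure IsPolMatrix (q : ℝ) (Z : Matrix (Fin n) (Fin n) A) : Prop where
  isQMatrix : IsQMatrix q Z
  mixed (α β a b : Fin n) : star (Z β b) * Z α a =
    (q : ℂ) ^ 2 • rContract q α β (fun α' β' => rContract q a b
      fun a' b' => Z α' a' * star (Z β' b')) +
      if a = b ∧ α = β then (1 - (q : ℂ) ^ 2) • 1 else 0

omit [StarModule ℂ A] in
theorem sum_rCoeff_eq_rContract (Z : Matrix (Fin n) (Fin n) A) (α β a b : Fin n) :
    ∑ a' : Fin n, ∑ b' : Fin n, ∑ α' : Fin n, ∑ β' : Fin n,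
      (rCoeff q b a b' a' * rCoeff q β α β' α') • (Z α' a' * star (Z β' b')) =
    rContract q α β (fun α' β' => rContract q a b fun a' b' => Z α' a' * star (Z β' b')) := by
  simp only [← sum_rCoeff_smul, Finset.smul_sum, smul_smul]
  have : ∀ a' : Fin n, ∑ b' : Fin n, ∑ α' : Fin n, ∑ β' : Fin n,
      (rCoeff q b a b' a' * rCoeff q β α β' α') • (Z α' a' * star (Z β' b')) =
      ∑ α' : Fin n, ∑ β' : Fin n, ∑ b' : Fin n,
      (rCoeff q b a b' a' * rCoeff q β α β' α') • (Z α' a' * star (Z β' b')) := by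
    intro a'
    rw [Finset.sum_comm]
    exact Finset.sum_congr rfl fun _ _ => Finset.sum_comm
  rw [Finset.sum_congr rfl fun a' _ => this a', Finset.sum_comm]
  refine Finset.sum_congr rfl fun α' _ => ?_
  rw [Finset.sum_comm]
  simp only [mul_comm]

theorem IsPolMatrix.exists_hom {Z : Matrix (Fin n) (Fin n) A} (h : IsPolMatrix q Z) :
    ∃ F : PolMat n q →⋆ₐ[ℂ] A, ∀ i j, F (zGen n q i j) = Z i j := by
  set F := FreeStarAlgebra.lift fun p : Fin n × Fin n => Z p.1 p.2 with hF
  have hg : ∀ i j, F (genMatrix n i j) = Z i j := fun i j => FreeStarAlgebra.lift_gen _ _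
  have hM : (genMatrix n).map F = Z := by
    ext i j
    exact hg i j
  refine ⟨StarPresented.lift (fun p => Z p.1 p.2) ?_, fun i j => StarPresented.lift_gen _ _ _⟩
  rintro _ _ (hxy | ⟨α, β, a, b⟩)
  · refine (isQMatrix_map_iff _).mp ?_ _ _ hxy
    rw [← hF, hM]; exact h.isQMatrix
  · rw [← hF]
    have hite : F (if a = b ∧ α = β then (1 - (q : ℂ) ^ 2) • 1 else 0) =
        if a = b ∧ α = β then (1 - (q : ℂ) ^ 2) • 1 else 0 := by
      split_ifs
      · rw [map_smul, map_one]
      · rw [map_zero]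
    rw [map_mul, map_add, hite, map_smul]
    simp only [map_sum, map_smul, map_mul]
    simp only [hF, FreeStarAlgebra.lift_star]
    simp only [← hF, hg]
    rw [sum_rCoeff_eq_rContract]
    exact h.mixed α β a b

omit [StarModule ℂ A] in
/-- The relations between the entries of a unitary quantum matrix and their adjoints. -/
theorem IsSUMatrix.star_mul_relation {N : ℕ} {T : Matrix (Fin N) (Fin N) A} (h : IsSUMatrix q T)
    (h' : T.conjTranspose * T = 1) (hq : q ≠ 0) (y j x k : Fin N) :
    flipCoeff q y j • (star (T y x) * T j k) +
        (if j = y then ∑ i, idCoeff q i j • (star (T i x) * T i k) else 0) =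
      flipCoeff q k x • (T j k * star (T y x)) +
        (if x = k then ∑ l, idCoeff q k l • (T j l * star (T y l)) else 0) := by
  have hrow : ∀ i m, ∑ l, T i l * star (T m l) = if i = m then 1 else 0 := fun i m => by
    rw [← Matrix.one_apply, ← h.mul_conjTranspose, Matrix.mul_apply]; rfl
  have hcol : ∀ l m, ∑ i, star (T i l) * T i m = if l = m then 1 else 0 := fun l m => by
    rw [← Matrix.one_apply, ← h', Matrix.mul_apply]; rfl
  have hr : ∀ X : A, ∀ i m, ∑ l, X * T i l * star (T m l) = if i = m then X else 0 :=
    fun X i m => by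
      simp only [mul_assoc, ← Finset.mul_sum, hrow, mul_ite, mul_one, mul_zero]
  have hl : ∀ X : A, ∀ l m, ∑ i, star (T i l) * (T i m * X) = if l = m then X else 0 :=
    fun X l m => by
      simp only [← mul_assoc, ← Finset.sum_mul, hcol, ite_mul, one_mul, zero_mul]
  -- The `R`-matrix relation is sandwiched between adjoints and summed over `i` and `l`. On the left
  -- side the sum over `l`, on the right side the sum over `i`, contracts an entry with an adjoint
  -- by unitarity.
  have key : ∑ i, ∑ l, star (T i x) * (flipCoeff q i j • (T j k * T i l) +
      idCoeff q i j • (T i k * T j l)) * star (T y l) =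
      ∑ l, ∑ i, star (T i x) * (flipCoeff q k l • (T i l * T j k) +
      idCoeff q k l • (T i k * T j l)) * star (T y l) := by
    rw [Finset.sum_comm]
    simp only [h.isQMatrix.rtt hq]
  have e1 : ∀ i, ∑ l, star (T i x) * (flipCoeff q i j • (T j k * T i l) +
      idCoeff q i j • (T i k * T j l)) * star (T y l) =
      (if i = y then flipCoeff q i j • (star (T i x) * T j k) else 0) +
      (if j = y then idCoeff q i j • (star (T i x) * T i k) else 0) := by
    intro i
    simp only [mul_add, add_mul, Finset.sum_add_distrib, mul_smul_comm, smul_mul_assoc,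
      ← Finset.smul_sum, ← mul_assoc, hr, smul_ite, smul_zero]
  have e2 : ∀ l, ∑ i, star (T i x) * (flipCoeff q k l • (T i l * T j k) +
      idCoeff q k l • (T i k * T j l)) * star (T y l) =
      (if x = l then flipCoeff q k l • (T j k * star (T y l)) else 0) +
      (if x = k then idCoeff q k l • (T j l * star (T y l)) else 0) := by
    intro l
    simp only [mul_add, add_mul, Finset.sum_add_distrib, mul_smul_comm, smul_mul_assoc,
      ← Finset.smul_sum, mul_assoc, hl, smul_ite, smul_zero]
  simp only [e1, e2, Finset.sum_add_distrib, Finset.sum_ite_eq', Finset.sum_ite_eq,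
    Finset.mem_univ, if_true] at key
  rw [← apply_ite (fun X : A => X)]
  have p1 : ∀ (p : Prop) [Decidable p] (f : Fin N → A),
      ∑ i, (if p then f i else 0) = if p then ∑ i, f i else 0 := by
    intro p _ f; split_ifs <;> simp
  rw [p1, p1] at key
  exact key

/-- The lower right corner of a unitary quantum matrix, with rescaled rows. -/
def corner (q : ℝ) (T : Matrix (Fin (n + n)) (Fin (n + n)) A) : Matrix (Fin n) (Fin n) A :=
  fun i j => (q : ℂ) ^ (((i : ℤ) + 1) - (n : ℤ)) • T (Fin.natAdd n i) (Fin.natAdd n j)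

/-- The column sums in `IsSUMatrix.star_mul_relation` run over columns to the right, hence stay in
the corner and give the column contraction at once. The row sums run over the rows above and leave
the corner; the complementary sum over the rows from the given one on stays inside, and yields the
triangular system that the weights solve. -/
theorem IsSUMatrix.isPolMatrix_corner {T : Matrix (Fin (n + n)) (Fin (n + n)) A}
    (h : IsSUMatrix q T) (h' : T.conjTranspose * T = 1) (hq : q ≠ 0) :
    IsPolMatrix q (corner q T) where
  isQMatrix := (h.isQMatrix.submatrix (Fin.strictMono_natAdd n) (Fin.strictMono_natAdd n)).smul_rows
    fun i => (q : ℂ) ^ (((i : ℤ) + 1) - (n : ℤ))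
  mixed α β a b := by
    have hq' : (q : ℂ) ≠ 0 := by exact_mod_cast hq
    set W : Fin n → ℂ := fun i => (q : ℂ) ^ (((i : ℤ) + 1) - (n : ℤ)) with hW
    have hWs : ∀ i, star (W i) = W i := fun i => by simp [hW]
    set t : Fin n → Fin n → A := fun i j => T (Fin.natAdd n i) (Fin.natAdd n j) with ht
    have hc : ∀ i j, corner q T i j = W i • t i j := fun i j => rfl
    have hnat : ∀ i j : Fin n, Fin.natAdd n i < Fin.natAdd n j ↔ i < j := fun i j =>
      (Fin.strictMono_natAdd n).lt_iff_lt
    have hnat' : ∀ i j : Fin n, Fin.natAdd n i = Fin.natAdd n j ↔ i = j := fun i j =>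
      (Fin.strictMono_natAdd n).injective.eq_iff
    have hcast : ∀ i j : Fin n, ¬ Fin.natAdd n i < Fin.castAdd n j := fun i j hij => by
      have := Fin.lt_def.mp hij; simp at this; omega
    set Y : Fin n → Fin n → A := fun α β => rContract q a b fun a' b' => t α a' * star (t β b')
      with hY
    -- The columns of the left half do not enter, as their indices are smaller than `n + a`.
    have hX : ∀ α β : Fin n, flipCoeff q (Fin.natAdd n a) (Fin.natAdd n b) • (t α a * star (t β b)) +
        (if Fin.natAdd n b = Fin.natAdd n a then ∑ l, idCoeff q (Fin.natAdd n a) l •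
          (T (Fin.natAdd n α) l * star (T (Fin.natAdd n β) l)) else 0) = (q : ℂ) • Y α β := by
      intro α β
      simp only [flipCoeff, idCoeff, Fin.sum_univ_add, hcast, hnat, hnat', if_false, zero_smul,
        Finset.sum_const_zero, zero_add, hY, rContract]
      rcases eq_or_ne a b with rfl | hab
      · simp only [if_true, smul_add, Finset.smul_sum, smul_smul]
        congr 1
        refine Finset.sum_congr rfl fun i _ => ?_
        congr 1
        split_ifs
        · field_simp
        · simp
      · simp only [hab, hab.symm, if_false, add_zero, smul_smul, mul_inv_cancel₀ hq']
    have hrel : ∀ α β : Fin n, flipCoeff q (Fin.natAdd n β) (Fin.natAdd n α) •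
        (star (t β b) * t α a) + (if α = β then ∑ i, idCoeff q i (Fin.natAdd n α) •
          (star (T i (Fin.natAdd n b)) * T i (Fin.natAdd n a)) else 0) = (q : ℂ) • Y α β := by
      intro α β
      have h1 := h.star_mul_relation h' hq (Fin.natAdd n β) (Fin.natAdd n α)
        (Fin.natAdd n b) (Fin.natAdd n a)
      rw [← hX]
      simp only [hnat'] at h1 ⊢
      exact h1
    have hF : ∀ α' β', (rContract q a b fun a' b' => corner q T α' a' * star (corner q T β' b')) =
        (W α' * W β') • Y α' β' := by
      intro α' β'
      simp only [hc, star_smul, hWs, smul_mul_smul_comm, rContract_smul, hY]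
    simp only [hF]
    simp only [hc, star_smul, hWs, smul_mul_smul_comm]
    rcases eq_or_ne α β with rfl | hαβ
    · have hcol : ∑ i, star (T i (Fin.natAdd n b)) * T i (Fin.natAdd n a) =
          if a = b then 1 else 0 := by
        have := congrFun (congrFun h' (Fin.natAdd n b)) (Fin.natAdd n a)
        rw [Matrix.mul_apply, Matrix.one_apply] at this
        simp only [hnat', eq_comm (a := b)] at this
        exact this
      have htri := weighted_triangular_solution hq (fun i => star (t i b) * t i a)
        (fun i => Y i i) (if a = b then 1 else 0) ?_ α
      · rw [rContract, if_pos rfl]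
        simp only [← pow_two]
        rw [htri]
        simp only [and_true, smul_ite, smul_zero]
        rfl
      · intro j
        have h1 := hrel j j
        simp only [if_true] at h1
        have h2 : ∑ i, idCoeff q i (Fin.natAdd n j) •
            (star (T i (Fin.natAdd n b)) * T i (Fin.natAdd n a)) =
            ((q : ℂ) - (q : ℂ)⁻¹) • ((if a = b then 1 else 0) - (star (t j b) * t j a) -
              ∑ i, if j < i then star (t i b) * t i a else 0) := by
          have h3 : ∀ i : Fin n, (idCoeff q (Fin.natAdd n i) (Fin.natAdd n j) •
            (star (t i b) * t i a)) = ((q : ℂ) - (q : ℂ)⁻¹) • ((star (t i b) * t i a) -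
              (if i = j then star (t i b) * t i a else 0) -
              if j < i then star (t i b) * t i a else 0) := by
            intro i
            simp only [idCoeff, hnat]
            rcases lt_trichotomy i j with hij | rfl | hij
            · simp [hij, hij.ne, hij.asymm]
            · simp
            · simp [hij, hij.ne', hij.asymm]
          have h4 : ∀ i : Fin n, idCoeff q (Fin.castAdd n i) (Fin.natAdd n j) =
              (q : ℂ) - (q : ℂ)⁻¹ := by
            intro i
            rw [idCoeff, if_pos]
            rw [Fin.lt_def]; simp; omega
          rw [← hcol, Fin.sum_univ_add, Fin.sum_univ_add, Finset.sum_congr rfl fun i _ => h3 i]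
          simp only [h4, ← Finset.smul_sum, Finset.sum_sub_distrib, Finset.sum_ite_eq',
            Finset.mem_univ, if_true, ht]
          module
        rw [h2, flipCoeff, if_pos rfl] at h1
        set G := ∑ i, if j < i then star (t i b) * t i a else 0
        set D : A := if a = b then 1 else 0
        have h5 := congrArg (fun z => (q : ℂ) • z) h1
        simp only [smul_add, smul_smul] at h5
        rw [mul_sub, mul_inv_cancel₀ hq'] at h5
        rw [pow_two, ← h5]
        module
    · have h1 := hrel α β
      have h2 : flipCoeff q (Fin.natAdd n β) (Fin.natAdd n α) = 1 := by
        rw [flipCoeff, if_neg]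
        rw [hnat']; exact hαβ.symm
      rw [h2, one_smul, if_neg hαβ, add_zero] at h1
      have h3 : ¬ (a = b ∧ α = β) := fun h => hαβ h.2
      rw [rContract, if_neg hαβ, if_neg h3, add_zero, h1, smul_smul, smul_smul, smul_smul]
      congr 1
      field_simp

end Pol

/-- With zero-based indices the exponent `i - n` becomes `i + 1 - n`. -/
theorem existsUnique_embedding (n : ℕ) {q : ℝ} (hq : q ≠ 0) :
    ∃! ι : PolMat n q →⋆ₐ[ℂ] CSU (n + n) q,
      ∀ i j, ι (zGen n q i j) = (q : ℂ) ^ (((i : ℤ) + 1) - (n : ℤ)) •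
        tGen (n + n) q (Fin.natAdd n i) (Fin.natAdd n j) := by
  obtain ⟨F, hF⟩ := ((isSUMatrix_tMatrix (n + n) hq).isPolMatrix_corner
    (conjTranspose_mul_tMatrix (n + n) hq) hq).exists_hom
  exact ⟨F, hF, fun G hG => StarPresented.hom_ext fun x => (hG x.1 x.2).trans (hF x.1 x.2).symm⟩

/-! ### Operators in the standard basis of `ℓ²` -/

section Basis

variable {α : Type} [DecidableEq α]

/-- The standard basis vector `e_κ` of `ℓ²(α)`. -/
def basisVec (κ : α) : ℓ²(α, ℂ) := lp.single 2 κ (1 : ℂ)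

theorem basisVec_apply (κ k : α) : basisVec κ k = if k = κ then 1 else 0 := by
  rw [basisVec, lp.single_apply, Pi.single_apply]

theorem inner_basisVec_left (κ : α) (f : ℓ²(α, ℂ)) : inner ℂ (basisVec κ) f = f κ := by
  rw [basisVec, lp.inner_single_left]
  simp

theorem inner_basisVec_right (κ : α) (f : ℓ²(α, ℂ)) :
    inner ℂ f (basisVec κ) = starRingEnd ℂ (f κ) := by
  rw [← inner_basisVec_left, inner_conj_symm]

theorem hasSum_basisVec (f : ℓ²(α, ℂ)) : HasSum (fun κ => f κ • basisVec κ) f := by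
  have h := lp.hasSum_single (E := fun _ : α => ℂ) (p := 2) ENNReal.ofNat_ne_top f
  have h1 : ∀ κ, (lp.single 2 κ (f κ) : ℓ²(α, ℂ)) = f κ • basisVec κ := fun κ => by
    rw [basisVec, ← lp.single_smul, smul_eq_mul, mul_one]
  simpa only [h1] using h

theorem op_ext {F : Type*} [NormedAddCommGroup F] [NormedSpace ℂ F] {A B : ℓ²(α, ℂ) →L[ℂ] F}
    (h : ∀ κ, A (basisVec κ) = B (basisVec κ)) : A = B := by
  ext1 f
  have hA := A.hasSum (hasSum_basisVec f)
  have hB := B.hasSum (hasSum_basisVec f)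
  simp only [map_smul, h] at hA hB
  exact hA.unique hB

theorem star_op_apply (A : ℓ²(α, ℂ) →L[ℂ] ℓ²(α, ℂ)) (κ k : α) :
    (star A) (basisVec κ) k = starRingEnd ℂ (A (basisVec k) κ) := by
  rw [← inner_basisVec_left, ContinuousLinearMap.star_eq_adjoint,
    ContinuousLinearMap.adjoint_inner_right, inner_basisVec_right]

end Basis

/-! ### Operators in one tensor factor -/

section Slot

variable {m : ℕ}

theorem slotOp_apply (r : Fin m) (A : ℓ²(ℕ, ℂ) →L[ℂ] ℓ²(ℕ, ℂ)) (f : ℓ²(Fin m → ℕ, ℂ))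
    (k : Fin m → ℕ) : slotOp r A f k = A (slice r f k) (k r) := rfl

theorem slice_apply (r : Fin m) (f : ℓ²(Fin m → ℕ, ℂ)) (k : Fin m → ℕ) (l : ℕ) :
    slice r f k l = f (Function.update k r l) := rfl

theorem slice_slotOp (r : Fin m) (A : ℓ²(ℕ, ℂ) →L[ℂ] ℓ²(ℕ, ℂ)) (f : ℓ²(Fin m → ℕ, ℂ))
    (k : Fin m → ℕ) : slice r (slotOp r A f) k = A (slice r f k) := by
  ext l
  have : slice r f (Function.update k r l) = slice r f k := by
    ext l'
    rw [slice_apply, slice_apply, Function.update_idem]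
  rw [slice_apply, slotOp_apply, this, Function.update_self]

theorem slice_basisVec (r : Fin m) (κ k : Fin m → ℕ) :
    slice r (basisVec κ) k =
      (if Function.update k r (κ r) = κ then (1 : ℂ) else 0) • basisVec (κ r) := by
  ext l
  rw [slice_apply, basisVec_apply, lp.coeFn_smul, Pi.smul_apply, basisVec_apply]
  by_cases hl : l = κ r
  · simp [hl]
  · have : Function.update k r l ≠ κ := fun h => hl (by rw [← h, Function.update_self])
    simp [hl, this]

/-- The condition says that `k` and `κ` agree outside the `r`-th place. -/
theorem slotOp_basisVec_apply (r : Fin m) (A : ℓ²(ℕ, ℂ) →L[ℂ] ℓ²(ℕ, ℂ)) (κ k : Fin m → ℕ) :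
    slotOp r A (basisVec κ) k =
      if Function.update k r (κ r) = κ then A (basisVec (κ r)) (k r) else 0 := by
  rw [slotOp_apply, slice_basisVec, map_smul, lp.coeFn_smul, Pi.smul_apply]
  split_ifs <;> simp

/-- The embedding of the operators on the `r`-th tensor factor. -/
def slotHom (r : Fin m) :
    (ℓ²(ℕ, ℂ) →L[ℂ] ℓ²(ℕ, ℂ)) →⋆ₐ[ℂ] (ℓ²(Fin m → ℕ, ℂ) →L[ℂ] ℓ²(Fin m → ℕ, ℂ)) where
  toFun := slotOp r
  map_one' := by
    ext f k
    rw [slotOp_apply, one_apply_eq_self, slice_apply, Function.update_eq_self]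
    rfl
  map_mul' A B := by
    ext f k
    rw [slotOp_apply, mul_apply_eq_comp, mul_apply_eq_comp, slotOp_apply,
      slice_slotOp]
  map_zero' := by ext f k; rfl
  map_add' A B := by ext f k; rfl
  commutes' c := by
    ext f k
    rw [slotOp_apply, Algebra.algebraMap_eq_smul_one, Algebra.algebraMap_eq_smul_one,
      smul_apply, smul_apply,
      one_apply_eq_self, one_apply_eq_self, lp.coeFn_smul, lp.coeFn_smul,
      Pi.smul_apply, Pi.smul_apply, slice_apply, Function.update_eq_self]
  map_star' A := by
    refine op_ext fun κ => ?_
    ext k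
    rw [slotOp_basisVec_apply, star_op_apply, star_op_apply, slotOp_basisVec_apply]
    have : Function.update k r (κ r) = κ ↔ Function.update κ r (k r) = k := by
      constructor <;> intro h
      · rw [← h, Function.update_idem, Function.update_eq_self]
      · rw [← h, Function.update_idem, Function.update_eq_self]
    simp only [this]
    split_ifs <;> simp

theorem slotOp_commute {r s : Fin m} (hrs : r ≠ s) (A B : ℓ²(ℕ, ℂ) →L[ℂ] ℓ²(ℕ, ℂ)) :
    Commute (slotOp r A) (slotOp s B) := by
  have key : ∀ {r s : Fin m}, r ≠ s → ∀ (A B : ℓ²(ℕ, ℂ) →L[ℂ] ℓ²(ℕ, ℂ)) (κ k : Fin m → ℕ),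
      slotOp r A (slotOp s B (basisVec κ)) k =
        if Function.update (Function.update k r (κ r)) s (κ s) = κ then
          B (basisVec (κ s)) (k s) * A (basisVec (κ r)) (k r) else 0 := by
    intro r s hrs A B κ k
    have h1 : slice r (slotOp s B (basisVec κ)) k =
        (if Function.update (Function.update k r (κ r)) s (κ s) = κ then
          B (basisVec (κ s)) (k s) else 0) • basisVec (κ r) := by
      ext l
      rw [slice_apply, slotOp_basisVec_apply, lp.coeFn_smul, Pi.smul_apply, basisVec_apply,
        Function.update_of_ne hrs.symm]
      by_cases hl : l = κ r
      · simp [hl]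
      · have : Function.update (Function.update k r l) s (κ s) ≠ κ := fun h => hl (by
          rw [← h, Function.update_of_ne hrs, Function.update_self])
        simp [hl, this]
    rw [slotOp_apply, h1, map_smul, lp.coeFn_smul, Pi.smul_apply]
    split_ifs <;> simp
  refine op_ext fun κ => ?_
  ext k
  rw [mul_apply_eq_comp, mul_apply_eq_comp, key hrs, key hrs.symm,
    Function.update_comm hrs, mul_comm]

theorem slotOp_basisVec_of_eq {r : Fin m} {A : ℓ²(ℕ, ℂ) →L[ℂ] ℓ²(ℕ, ℂ)} {κ : Fin m → ℕ} {c : ℂ}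
    {l : ℕ} (h : A (basisVec (κ r)) = c • basisVec l) :
    slotOp r A (basisVec κ) = c • basisVec (Function.update κ r l) := by
  ext k
  rw [slotOp_basisVec_apply, h, lp.coeFn_smul, lp.coeFn_smul, Pi.smul_apply, Pi.smul_apply,
    basisVec_apply, basisVec_apply]
  by_cases hk : Function.update k r (κ r) = κ
  · have : k = Function.update κ r l ↔ k r = l := by
      constructor
      · intro h; rw [h, Function.update_self]
      · intro h; rw [← hk, Function.update_idem, ← h, Function.update_eq_self]
    simp [hk, this]
  · have : k ≠ Function.update κ r l := by
      intro h; apply hk; rw [h, Function.update_idem, Function.update_eq_self]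
    simp [hk, this]

end Slot

/-! ### Products of matrices along paths -/

/-- This turns the sum over paths that defines `wordOp` into a product of matrices, to which the
stability results for products apply. -/
theorem ofFn_matrix_prod_apply {E : Type*} [Ring E] {N : ℕ} : ∀ {m : ℕ}
    (X : Fin m → Matrix (Fin N) (Fin N) E) (i j : Fin N), (List.ofFn X).prod i j =
      ∑ k : Fin (m + 1) → Fin N with k 0 = i ∧ k (Fin.last m) = j,
        (List.ofFn fun r => X r (k r.castSucc) (k r.succ)).prod := by
  intro m
  induction m with
  | zero =>
    intro X i j
    rw [Finset.sum_filter, ← (Equiv.funUnique (Fin 1) (Fin N)).symm.sum_comp]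
    simp only [List.ofFn_zero, List.prod_nil, Matrix.one_apply]
    have : ∀ x : Fin N, (if ((Equiv.funUnique (Fin 1) (Fin N)).symm x 0 = i ∧
        (Equiv.funUnique (Fin 1) (Fin N)).symm x (Fin.last 0) = j) then (1 : E) else 0) =
        if x = i then (if i = j then 1 else 0) else 0 := by
      intro x
      simp only [Equiv.funUnique_symm_apply, uniqueElim_const]
      split_ifs <;> simp_all
    rw [Finset.sum_congr rfl fun x _ => this x]
    simp
  | succ m ih =>
    intro X i j
    rw [List.ofFn_succ, List.prod_cons, Matrix.mul_apply, Finset.sum_filter,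
      ← (Fin.consEquiv fun _ : Fin (m + 2) => Fin N).sum_comp, Fintype.sum_prod_type]
    simp only [ih, Finset.sum_filter, Finset.mul_sum, Fin.consEquiv_apply, Fin.cons_zero,
      ← Fin.succ_last, Fin.cons_succ, List.ofFn_succ, List.prod_cons, Fin.castSucc_zero,
      ← Fin.succ_castSucc]
    rw [Finset.sum_comm, Finset.sum_comm (f := fun x y => ite _ _ _)]
    refine Finset.sum_congr rfl fun k _ => ?_
    simp only [ite_and, Finset.sum_ite_eq', Finset.sum_ite_eq, Finset.mem_univ, if_true, mul_ite,
      mul_zero]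

/-- The matrix `(t_{a,b} ↦ I ⊗ ⋯ ⊗ π_s(t_{a,b}) ⊗ ⋯ ⊗ I)`. -/
def slotMatrix {q : ℝ} (hq : q ∈ Set.Ioo (0 : ℝ) 1) (N : ℕ) {m : ℕ} (w : Fin m → ℕ) (r : Fin m) :
    Matrix (Fin N) (Fin N) (ℓ²(Fin m → ℕ, ℂ) →L[ℂ] ℓ²(Fin m → ℕ, ℂ)) :=
  (simpleMatrix hq N (w r)).map (slotHom r)

theorem wordOp_eq {q : ℝ} (hq : q ∈ Set.Ioo (0 : ℝ) 1) (N : ℕ) {m : ℕ} (w : Fin m → ℕ)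
    (i j : Fin N) : wordOp hq N w i j = (List.ofFn (slotMatrix hq N w)).prod i j := by
  rw [ofFn_matrix_prod_apply]
  rfl

/-! ### The representation `π_u` -/

section ListProd

variable {A : Type} [Ring A] [Algebra ℂ A] [StarRing A] {q : ℝ} {N : ℕ}

omit [Algebra ℂ A] [StarRing A] in
theorem commute_ofFn_matrix_prod : ∀ {m : ℕ} (X : Fin m → Matrix (Fin N) (Fin N) A) (x : A),
    (∀ r i j, Commute x (X r i j)) → ∀ i j, Commute x ((List.ofFn X).prod i j) := by
  intro m
  induction m with
  | zero =>
    intro X x _ i j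
    rw [List.ofFn_zero, List.prod_nil, Matrix.one_apply]
    split_ifs
    · exact Commute.one_right x
    · exact Commute.zero_right x
  | succ m ih =>
    intro X x h i j
    rw [List.ofFn_succ, List.prod_cons, Matrix.mul_apply]
    exact Commute.sum_right _ _ _ fun k _ => (h 0 i k).mul_right (ih _ x (fun r => h r.succ) k j)

omit [StarRing A] in
theorem isQMatrix_one : IsQMatrix q (1 : Matrix (Fin N) (Fin N) A) := by
  refine IsQMatrix.of_relations ?_ ?_ ?_ ?_ <;> intros <;> simp only [Matrix.one_apply] <;>
    split_ifs <;> (simp_all; try omega)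

theorem isSUMatrix_one : IsSUMatrix q (1 : Matrix (Fin N) (Fin N) A) where
  isQMatrix := isQMatrix_one
  qDet_eq_one := by
    rw [qDet, Finset.sum_eq_single 1]
    · have h1 : permLength (1 : Equiv.Perm (Fin N)) = 0 := by
        rw [permLength, Finset.card_eq_zero, Finset.filter_eq_empty_iff]
        rintro ⟨x, y⟩ _ ⟨h1, h2⟩
        exact absurd h1 (lt_asymm h2)
      rw [h1, pow_zero, one_smul]
      refine List.prod_eq_one fun x hx => ?_
      obtain ⟨j, rfl⟩ := (List.mem_ofFn' _ _).mp hx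
      exact Matrix.one_apply_eq j
    · intro s _ hs
      obtain ⟨j, hj⟩ : ∃ j, s j ≠ j := by
        by_contra! h
        exact hs (Equiv.ext h)
      rw [List.prod_eq_zero, smul_zero]
      exact (List.mem_ofFn' _ _).mpr ⟨j, Matrix.one_apply_ne hj⟩
    · simp
  mul_conjTranspose := by rw [Matrix.conjTranspose_one, one_mul]

theorem isSUMatrix_ofFn_prod (hq : q ≠ 0) : ∀ {m : ℕ} (X : Fin m → Matrix (Fin N) (Fin N) A),
    (∀ r, IsSUMatrix q (X r)) → (∀ r s, r ≠ s → ∀ i j k l, Commute (X r i j) (X s k l)) →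
      IsSUMatrix q (List.ofFn X).prod := by
  intro m
  induction m with
  | zero => intro X _ _; rw [List.ofFn_zero, List.prod_nil]; exact isSUMatrix_one
  | succ m ih =>
    intro X h hc
    rw [List.ofFn_succ, List.prod_cons]
    refine (h 0).mul (ih _ (fun r => h r.succ) fun r s hrs =>
      hc _ _ fun h => hrs (Fin.succ_injective _ h)) hq fun i j k l => ?_
    exact commute_ofFn_matrix_prod _ _ (fun r k l => hc _ _ (Fin.succ_ne_zero r).symm i j k l) k l

end ListProd

/-! #### The operators of the representation of `ℂ[SU_2]_q` -/

section SUTwo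

variable {q : ℝ} (hq : q ∈ Set.Ioo (0 : ℝ) 1)

/-- The weight `√(1 - q^{2k})`. -/
def wt (q : ℝ) (k : ℕ) : ℂ := (Real.sqrt (1 - q ^ (2 * k)) : ℂ)

theorem wt_zero (q : ℝ) : wt q 0 = 0 := by simp [wt]

include hq in
theorem wt_mul_self (k : ℕ) : wt q k * wt q k = 1 - (q : ℂ) ^ (2 * k) := by
  rw [wt, ← Complex.ofReal_mul, Real.mul_self_sqrt]
  · push_cast; rfl
  · have := pow_le_one₀ hq.1.le hq.2.le (n := 2 * k)
    linarith

include hq in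
theorem wt_succ_ne_zero (k : ℕ) : wt q (k + 1) ≠ 0 := by
  rw [wt, Complex.ofReal_ne_zero]
  refine (Real.sqrt_pos.mpr ?_).ne'
  have := pow_lt_one₀ hq.1.le hq.2 (n := 2 * (k + 1)) (by omega)
  linarith

theorem conj_wt (k : ℕ) : starRingEnd ℂ (wt q k) = wt q k := Complex.conj_ofReal _

theorem diagOp_basisVec (w : ℕ → ℂ) (hw : ∀ k, ‖w k‖ ≤ 1) (k : ℕ) :
    diagOp w hw (basisVec k) = w k • basisVec k := by
  ext l
  have : diagOp w hw (basisVec k) l = w l * basisVec k l := rfl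
  rw [this, lp.coeFn_smul, Pi.smul_apply, basisVec_apply]
  split_ifs with h
  · rw [h, smul_eq_mul]
  · simp

theorem cOp_basisVec (k : ℕ) : cOp hq (basisVec k) = wt q k • basisVec k := diagOp_basisVec _ _ k

theorem dOp_basisVec (k : ℕ) : dOp hq (basisVec k) = (q : ℂ) ^ k • basisVec k := by
  rw [dOp, diagOp_basisVec]
  push_cast
  rfl

theorem shiftOp_basisVec (k : ℕ) : shiftOp (basisVec k) = basisVec (k + 1) := by
  ext l
  have : shiftOp (basisVec k) l = if l = 0 then 0 else basisVec k (l - 1) := rfl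
  rw [this, basisVec_apply, basisVec_apply]
  split_ifs <;> first | rfl | omega

theorem star_cOp : star (cOp hq) = cOp hq := by
  refine op_ext fun κ => ?_
  ext k
  rw [star_op_apply, cOp_basisVec, cOp_basisVec, lp.coeFn_smul, lp.coeFn_smul, Pi.smul_apply,
    Pi.smul_apply, basisVec_apply, basisVec_apply, smul_eq_mul, map_mul, conj_wt]
  by_cases h : κ = k
  · simp [h]
  · simp [h, Ne.symm h]

theorem star_dOp : star (dOp hq) = dOp hq := by
  refine op_ext fun κ => ?_
  ext k
  rw [star_op_apply, dOp_basisVec, dOp_basisVec, lp.coeFn_smul, lp.coeFn_smul, Pi.smul_apply,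
    Pi.smul_apply, basisVec_apply, basisVec_apply, smul_eq_mul, map_mul, map_pow,
    Complex.conj_ofReal]
  by_cases h : κ = k
  · simp [h]
  · simp [h, Ne.symm h]

/-- At `k = 0` the truncated `k - 1` is harmless because the weight vanishes. -/
theorem star_shiftOp_cOp_basisVec (k : ℕ) :
    (star shiftOp * cOp hq) (basisVec k) = wt q k • basisVec (k - 1) := by
  rw [mul_apply_eq_comp, cOp_basisVec, map_smul]
  rcases k with _ | k
  · rw [wt_zero, zero_smul, zero_smul]
  · congr 1
    ext l
    rw [star_op_apply, shiftOp_basisVec, basisVec_apply, basisVec_apply]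
    by_cases h : l = k
    · simp [h]
    · simp [h, Ne.symm h]

theorem cOp_shiftOp_basisVec (k : ℕ) :
    (cOp hq * shiftOp) (basisVec k) = wt q (k + 1) • basisVec (k + 1) := by
  rw [mul_apply_eq_comp, shiftOp_basisVec, cOp_basisVec]

theorem star_cOp_shiftOp : star (cOp hq * shiftOp) = star shiftOp * cOp hq := by
  rw [star_mul, star_cOp]

theorem star_star_shiftOp_cOp : star (star shiftOp * cOp hq) = cOp hq * shiftOp := by
  rw [star_mul, star_cOp, star_star]

theorem lower_mul_dOp : (star shiftOp * cOp hq) * dOp hq =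
    (q : ℂ) • (dOp hq * (star shiftOp * cOp hq)) := by
  refine op_ext fun k => ?_
  rw [smul_apply, mul_apply_eq_comp (dOp hq), mul_apply_eq_comp _ (dOp hq), dOp_basisVec, map_smul,
    star_shiftOp_cOp_basisVec, map_smul, dOp_basisVec]
  rcases k with _ | k
  · simp [wt_zero]
  · rw [Nat.add_sub_cancel, smul_smul, smul_smul, smul_smul]
    congr 1; ring

theorem dOp_mul_raise : dOp hq * (cOp hq * shiftOp) =
    (q : ℂ) • ((cOp hq * shiftOp) * dOp hq) := by
  refine op_ext fun k => ?_
  rw [smul_apply, mul_apply_eq_comp (dOp hq), mul_apply_eq_comp _ (dOp hq), dOp_basisVec, map_smul,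
    cOp_shiftOp_basisVec, map_smul, dOp_basisVec, smul_smul, smul_smul, smul_smul]
  congr 1; ring

theorem lower_mul_raise : (star shiftOp * cOp hq) * (cOp hq * shiftOp) =
    1 - (q : ℂ) ^ 2 • (dOp hq * dOp hq) := by
  refine op_ext fun k => ?_
  rw [sub_apply, smul_apply, one_apply_eq_self, mul_apply_eq_comp (dOp hq), dOp_basisVec, map_smul,
    dOp_basisVec, mul_apply_eq_comp, cOp_shiftOp_basisVec, map_smul, star_shiftOp_cOp_basisVec,
    Nat.add_sub_cancel, smul_smul, wt_mul_self hq, smul_smul, smul_smul, sub_smul, one_smul]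
  congr 2; ring

theorem raise_mul_lower : (cOp hq * shiftOp) * (star shiftOp * cOp hq) =
    1 - dOp hq * dOp hq := by
  refine op_ext fun k => ?_
  rw [sub_apply, one_apply_eq_self, mul_apply_eq_comp (dOp hq), dOp_basisVec, map_smul,
    dOp_basisVec, mul_apply_eq_comp, star_shiftOp_cOp_basisVec, map_smul, cOp_shiftOp_basisVec]
  rcases k with _ | k
  · simp [wt_zero]
  · rw [Nat.add_sub_cancel, smul_smul, wt_mul_self hq, smul_smul, sub_smul, one_smul]
    congr 2; ring

end SUTwo

theorem ofFn_prod_eq_mul {A : Type*} [Monoid A] : ∀ {N : ℕ} (g : Fin N → A) (a b : Fin N),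
    (a : ℕ) + 1 = b → (∀ i, i ≠ a → i ≠ b → g i = 1) → (List.ofFn g).prod = g a * g b := by
  intro N
  induction N with
  | zero => intro g a; exact a.elim0
  | succ N ih =>
    intro g a b hab h
    induction a using Fin.cases with
    | zero =>
      cases N with
      | zero => exact absurd hab (by have := b.isLt; simp at *)
      | succ N =>
        obtain rfl : b = Fin.succ 0 := Fin.ext (by simpa using hab.symm)
        have h1 : (List.ofFn fun i : Fin N => g i.succ.succ).prod = 1 := by
          refine List.prod_eq_one fun x hx => ?_
          obtain ⟨i, rfl⟩ := (List.mem_ofFn' _ _).mp hx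
          exact h _ (Fin.succ_ne_zero _) fun h => Fin.succ_ne_zero i (Fin.succ_injective _ h)
        rw [List.ofFn_succ, List.ofFn_succ, List.prod_cons, List.prod_cons, h1, mul_one]
    | succ a =>
      induction b using Fin.cases with
      | zero => simp at hab
      | succ b =>
        rw [List.ofFn_succ, List.prod_cons, h 0 (Fin.succ_ne_zero _).symm (Fin.succ_ne_zero _).symm,
          one_mul]
        exact ih (fun i => g i.succ) a b (by simpa using hab) fun i h1 h2 =>
          h _ (fun h => h1 (Fin.succ_injective _ h)) (fun h => h2 (Fin.succ_injective _ h))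

/-! ### The matrix of a simple transposition is of `SU_N` type -/

section Simple

variable {q : ℝ} (hq : q ∈ Set.Ioo (0 : ℝ) 1) {N : ℕ} {x y : Fin N}

theorem simpleMatrix_of_ne_left {l : ℕ} {i : Fin N} (h1 : (i : ℕ) ≠ l) (h2 : (i : ℕ) ≠ l + 1)
    (j : Fin N) : simpleMatrix hq N l i j = if i = j then 1 else 0 := by
  rw [simpleMatrix, dif_neg]
  rintro ⟨⟨h3, h4⟩, -⟩
  omega

theorem simpleMatrix_of_ne_right {l : ℕ} {j : Fin N} (h1 : (j : ℕ) ≠ l) (h2 : (j : ℕ) ≠ l + 1)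
    (i : Fin N) : simpleMatrix hq N l i j = if i = j then 1 else 0 := by
  rw [simpleMatrix, dif_neg]
  rintro ⟨-, h3, h4⟩
  omega

theorem simpleMatrix_lower (x : Fin N) : simpleMatrix hq N x x x = star shiftOp * cOp hq := by
  rw [simpleMatrix, dif_pos ⟨⟨le_rfl, Nat.le_succ _⟩, le_rfl, Nat.le_succ _⟩]
  simp [suTwoMatrix]

theorem simpleMatrix_up (h : (x : ℕ) + 1 = y) : simpleMatrix hq N x x y = (q : ℂ) • dOp hq := by
  rw [simpleMatrix, dif_pos ⟨⟨le_rfl, Nat.le_succ _⟩, by omega, by omega⟩]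
  have h1 : (y : ℕ) - x = 1 := by omega
  simp [suTwoMatrix, h1]

theorem simpleMatrix_down (h : (x : ℕ) + 1 = y) : simpleMatrix hq N x y x = -dOp hq := by
  rw [simpleMatrix, dif_pos ⟨⟨by omega, by omega⟩, le_rfl, Nat.le_succ _⟩]
  have h1 : (y : ℕ) - x = 1 := by omega
  simp [suTwoMatrix, h1]

theorem simpleMatrix_raise (h : (x : ℕ) + 1 = y) :
    simpleMatrix hq N x y y = cOp hq * shiftOp := by
  rw [simpleMatrix, dif_pos ⟨⟨by omega, by omega⟩, by omega, by omega⟩]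
  have h1 : (y : ℕ) - x = 1 := by omega
  simp [suTwoMatrix, h1]

/-- Inside the block `{x, y}` these are the relations of `ℂ[SU_2]_q` checked above; outside it the
entries are `0` or `1`, so products commute or vanish. -/
theorem isQMatrix_simpleMatrix (h : (x : ℕ) + 1 = y) : IsQMatrix q (simpleMatrix hq N x) := by
  have hq' : (q : ℂ) ≠ 0 := by exact_mod_cast hq.1.ne'
  have e1 := simpleMatrix_lower hq x
  have e2 := simpleMatrix_up hq h
  have e3 := simpleMatrix_down hq h
  have e4 := simpleMatrix_raise hq h
  have hl : ∀ {i : Fin N}, i ≠ x → i ≠ y → ∀ j, simpleMatrix hq N x i j = if i = j then 1 else 0 :=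
    fun {i} h1 h2 j => simpleMatrix_of_ne_left hq (by simpa [Fin.ext_iff] using h1)
      (by rw [h]; simpa [Fin.ext_iff] using h2) j
  have hr : ∀ {j : Fin N}, j ≠ x → j ≠ y → ∀ i, simpleMatrix hq N x i j = if i = j then 1 else 0 :=
    fun {j} h1 h2 i => simpleMatrix_of_ne_right hq (by simpa [Fin.ext_iff] using h1)
      (by rw [h]; simpa [Fin.ext_iff] using h2) i
  have hsc : ∀ i j c, (¬ (i = x ∨ i = y) ∨ ¬ (j = x ∨ j = y)) →
      simpleMatrix hq N x i j * c = c * simpleMatrix hq N x i j := by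
    intro i j c hij
    have : simpleMatrix hq N x i j = if i = j then 1 else 0 := by
      simp only [not_or] at hij
      rcases hij with hij | hij
      · exact hl hij.1 hij.2 j
      · exact hr hij.1 hij.2 i
    rw [this]; split_ifs <;> simp
  have hoff : ∀ i j : Fin N, i ≠ j → (i = x ∧ j = y) ∨ (i = y ∧ j = x) ∨
      simpleMatrix hq N x i j = 0 := by
    intro i j hij
    by_cases hi : i = x ∨ i = y
    · by_cases hj : j = x ∨ j = y
      · rcases hi with rfl | rfl <;> rcases hj with rfl | rfl <;> simp_all
      · rw [not_or] at hj
        rw [hr hj.1 hj.2, if_neg hij]; simp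
    · rw [not_or] at hi
      rw [hl hi.1 hi.2, if_neg hij]; simp
  have hxy : ∀ {a b : Fin N}, a < b → (a = x ∨ a = y) → (b = x ∨ b = y) → a = x ∧ b = y := by
    rintro a b hab (rfl | rfl) (rfl | rfl)
    · exact absurd hab (lt_irrefl _)
    · exact ⟨rfl, rfl⟩
    · have := Fin.lt_def.mp hab; omega
    · exact absurd hab (lt_irrefl _)
  have hlt : x < y := by rw [Fin.lt_def]; omega
  refine IsQMatrix.of_relations ?_ ?_ ?_ ?_
  · intro α a b hab
    by_cases hblock : (α = x ∨ α = y) ∧ (a = x ∨ a = y) ∧ (b = x ∨ b = y)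
    · obtain ⟨hα, ha, hb⟩ := hblock
      obtain ⟨rfl, rfl⟩ := hxy hab ha hb
      rcases hα with rfl | rfl
      · rw [e1, e2, mul_smul_comm, smul_mul_assoc, lower_mul_dOp]
      · rw [e3, e4, neg_mul, mul_neg, dOp_mul_raise, smul_neg]
    · have h0 : simpleMatrix hq N x α a = 0 ∨ simpleMatrix hq N x α b = 0 := by
        rcases eq_or_ne α a with rfl | ha
        · rcases hoff α b hab.ne with ⟨rfl, rfl⟩ | ⟨rfl, rfl⟩ | h0
          · simp at hblock
          · simp at hblock
          · exact Or.inr h0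
        · rcases hoff α a ha with ⟨rfl, rfl⟩ | ⟨rfl, rfl⟩ | h0
          · rcases hoff α b (by rintro rfl; exact hlt.asymm hab) with
              ⟨-, rfl⟩ | ⟨rfl, rfl⟩ | h0
            · simp at hblock
            · simp at hblock
            · exact Or.inr h0
          · rcases eq_or_ne α b with rfl | hb
            · simp at hblock
            · rcases hoff α b hb with ⟨rfl, rfl⟩ | ⟨-, rfl⟩ | h0
              · simp at hblock
              · simp at hblock
              · exact Or.inr h0
          · exact Or.inl h0
      rcases h0 with h0 | h0 <;> rw [h0] <;> simp
  · intro a α β hαβ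
    by_cases hblock : (a = x ∨ a = y) ∧ (α = x ∨ α = y) ∧ (β = x ∨ β = y)
    · obtain ⟨ha, hα, hβ⟩ := hblock
      obtain ⟨rfl, rfl⟩ := hxy hαβ hα hβ
      rcases ha with rfl | rfl
      · rw [e1, e3, neg_mul, mul_neg, lower_mul_dOp, smul_neg]
      · rw [e2, e4, mul_smul_comm, smul_mul_assoc, dOp_mul_raise]
    · have h0 : simpleMatrix hq N x α a = 0 ∨ simpleMatrix hq N x β a = 0 := by
        by_contra! hne
        apply hblock
        have h1 : ∀ i, simpleMatrix hq N x i a ≠ 0 → i = a ∨ (i = x ∨ i = y) ∧ (a = x ∨ a = y) := by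
          intro i hi
          rcases eq_or_ne i a with rfl | hia
          · exact Or.inl rfl
          · rcases hoff i a hia with ⟨rfl, rfl⟩ | ⟨rfl, rfl⟩ | h0
            · simp
            · simp
            · exact absurd h0 hi
        rcases h1 α hne.1 with rfl | ⟨h2, h3⟩ <;> rcases h1 β hne.2 with rfl | ⟨h4, h5⟩
        · exact absurd hαβ (lt_irrefl _)
        · exact ⟨h5, h5, h4⟩
        · exact ⟨h3, h2, h3⟩
        · exact ⟨h3, h2, h4⟩
      rcases h0 with h0 | h0 <;> rw [h0] <;> simp
  · intro α β a b hαβ hab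
    by_cases hblock : ((α = x ∨ α = y) ∧ (a = x ∨ a = y)) ∧ (β = x ∨ β = y) ∧ (b = x ∨ b = y)
    · obtain ⟨⟨hα, ha⟩, hβ, hb⟩ := hblock
      obtain ⟨rfl, rfl⟩ := hxy hαβ hα hβ
      obtain ⟨rfl, rfl⟩ := hxy hab hb ha
      rw [e2, e3, mul_neg, neg_mul, smul_mul_assoc, mul_smul_comm]
    · rw [not_and_or, not_and_or, not_and_or] at hblock
      rcases hblock with hblock | hblock
      · exact hsc α a _ hblock
      · exact (hsc β b _ hblock).symm
  · intro α β a b hαβ hab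
    by_cases hblock : ((α = x ∨ α = y) ∧ (a = x ∨ a = y)) ∧ (β = x ∨ β = y) ∧ (b = x ∨ b = y)
    · obtain ⟨⟨hα, ha⟩, hβ, hb⟩ := hblock
      obtain ⟨rfl, rfl⟩ := hxy hαβ hα hβ
      obtain ⟨rfl, rfl⟩ := hxy hab ha hb
      rw [e1, e2, e3, e4, lower_mul_raise, raise_mul_lower, mul_smul_comm, neg_mul, smul_smul,
        smul_neg, sub_mul, inv_mul_cancel₀ hq']
      module
    · have h0 : simpleMatrix hq N x β a * simpleMatrix hq N x α b = 0 := by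
        rcases eq_or_ne β a with rfl | hβa
        · rcases hoff α b (hαβ.trans hab).ne with ⟨rfl, rfl⟩ | ⟨rfl, rfl⟩ | h0
          · have := Fin.lt_def.mp hαβ; have := Fin.lt_def.mp hab; omega
          · exact absurd (hαβ.trans hab) hlt.asymm
          · rw [h0, mul_zero]
        · rcases hoff β a hβa with ⟨rfl, rfl⟩ | ⟨rfl, rfl⟩ | h0
          · rcases hoff α b (hαβ.trans (hlt.trans hab)).ne with ⟨rfl, -⟩ | ⟨rfl, -⟩ | h0
            · exact absurd hαβ (lt_irrefl _)
            · exact absurd hαβ hlt.asymm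
            · rw [h0, mul_zero]
          · have hαb : α ≠ b := by
              rintro rfl
              have := Fin.lt_def.mp hαβ; have := Fin.lt_def.mp hab; omega
            rcases hoff α b hαb with ⟨rfl, rfl⟩ | ⟨rfl, -⟩ | h0
            · simp at hblock
            · exact absurd hαβ (lt_irrefl _)
            · rw [h0, mul_zero]
          · rw [h0, zero_mul]
      rw [h0, smul_zero, add_zero]
      rw [not_and_or, not_and_or, not_and_or] at hblock
      rcases hblock with hblock | hblock
      · exact hsc α a _ hblock
      · exact (hsc β b _ hblock).symm

/-- Only the identity and the transposition of `x, y` contribute to the determinant, and they add up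
to `1` by `lower_mul_raise`. -/
theorem isSUMatrix_simpleMatrix (h : (x : ℕ) + 1 = y) :
    IsSUMatrix q (simpleMatrix hq N x) where
  isQMatrix := isQMatrix_simpleMatrix hq h
  qDet_eq_one := by
    have hlt : x < y := by rw [Fin.lt_def]; omega
    have hl : ∀ {i : Fin N}, i ≠ x → i ≠ y → ∀ j,
        simpleMatrix hq N x j i = if j = i then 1 else 0 :=
      fun {i} h1 h2 j => simpleMatrix_of_ne_right hq (by simpa [Fin.ext_iff] using h1)
        (by rw [h]; simpa [Fin.ext_iff] using h2) j
    have hne : (1 : Equiv.Perm (Fin N)) ≠ Equiv.swap x y := by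
      intro h1
      have := Equiv.congr_fun h1 x
      rw [Equiv.swap_apply_left] at this
      exact hlt.ne this
    have hid : permLength (1 : Equiv.Perm (Fin N)) = 0 := by
      rw [permLength, Finset.card_eq_zero, Finset.filter_eq_empty_iff]
      rintro ⟨x, y⟩ _ ⟨h1, h2⟩
      exact absurd h1 (lt_asymm h2)
    have hsw : permLength (Equiv.swap x y) = 1 := by
      have := invCount_comp_swap ((1 : Equiv.Perm (Fin N)) : Fin N → Fin N) h hlt
      rw [← permLength_eq_invCount, hid] at this
      exact this
    rw [qDet, Fintype.sum_eq_add 1 (Equiv.swap x y) hne]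
    · rw [ofFn_prod_eq_mul _ x y h, ofFn_prod_eq_mul _ x y h]
      · simp only [Equiv.Perm.one_apply, Equiv.swap_apply_left, Equiv.swap_apply_right, hid, hsw,
          pow_zero, pow_one, one_smul]
        rw [simpleMatrix_lower, simpleMatrix_up hq h, simpleMatrix_down hq h,
          simpleMatrix_raise hq h, lower_mul_raise, mul_smul_comm, neg_mul]
        module
      · intro i h1 h2
        rw [hl h1 h2, Equiv.swap_apply_of_ne_of_ne h1 h2, if_pos rfl]
      · intro i h1 h2
        rw [hl h1 h2, Equiv.Perm.one_apply, if_pos rfl]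
    · rintro s ⟨h1, h2⟩
      -- Any other permutation moves an index outside the block, where the matrix is the identity,
      -- so its term contains a zero factor.
      obtain ⟨j, hjx, hjy, hj⟩ : ∃ j, j ≠ x ∧ j ≠ y ∧ s j ≠ j := by
        by_contra! hs
        have hmem : ∀ i, i = x ∨ i = y → s i = x ∨ s i = y := by
          intro i hi
          by_contra! hsi
          have := s.injective (hs _ hsi.1 hsi.2)
          rw [this] at hsi
          rcases hi with rfl | rfl
          · exact hsi.1 rfl
          · exact hsi.2 rfl
        rcases hmem x (Or.inl rfl) with hx | hx
        · refine h1 (Equiv.ext fun i => ?_)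
          by_cases hix : i = x
          · rw [hix, hx, Equiv.Perm.one_apply]
          · by_cases hiy : i = y
            · rcases hmem y (Or.inr rfl) with hy | hy
              · exact absurd (s.injective (hx.trans hy.symm)) hlt.ne
              · rw [hiy, hy, Equiv.Perm.one_apply]
            · rw [hs i hix hiy, Equiv.Perm.one_apply]
        · refine h2 (Equiv.ext fun i => ?_)
          by_cases hix : i = x
          · rw [hix, hx, Equiv.swap_apply_left]
          · by_cases hiy : i = y
            · rcases hmem y (Or.inr rfl) with hy | hy
              · rw [hiy, hy, Equiv.swap_apply_right]
              · exact absurd (s.injective (hx.trans hy.symm)) hlt.ne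
            · rw [hs i hix hiy, Equiv.swap_apply_of_ne_of_ne hix hiy]
      rw [List.prod_eq_zero, smul_zero]
      exact (List.mem_ofFn' _ _).mpr ⟨j, by simp only; rw [hl hjx hjy, if_neg hj]⟩
  mul_conjTranspose := by
    have hlt : x < y := by rw [Fin.lt_def]; omega
    have hl : ∀ {i : Fin N}, i ≠ x → i ≠ y → ∀ j,
        simpleMatrix hq N x i j = if i = j then 1 else 0 :=
      fun {i} h1 h2 j => simpleMatrix_of_ne_left hq (by simpa [Fin.ext_iff] using h1)
        (by rw [h]; simpa [Fin.ext_iff] using h2) j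
    have hr : ∀ {i : Fin N}, i ≠ x → i ≠ y → ∀ j,
        simpleMatrix hq N x j i = if j = i then 1 else 0 :=
      fun {i} h1 h2 j => simpleMatrix_of_ne_right hq (by simpa [Fin.ext_iff] using h1)
        (by rw [h]; simpa [Fin.ext_iff] using h2) j
    have hqs : star (q : ℂ) = q := Complex.conj_ofReal q
    ext1 i k
    rw [Matrix.mul_apply, Matrix.one_apply]
    simp only [Matrix.conjTranspose_apply]
    by_cases hi : i = x ∨ i = y
    · have hsum : ∑ j, simpleMatrix hq N x i j * star (simpleMatrix hq N x k j) =
          simpleMatrix hq N x i x * star (simpleMatrix hq N x k x) +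
            simpleMatrix hq N x i y * star (simpleMatrix hq N x k y) := by
        refine Fintype.sum_eq_add x y hlt.ne ?_
        rintro j ⟨h1, h2⟩
        rw [hr h1 h2, if_neg, zero_mul]
        rintro rfl
        exact hi.elim h1 h2
      rw [hsum]
      by_cases hk : k = x ∨ k = y
      · rcases hi with rfl | rfl <;> rcases hk with rfl | rfl
        · rw [simpleMatrix_lower, simpleMatrix_up hq h, star_star_shiftOp_cOp, lower_mul_raise,
            star_smul, star_dOp, hqs, if_pos rfl, smul_mul_smul_comm]
          module
        · rw [simpleMatrix_lower, simpleMatrix_up hq h, simpleMatrix_down hq h,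
            simpleMatrix_raise hq h, star_neg, star_dOp, star_cOp_shiftOp, if_neg hlt.ne, mul_neg,
            lower_mul_dOp, smul_mul_assoc, neg_add_cancel]
        · rw [simpleMatrix_lower, simpleMatrix_up hq h, simpleMatrix_down hq h,
            simpleMatrix_raise hq h, star_star_shiftOp_cOp, star_smul, star_dOp, hqs,
            if_neg hlt.ne', neg_mul, dOp_mul_raise, mul_smul_comm, neg_add_cancel]
        · rw [simpleMatrix_down hq h, simpleMatrix_raise hq h, star_neg, star_dOp,
            star_cOp_shiftOp, if_pos rfl, raise_mul_lower, neg_mul_neg, add_sub_cancel]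
      · rw [not_or] at hk
        rw [hl hk.1 hk.2, hl hk.1 hk.2, if_neg hk.1, if_neg hk.2, star_zero, mul_zero, mul_zero,
          add_zero, if_neg]
        rintro rfl
        exact hi.elim hk.1 hk.2
    · rw [not_or] at hi
      simp only [hl hi.1 hi.2, ite_mul, one_mul, zero_mul, Finset.sum_ite_eq, Finset.mem_univ,
        if_true]
      rw [hr hi.1 hi.2]
      rcases eq_or_ne i k with rfl | hik
      · simp
      · rw [if_neg hik, if_neg hik.symm, star_zero]

end Simple

/-! ### Existence and uniqueness of `π_u` -/

section PiU

variable {q : ℝ} (hq : q ∈ Set.Ioo (0 : ℝ) 1)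

theorem isSUMatrix_wordOp {N m : ℕ} (w : Fin m → ℕ) (hw : ∀ r, w r + 1 < N) :
    IsSUMatrix q (Matrix.of (wordOp hq N w)) := by
  have h : Matrix.of (wordOp hq N w) = (List.ofFn (slotMatrix hq N w)).prod := by
    ext1 i j
    exact wordOp_eq hq N w i j
  rw [h]
  refine isSUMatrix_ofFn_prod hq.1.ne' _ (fun r => ?_) fun r s hrs i j k l =>
    slotOp_commute hrs _ _
  have h1 := isSUMatrix_simpleMatrix hq (x := (⟨w r, by have := hw r; omega⟩ : Fin N))
    (y := ⟨w r + 1, hw r⟩) rfl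
  exact h1.map (slotHom r)

theorem halfSwapWord_lt (n : ℕ) (r : Fin (n ^ 2)) : halfSwapWord n r + 1 < n + n := by
  have hn : 0 < n := by
    rcases Nat.eq_zero_or_pos n with rfl | h
    · exact r.elim0
    · exact h
  have h1 : (r : ℕ) / n < n := Nat.div_lt_of_lt_mul (r.isLt.trans_eq (pow_two n))
  have h2 : (r : ℕ) % n < n := Nat.mod_lt _ hn
  rw [halfSwapWord]
  omega

theorem existsUnique_piU (n : ℕ) :
    ∃! πu : CSU (n + n) q →⋆ₐ[ℂ] (ℓ²(Fin (n ^ 2) → ℕ, ℂ) →L[ℂ] ℓ²(Fin (n ^ 2) → ℕ, ℂ)),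
      ∀ i j, πu (tGen (n + n) q i j) = piUOp hq n i j := by
  obtain ⟨F, hF⟩ := (isSUMatrix_wordOp hq (halfSwapWord n) (halfSwapWord_lt n)).exists_hom hq.1.ne'
  exact ⟨F, hF, fun G hG => StarPresented.hom_ext fun x => (hG x.1 x.2).trans (hF x.1 x.2).symm⟩

end PiU

/-! ### The action of `π_u` on basis vectors -/

section Recursion

variable {q : ℝ} (hq : q ∈ Set.Ioo (0 : ℝ) 1) {N m : ℕ} (w : Fin m → ℕ)

theorem slotMatrix_commute {r s : Fin m} (hrs : r ≠ s) (A : ℓ²(ℕ, ℂ) →L[ℂ] ℓ²(ℕ, ℂ))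
    (x y : Fin N) : Commute (slotOp r A) (slotMatrix hq N w s x y) :=
  slotOp_commute hrs _ _

/-- One transposition is one step of a transfer recursion on vectors indexed by states: only the
states `w r` and `w r + 1` are mixed. -/
theorem sum_slotMatrix_row {l : Fin N} {r : Fin m} (hl : (l : ℕ) = w r) (hw : w r + 1 < N)
    (v : Fin N → ℓ²(Fin m → ℕ, ℂ)) :
    (∀ x : Fin N, (x : ℕ) ≠ w r → (x : ℕ) ≠ w r + 1 →
      ∑ y, slotMatrix hq N w r x y (v y) = v x) ∧
    (∑ y, slotMatrix hq N w r l y (v y) = slotOp r (star shiftOp * cOp hq) (v l) +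
      (q : ℂ) • slotOp r (dOp hq) (v ⟨w r + 1, hw⟩)) ∧
    (∑ y, slotMatrix hq N w r ⟨w r + 1, hw⟩ y (v y) = -slotOp r (dOp hq) (v l) +
      slotOp r (cOp hq * shiftOp) (v ⟨w r + 1, hw⟩)) := by
  have hlu : (l : ℕ) + 1 = ((⟨w r + 1, hw⟩ : Fin N) : ℕ) := by rw [hl]
  have hne : l ≠ ⟨w r + 1, hw⟩ := fun h => by rw [← h] at hlu; omega
  have h0 : ∀ x y : Fin N, (y ≠ l ∧ y ≠ ⟨w r + 1, hw⟩) → x ≠ y →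
      slotMatrix hq N w r x y (v y) = 0 := by
    rintro x y ⟨h1, h2⟩ hxy
    rw [slotMatrix, Matrix.map_apply, simpleMatrix_of_ne_right, if_neg hxy, map_zero]
    · rfl
    · rw [← hl]; exact fun h => h1 (Fin.ext h)
    · exact fun h => h2 (Fin.ext h)
  refine ⟨fun x h1 h2 => ?_, ?_, ?_⟩
  · rw [Finset.sum_eq_single x]
    · rw [slotMatrix, Matrix.map_apply, simpleMatrix_of_ne_left hq h1 h2, if_pos rfl, map_one]
      rfl
    · intro y _ hy
      rw [slotMatrix, Matrix.map_apply, simpleMatrix_of_ne_left hq h1 h2, if_neg hy.symm, map_zero]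
      rfl
    · simp
  · rw [Fintype.sum_eq_add l ⟨w r + 1, hw⟩ hne fun y hy => h0 l y hy hy.1.symm]
    simp only [slotMatrix, Matrix.map_apply, ← hl]
    rw [simpleMatrix_lower, simpleMatrix_up hq (by simp [hl]), map_smul]
    rfl
  · rw [Fintype.sum_eq_add l ⟨w r + 1, hw⟩ hne fun y hy => h0 _ y hy hy.2.symm]
    simp only [slotMatrix, Matrix.map_apply, ← hl]
    rw [simpleMatrix_down hq (by simp [hl]), simpleMatrix_raise hq (by simp [hl]), map_neg]
    rfl

theorem sum_star_slotMatrix_col {l : Fin N} {r : Fin m} (hl : (l : ℕ) = w r) (hw : w r + 1 < N)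
    (v : Fin N → ℓ²(Fin m → ℕ, ℂ)) :
    (∀ y : Fin N, (y : ℕ) ≠ w r → (y : ℕ) ≠ w r + 1 →
      ∑ x, star (slotMatrix hq N w r x y) (v x) = v y) ∧
    (∑ x, star (slotMatrix hq N w r x l) (v x) = slotOp r (cOp hq * shiftOp) (v l) -
      slotOp r (dOp hq) (v ⟨w r + 1, hw⟩)) ∧
    (∑ x, star (slotMatrix hq N w r x ⟨w r + 1, hw⟩) (v x) = (q : ℂ) • slotOp r (dOp hq) (v l) +
      slotOp r (star shiftOp * cOp hq) (v ⟨w r + 1, hw⟩)) := by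
  have hlu : (l : ℕ) + 1 = ((⟨w r + 1, hw⟩ : Fin N) : ℕ) := by rw [hl]
  have hne : l ≠ ⟨w r + 1, hw⟩ := fun h => by rw [← h] at hlu; omega
  have h0 : ∀ x y : Fin N, (x ≠ l ∧ x ≠ ⟨w r + 1, hw⟩) → x ≠ y →
      star (slotMatrix hq N w r x y) (v x) = 0 := by
    rintro x y ⟨h1, h2⟩ hxy
    rw [slotMatrix, Matrix.map_apply, simpleMatrix_of_ne_left, if_neg hxy, map_zero, star_zero]
    · rfl
    · rw [← hl]; exact fun h => h1 (Fin.ext h)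
    · exact fun h => h2 (Fin.ext h)
  refine ⟨fun y h1 h2 => ?_, ?_, ?_⟩
  · rw [Finset.sum_eq_single y]
    · rw [slotMatrix, Matrix.map_apply, simpleMatrix_of_ne_right hq h1 h2, if_pos rfl, map_one,
        star_one]
      rfl
    · intro x _ hx
      rw [slotMatrix, Matrix.map_apply, simpleMatrix_of_ne_right hq h1 h2, if_neg hx, map_zero,
        star_zero]
      rfl
    · simp
  · rw [Fintype.sum_eq_add l ⟨w r + 1, hw⟩ hne fun y hy => h0 y l hy hy.1]
    simp only [slotMatrix, Matrix.map_apply, ← hl, ← map_star]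
    rw [simpleMatrix_lower, simpleMatrix_down hq (by simp [hl]), star_star_shiftOp_cOp, star_neg,
      star_dOp, map_neg, sub_eq_add_neg]
    rfl
  · rw [Fintype.sum_eq_add l ⟨w r + 1, hw⟩ hne fun y hy => h0 y _ hy hy.2]
    simp only [slotMatrix, Matrix.map_apply, ← hl, ← map_star]
    rw [simpleMatrix_up hq (by simp [hl]), simpleMatrix_raise hq (by simp [hl]), star_cOp_shiftOp,
      star_smul, star_dOp, map_smul, show star (q : ℂ) = q from Complex.conj_ofReal q]
    rfl

theorem commute_list_matrix_prod {E : Type*} [Ring E] (x : E) :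
    ∀ L : List (Matrix (Fin N) (Fin N) E), (∀ M ∈ L, ∀ i j, Commute x (M i j)) →
      ∀ i j, Commute x (L.prod i j) := by
  intro L
  induction L with
  | nil =>
    intro _ i j
    rw [List.prod_nil, Matrix.one_apply]
    split_ifs
    · exact Commute.one_right x
    · exact Commute.zero_right x
  | cons M L ih =>
    intro h i j
    rw [List.prod_cons, Matrix.mul_apply]
    exact Commute.sum_right _ _ _ fun k _ => (h M (by simp) i k).mul_right
      (ih (fun M' hM' => h M' (by simp [hM'])) k j)

/-- The vectors obtained from `v` by the last factors of the word, as functions of the initial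
state, and their recursion. -/
theorem exists_suffix_vectors (hw : ∀ r, w r + 1 < N) (i j : Fin N) (v : ℓ²(Fin m → ℕ, ℂ)) :
    ∃ Q : ℕ → ℕ → ℓ²(Fin m → ℕ, ℂ), Q 0 i = wordOp hq N w i j v ∧
      (∀ x < N, Q m x = if x = j then v else 0) ∧
      (∀ (r : Fin m) (x : ℕ), x < N → x ≠ w r → x ≠ w r + 1 → Q r x = Q (r + 1) x) ∧
      (∀ r : Fin m, Q r (w r) = slotOp r (star shiftOp * cOp hq) (Q (r + 1) (w r)) +
        (q : ℂ) • slotOp r (dOp hq) (Q (r + 1) (w r + 1))) ∧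
      (∀ r : Fin m, Q r (w r + 1) = -slotOp r (dOp hq) (Q (r + 1) (w r)) +
        slotOp r (cOp hq * shiftOp) (Q (r + 1) (w r + 1))) ∧
      ∀ (r : Fin m) (s : ℕ) (A : ℓ²(ℕ, ℂ) →L[ℂ] ℓ²(ℕ, ℂ)) (c : ℂ), (r : ℕ) < s →
        slotOp r A v = c • v → ∀ x < N, slotOp r A (Q s x) = c • Q s x := by
  set L := List.ofFn (slotMatrix hq N w) with hL
  have hlen : L.length = m := by rw [hL, List.length_ofFn]
  have hget : ∀ r : Fin m, L.drop r = slotMatrix hq N w r :: L.drop (r + 1) := by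
    intro r
    rw [List.drop_eq_getElem_cons (by rw [hlen]; exact r.isLt)]
    simp [hL]
  -- States are natural numbers to ease the arithmetic; those `≥ N` get the dummy value `0`.
  set Q : ℕ → ℕ → ℓ²(Fin m → ℕ, ℂ) := fun r x =>
    if h : x < N then (L.drop r).prod ⟨x, h⟩ j v else 0 with hQ
  have hQx : ∀ r (x : Fin N), Q r x = (L.drop r).prod x j v := fun r x => by
    simp only [hQ, x.isLt, dif_pos]
  have hstep : ∀ (r : Fin m) (x : Fin N),
      Q r x = ∑ y : Fin N, slotMatrix hq N w r x y (Q (r + 1) y) := by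
    intro r x
    simp only [hQx]
    rw [hget, List.prod_cons, Matrix.mul_apply, _root_.sum_apply]
    rfl
  have hrow := fun r : Fin m => sum_slotMatrix_row hq w (N := N)
    (l := ⟨w r, (Nat.lt_succ_self _).trans (hw r)⟩) rfl (hw r) fun y => Q (r + 1) y
  refine ⟨Q, ?_, ?_, ?_, ?_, ?_, ?_⟩
  · rw [hQx, wordOp_eq, List.drop_zero]
  · intro x hx
    have := hQx m ⟨x, hx⟩
    rw [this, List.drop_of_length_le hlen.le, List.prod_nil, Matrix.one_apply]
    simp only [Fin.ext_iff]
    split_ifs <;> rfl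
  · intro r x hx h1 h2
    exact (hstep r ⟨x, hx⟩).trans ((hrow r).1 ⟨x, hx⟩ h1 h2)
  · intro r
    exact (hstep r ⟨w r, _⟩).trans (hrow r).2.1
  · intro r
    exact (hstep r ⟨w r + 1, hw r⟩).trans (hrow r).2.2
  · intro r s A c hrs hv x hx
    have h1 := hQx s ⟨x, hx⟩
    simp only at h1
    -- The factors from `s` on act in places other than `r`, so an eigenvector property of `v` at
    -- place `r` persists.
    have h2 : Commute (slotOp r A) ((L.drop s).prod ⟨x, hx⟩ j) := by
      refine commute_list_matrix_prod _ _ (fun M hM k l => ?_) _ _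
      obtain ⟨t, ht, rfl⟩ := List.mem_iff_getElem.mp hM
      rw [List.length_drop, hlen] at ht
      have : (L.drop s)[t] = slotMatrix hq N w ⟨s + t, by omega⟩ := by
        simp [hL]
      rw [this]
      exact slotMatrix_commute hq w (fun h => by rw [Fin.ext_iff] at h; simp at h; omega) A k l
    rw [h1, ← mul_apply_eq_comp, h2.eq, mul_apply_eq_comp, hv, map_smul]

/-- The vectors obtained from `v` by the adjoints of the first factors of the word, as functions of
the final state, and their recursion. -/
theorem exists_prefix_vectors (hw : ∀ r, w r + 1 < N) (i j : Fin N) (v : ℓ²(Fin m → ℕ, ℂ)) :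
    ∃ V : ℕ → ℕ → ℓ²(Fin m → ℕ, ℂ), V m j = star (wordOp hq N w i j) v ∧
      (∀ x < N, V 0 x = if x = i then v else 0) ∧
      (∀ (r : Fin m) (x : ℕ), x < N → x ≠ w r → x ≠ w r + 1 → V (r + 1) x = V r x) ∧
      (∀ r : Fin m, V (r + 1) (w r) = slotOp r (cOp hq * shiftOp) (V r (w r)) -
        slotOp r (dOp hq) (V r (w r + 1))) ∧
      (∀ r : Fin m, V (r + 1) (w r + 1) = (q : ℂ) • slotOp r (dOp hq) (V r (w r)) +
        slotOp r (star shiftOp * cOp hq) (V r (w r + 1))) := by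
  set L := List.ofFn (slotMatrix hq N w) with hL
  have hlen : L.length = m := by rw [hL, List.length_ofFn]
  have hget : ∀ r : Fin m, L.take (r + 1) = L.take r ++ [slotMatrix hq N w r] := by
    intro r
    rw [List.take_succ_eq_append_getElem (by rw [hlen]; exact r.isLt)]
    simp [hL]
  set V : ℕ → ℕ → ℓ²(Fin m → ℕ, ℂ) := fun r x =>
    if h : x < N then star ((L.take r).prod i ⟨x, h⟩) v else 0 with hV
  have hVx : ∀ r (x : Fin N), V r x = star ((L.take r).prod i x) v := fun r x => by
    simp only [hV, x.isLt, dif_pos]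
  -- Adjoints reverse products, so the adjoint of the newest factor is applied last and the
  -- recursion runs forward.
  have hstep : ∀ (r : Fin m) (y : Fin N),
      V (r + 1) y = ∑ x : Fin N, star (slotMatrix hq N w r x y) (V r x) := by
    intro r y
    simp only [hVx]
    rw [hget, List.prod_append, List.prod_singleton, Matrix.mul_apply, star_sum,
      _root_.sum_apply]
    simp only [star_mul]
    rfl
  have hcol := fun r : Fin m => sum_star_slotMatrix_col hq w (N := N)
    (l := ⟨w r, (Nat.lt_succ_self _).trans (hw r)⟩) rfl (hw r) fun y => V r y
  refine ⟨V, ?_, ?_, ?_, ?_, ?_⟩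
  · rw [hVx, wordOp_eq, List.take_of_length_le hlen.le]
  · intro x hx
    have := hVx 0 ⟨x, hx⟩
    rw [this, List.take_zero, List.prod_nil, Matrix.one_apply]
    simp only [Fin.ext_iff, eq_comm (a := x)]
    split_ifs
    · rw [star_one]; rfl
    · rw [star_zero]; rfl
  · intro r x hx h1 h2
    exact (hstep r ⟨x, hx⟩).trans ((hcol r).1 ⟨x, hx⟩ h1 h2)
  · intro r
    exact (hstep r ⟨w r, _⟩).trans (hcol r).2.1
  · intro r
    exact (hstep r ⟨w r + 1, hw r⟩).trans (hcol r).2.2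

end Recursion

/-! ### Paths through the word of `u`: one surviving path, and the vacuum -/

section HalfSwap

variable {q : ℝ} (hq : q ∈ Set.Ioo (0 : ℝ) 1) {n : ℕ}

/-- The tensor factor of the `ρ`-th transposition of the `k`-th cycle. -/
def slotIdx (k ρ : Fin n) : Fin (n ^ 2) :=
  ⟨k * n + ρ, by
    have h1 := Nat.mul_le_mul_right n (Nat.succ_le_of_lt k.isLt)
    have h2 := ρ.isLt
    rw [Nat.succ_mul] at h1
    rw [pow_two]
    omega⟩

theorem halfSwapWord_slotIdx (k ρ : Fin n) :
    halfSwapWord n (slotIdx k ρ) = k + (n - 1 - ρ) := by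
  have hn : 0 < n := k.pos
  have h1 : ((k : ℕ) * n + ρ) / n = k := by
    rw [mul_comm, Nat.mul_add_div hn, Nat.div_eq_of_lt ρ.isLt, add_zero]
  have h2 : ((k : ℕ) * n + ρ) % n = ρ := by
    rw [mul_comm, Nat.mul_add_mod, Nat.mod_eq_of_lt ρ.isLt]
  rw [halfSwapWord]
  simp only [slotIdx, h1, h2]

theorem slotIdx_injective {k ρ k' ρ' : Fin n} (h : slotIdx k ρ = slotIdx k' ρ') :
    k = k' ∧ ρ = ρ' := by
  have hn : 0 < n := k.pos
  have h0 : (k : ℕ) * n + ρ = k' * n + ρ' := congrArg Fin.val h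
  have h1 := congrArg (· / n) h0
  have h2 := congrArg (· % n) h0
  simp only [mul_comm _ n, Nat.mul_add_div hn, Nat.div_eq_of_lt ρ.isLt, Nat.div_eq_of_lt ρ'.isLt,
    add_zero, Nat.mul_add_mod, Nat.mod_eq_of_lt ρ.isLt, Nat.mod_eq_of_lt ρ'.isLt] at h1 h2
  exact ⟨Fin.ext h1, Fin.ext h2⟩

theorem exists_slotIdx (r : Fin (n ^ 2)) : ∃ k ρ, r = slotIdx (n := n) k ρ := by
  have hn : 0 < n := by
    rcases Nat.eq_zero_or_pos n with rfl | h
    · exact r.elim0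
    · exact h
  refine ⟨⟨r / n, Nat.div_lt_of_lt_mul (r.isLt.trans_eq (pow_two n))⟩,
    ⟨r % n, Nat.mod_lt _ hn⟩, Fin.ext ?_⟩
  simp only [slotIdx]
  rw [mul_comm, Nat.div_add_mod]

theorem slotOp_lower_basisVec {m : ℕ} (r : Fin m) (κ : Fin m → ℕ) :
    slotOp r (star shiftOp * cOp hq) (basisVec κ) =
      wt q (κ r) • basisVec (Function.update κ r (κ r - 1)) :=
  slotOp_basisVec_of_eq (star_shiftOp_cOp_basisVec hq _)

theorem slotOp_raise_basisVec {m : ℕ} (r : Fin m) (κ : Fin m → ℕ) :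
    slotOp r (cOp hq * shiftOp) (basisVec κ) =
      wt q (κ r + 1) • basisVec (Function.update κ r (κ r + 1)) :=
  slotOp_basisVec_of_eq (cOp_shiftOp_basisVec hq _)

theorem slotOp_dOp_basisVec {m : ℕ} (r : Fin m) (κ : Fin m → ℕ) :
    slotOp r (dOp hq) (basisVec κ) = (q : ℂ) ^ κ r • basisVec κ := by
  rw [slotOp_basisVec_of_eq (dOp_basisVec hq _), Function.update_eq_self]

/-- `π_u(t_{n+i,n+j})` raises one coordinate of the basis vectors supported in the rows `≤ i`. -/
theorem piUOp_basisVec (i j : Fin n) (κ : Fin (n ^ 2) → ℕ)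
    (hκ : ∀ k ρ, i < k → κ (slotIdx k ρ) = 0) :
    ∃ c : ℂ, c ≠ 0 ∧ piUOp hq n (Fin.natAdd n i) (Fin.natAdd n j) (basisVec κ) =
      c • basisVec (Function.update κ (slotIdx i j.rev) (κ (slotIdx i j.rev) + 1)) := by
  have hq' : (q : ℂ) ≠ 0 := by exact_mod_cast hq.1.ne'
  obtain ⟨Q, hQ0, hQm, hQid, hQlow, hQup, hQeig⟩ := exists_suffix_vectors hq (halfSwapWord n)
    (halfSwapWord_lt n) (Fin.natAdd n i) (Fin.natAdd n j) (basisVec κ)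
  have hi := i.isLt
  have hj := j.isLt
  rw [Fin.val_natAdd] at hQ0
  simp only [Fin.val_natAdd] at hQm
  -- the recursion in terms of rows and positions in the row
  have hid : ∀ k ρ x : ℕ, k < n → ρ < n → x < n + n → x ≠ k + (n - 1 - ρ) →
      x ≠ k + (n - 1 - ρ) + 1 → Q (k * n + ρ) x = Q (k * n + (ρ + 1)) x := by
    intro k ρ x hk hρ hx h1 h2
    have := hQid (slotIdx ⟨k, hk⟩ ⟨ρ, hρ⟩) x hx
    rw [halfSwapWord_slotIdx] at this
    exact this h1 h2
  have hrows : ∀ k, Q (k * n + n) = Q ((k + 1) * n + 0) := fun k => by rw [Nat.succ_mul, add_zero]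
  -- rows below the `i`-th
  have hA : ∀ d k : ℕ, k + d = n → i < k → ∀ x < n + k,
      Q (k * n + 0) x = if x = j + k then (q : ℂ) ^ d • basisVec κ else 0 := by
    intro d
    induction d with
    | zero =>
      intro k hk hik x hx
      obtain rfl : k = n := by omega
      rw [add_zero, ← pow_two, hQm x (by omega), pow_zero, one_smul]
      simp only [add_comm]
    | succ d ih =>
      intro k hk hik x hx
      have hkn : k < n := by omega
      -- All coordinates of `κ` in this row are `0`, so the lowering entry gives `0` and `d(q)` acts
      -- as `1`. A state `x` from `k` to `k + n - 1` is moved to `x + 1` with a factor `q` by the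
      -- transposition of label `x`, and is untouched afterwards since the labels decrease. States
      -- with `x + ρ < k + n` have not passed this point, those with `x + ρ > k + n` have; the state
      -- with equality is not needed.
      have inner : ∀ e ρ : ℕ, ρ + e = n →
          (∀ x, x + ρ < k + n → Q (k * n + ρ) x =
            if x = j + k then (q : ℂ) ^ (d + 1) • basisVec κ else 0) ∧
          (∀ x, k + n < x + ρ → x ≤ n + k → Q (k * n + ρ) x =
            if x = j + k + 1 then (q : ℂ) ^ d • basisVec κ else 0) := by
        intro e
        induction e with
        | zero =>
          intro ρ hρ
          obtain rfl : ρ = n := by omega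
          have h1 := ih (k + 1) (by omega) (by omega)
          rw [hrows]
          refine ⟨fun x hx => ?_, fun x hx hx' => h1 x (by omega)⟩
          rw [h1 x (by omega), if_neg (by omega), if_neg (by omega)]
        | succ e ihe =>
          intro ρ hρ
          obtain ⟨ih1, ih2⟩ := ihe (ρ + 1) (by omega)
          have hρn : ρ < n := by omega
          refine ⟨fun x hx => ?_, fun x hx hx' => ?_⟩
          · by_cases hxl : x = k + (n - 1 - ρ)
            · have h1 := hQlow (slotIdx ⟨k, hkn⟩ ⟨ρ, hρn⟩)
              rw [halfSwapWord_slotIdx] at h1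
              simp only [← hxl] at h1
              have hκ0 : κ (slotIdx ⟨k, hkn⟩ ⟨ρ, hρn⟩) = 0 := hκ _ _ (by simpa [Fin.lt_def] using hik)
              have h2 := hQeig (slotIdx ⟨k, hkn⟩ ⟨ρ, hρn⟩) (k * n + (ρ + 1))
                (star shiftOp * cOp hq) 0 (by simp [slotIdx])
                (by rw [slotOp_lower_basisVec, hκ0, wt_zero, zero_smul, zero_smul]) x (by omega)
              have h3 := hQeig (slotIdx ⟨k, hkn⟩ ⟨ρ, hρn⟩) (k * n + (ρ + 1))
                (dOp hq) 1 (by simp [slotIdx])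
                (by rw [slotOp_dOp_basisVec, hκ0, pow_zero]) (x + 1) (by omega)
              change Q (k * n + ρ) x = _ at h1
              rw [h1]
              change slotOp _ _ (Q (k * n + (ρ + 1)) x) +
                (q : ℂ) • slotOp _ _ (Q (k * n + (ρ + 1)) (x + 1)) = _
              rw [h2, h3, zero_smul, zero_add, one_smul, ih2 (x + 1) (by omega) (by omega)]
              simp only [add_left_inj]
              split_ifs
              · rw [smul_smul]
                congr 1
                exact (pow_succ' _ _).symm
              · rw [smul_zero]
            · rw [hid k ρ x hkn hρn (by omega) hxl (by omega)]
              exact ih1 x (by omega)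
          · rw [hid k ρ x hkn hρn (by omega) (by omega) (by omega)]
            exact ih2 x (by omega) hx'
      exact (inner n 0 (by omega)).1 x (by omega)
  -- the `i`-th row
  set s := slotIdx i j.rev with hs
  set κ' := Function.update κ s (κ s + 1) with hκ'
  -- The state `i + n - ρ` is the upper one of the next transposition. Either it goes down with
  -- `-d(q)`, or it stays, raising place `ρ`, and is then fixed to the end of the row. The later
  -- rows lead to the final state `n + j` only from `j + i + 1`, so the path must stay exactly at `ρ
  -- = n - 1 - j`, that is at column `j.rev`.
  have hB : ∀ e ρ : ℕ, ρ + e = n →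
      (∀ x, i + n < x + ρ → x ≤ n + i → Q (i * n + ρ) x =
        if x = j + i + 1 then (q : ℂ) ^ (n - 1 - i) • basisVec κ else 0) ∧
      (n - 1 - j < ρ → Q (i * n + ρ) (i + n - ρ) = 0) ∧
      (ρ ≤ n - 1 - j → ∃ c : ℂ, c ≠ 0 ∧ Q (i * n + ρ) (i + n - ρ) = c • basisVec κ') := by
    intro e
    induction e with
    | zero =>
      intro ρ hρ
      obtain rfl : ρ = n := by omega
      have h1 := hA (ρ - 1 - i) (i + 1) (by omega) (by omega)
      rw [hrows]
      refine ⟨fun x hx hx' => h1 x (by omega), fun _ => ?_, fun h => by omega⟩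
      rw [h1 _ (by omega), if_neg (by omega)]
    | succ e ihe =>
      intro ρ hρ
      obtain ⟨ih1, ih2, ih3⟩ := ihe (ρ + 1) (by omega)
      have hρn : ρ < n := by omega
      have h1 := hQup (slotIdx i ⟨ρ, hρn⟩)
      rw [halfSwapWord_slotIdx] at h1
      have e1 : (i : ℕ) + (n - 1 - ρ) = i + n - (ρ + 1) := by omega
      have e2 : (i : ℕ) + n - (ρ + 1) + 1 = i + n - ρ := by omega
      simp only [e1, e2] at h1
      change Q (i * n + ρ) (i + n - ρ) =
        -slotOp _ _ (Q (i * n + (ρ + 1)) _) + slotOp _ _ (Q (i * n + (ρ + 1)) _) at h1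
      rw [ih1 (i + n - ρ) (by omega) (by omega)] at h1
      refine ⟨fun x hx hx' => ?_, fun hR => ?_, fun hR => ?_⟩
      · rw [hid i ρ x hi hρn (by omega) (by omega) (by omega)]
        exact ih1 x (by omega) hx'
      · rw [h1, ih2 (by omega), if_neg (by omega)]
        simp
      · rcases hR.lt_or_eq with hR | hR
        · obtain ⟨c, hc, h2⟩ := ih3 (by omega)
          refine ⟨-(c * (q : ℂ) ^ κ' (slotIdx i ⟨ρ, hρn⟩)),
            neg_ne_zero.mpr (mul_ne_zero hc (pow_ne_zero _ hq')), ?_⟩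
          rw [h1, h2, if_neg (by omega), map_zero, add_zero, map_smul, slotOp_dOp_basisVec,
            smul_smul, neg_smul]
        · have hsρ : slotIdx i ⟨ρ, hρn⟩ = s := by
            rw [hs]
            congr 1
            ext
            rw [Fin.val_rev]
            simp only
            omega
          refine ⟨(q : ℂ) ^ (n - 1 - i) * wt q (κ s + 1),
            mul_ne_zero (pow_ne_zero _ hq') (wt_succ_ne_zero hq _), ?_⟩
          rw [h1, ih2 (by omega), if_pos (by omega), map_zero, neg_zero, zero_add, map_smul, hsρ,
            slotOp_raise_basisVec, smul_smul]
  -- rows above the `i`-th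
  have hC : ∀ d k : ℕ, k + d = i → Q (k * n + 0) (n + i) = Q (i * n + 0) (n + i) := by
    intro d
    induction d with
    | zero =>
      intro k hk
      obtain rfl : k = i := hk
      rfl
    | succ d ih =>
      intro k hk
      have inner : ∀ e ρ : ℕ, ρ + e = n → Q (k * n + ρ) (n + i) = Q (i * n + 0) (n + i) := by
        intro e
        induction e with
        | zero =>
          intro ρ hρ
          obtain rfl : ρ = n := by omega
          rw [hrows, ih (k + 1) (by omega)]
        | succ e ihe =>
          intro ρ hρ
          rw [hid k ρ (n + i) (by omega) (by omega) (by omega) (by omega) (by omega)]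
          exact ihe (ρ + 1) (by omega)
      exact inner n 0 (by omega)
  obtain ⟨c, hc, h⟩ := (hB n 0 (by omega)).2.2 (Nat.zero_le _)
  refine ⟨c, hc, ?_⟩
  have h0 := hC i 0 (by omega)
  rw [zero_mul, add_zero, hQ0] at h0
  rw [piUOp, h0, add_comm n, ← h, Nat.sub_zero]

/-- The adjoints of the operators `π_u(t_{n+i,n+j})` annihilate the vacuum vector. -/
theorem star_piUOp_basisVec_zero (i j : Fin n) :
    star (piUOp hq n (Fin.natAdd n i) (Fin.natAdd n j)) (basisVec 0) = 0 := by
  obtain ⟨V, hVm, hV0, hVid, hVlow, hVup⟩ := exists_prefix_vectors hq (halfSwapWord n)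
    (halfSwapWord_lt n) (Fin.natAdd n i) (Fin.natAdd n j) (basisVec 0)
  have hi := i.isLt
  have hj := j.isLt
  simp only [Fin.val_natAdd] at hVm hV0
  have hd : ∀ r, slotOp r (dOp hq) (basisVec 0) = basisVec (0 : Fin (n ^ 2) → ℕ) := fun r => by
    rw [slotOp_dOp_basisVec, Pi.zero_apply, pow_zero, one_smul]
  have hlow : ∀ r, slotOp r (star shiftOp * cOp hq) (basisVec (0 : Fin (n ^ 2) → ℕ)) = 0 :=
    fun r => by rw [slotOp_lower_basisVec, Pi.zero_apply, wt_zero, zero_smul]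
  -- a state outside of the window of a transposition is not changed
  have hkeep : ∀ (r : Fin (n ^ 2)) (z : ℕ) (v : ℓ²(Fin (n ^ 2) → ℕ, ℂ)),
      z ≠ halfSwapWord n r → z ≠ halfSwapWord n r + 1 →
      (∀ x < n + n, V r x = if x = z then v else 0) →
      ∀ x < n + n, V (r + 1) x = if x = z then v else 0 := by
    intro r z v h1 h2 h x hx
    have hw := halfSwapWord_lt n r
    have h3 := h (halfSwapWord n r) (by omega)
    have h4 := h (halfSwapWord n r + 1) hw
    rw [if_neg h1.symm] at h3
    rw [if_neg h2.symm] at h4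
    by_cases hx1 : x = halfSwapWord n r
    · rw [hx1, hVlow, h3, h4, map_zero, map_zero, sub_zero, if_neg h1.symm]
    · by_cases hx2 : x = halfSwapWord n r + 1
      · rw [hx2, hVup, h3, h4, map_zero, map_zero, smul_zero, add_zero, if_neg h2.symm]
      · rw [hVid r x hx hx1 hx2, h x hx]
  -- The transpositions of the rows before `i` involve only states below `n + i`.
  have h1 : ∀ r : ℕ, r ≤ i * n → ∀ x < n + n, V r x = if x = n + i then basisVec 0 else 0 := by
    intro r
    induction r with
    | zero => exact fun _ => hV0
    | succ r ih =>
      intro hr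
      have hrn : r < n ^ 2 := by
        have := Nat.mul_le_mul_right n hi.le
        rw [pow_two]
        omega
      have hw : halfSwapWord n ⟨r, hrn⟩ + 1 < n + i := by
        have : r / n < i := Nat.div_lt_of_lt_mul (by rw [mul_comm]; omega)
        rw [halfSwapWord]
        simp only
        omega
      exact hkeep ⟨r, hrn⟩ _ _ (by omega) (by omega) (ih (by omega))
  -- On the vacuum `d(q)` acts as `1` and the lowering entry gives `0`, so each transposition of row
  -- `i` forces the state down by one, with a sign.
  have h2 : ∀ ρ : ℕ, ρ ≤ n → ∀ x < n + n, V (i * n + ρ) x =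
      if x = n + i - ρ then (-1 : ℂ) ^ ρ • basisVec 0 else 0 := by
    intro ρ
    induction ρ with
    | zero =>
      intro _ x hx
      rw [add_zero, h1 _ le_rfl x hx, pow_zero, one_smul, Nat.sub_zero]
    | succ ρ ih =>
      intro hρ x hx
      have ih := ih (by omega)
      have hρn : ρ < n := by omega
      have hw := halfSwapWord_slotIdx i ⟨ρ, hρn⟩
      simp only at hw
      set r := slotIdx i ⟨ρ, hρn⟩ with hr
      have h3 : V r (halfSwapWord n r) = 0 :=
        (ih (halfSwapWord n r) (by omega)).trans (if_neg (by omega))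
      have h4 : V r (halfSwapWord n r + 1) = (-1 : ℂ) ^ ρ • basisVec 0 :=
        (ih (halfSwapWord n r + 1) (by omega)).trans (if_pos (by omega))
      change V (r + 1) x = _
      by_cases hx1 : x = halfSwapWord n r
      · rw [hx1, hVlow, h3, h4, map_zero, map_smul, hd, if_pos (by omega), zero_sub]
        module
      · rw [if_neg (by omega)]
        by_cases hx2 : x = halfSwapWord n r + 1
        · rw [hx2, hVup, h3, h4, map_zero, map_smul, hlow, smul_zero, smul_zero, add_zero]
        · rw [hVid r x hx hx1 hx2]
          exact (ih x hx).trans (if_neg (by omega))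
  -- All later labels exceed `i`, so the state stays at `i` and never reaches `n + j`.
  have h3 : ∀ d : ℕ, i * n + n + d ≤ n ^ 2 → ∀ x < n + n, V (i * n + n + d) x =
      if x = i then (-1 : ℂ) ^ n • basisVec 0 else 0 := by
    intro d
    induction d with
    | zero =>
      intro _ x hx
      rw [add_zero, h2 n le_rfl x hx, Nat.add_sub_cancel_left]
    | succ d ih =>
      intro hd'
      have hw : (i : ℕ) < halfSwapWord n ⟨i * n + n + d, by omega⟩ := by
        have : (i : ℕ) + 1 ≤ (i * n + n + d) / n := by
          rw [Nat.le_div_iff_mul_le i.pos, Nat.succ_mul]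
          omega
        rw [halfSwapWord]
        simp only
        omega
      exact hkeep ⟨i * n + n + d, by omega⟩ _ _ (by omega) (by omega) (ih (by omega))
  have h4 : (i : ℕ) * n + n ≤ n ^ 2 := by
    have := Nat.mul_le_mul_right n (Nat.succ_le_of_lt hi)
    rwa [Nat.succ_mul, ← pow_two] at this
  have h5 := h3 (n ^ 2 - (i * n + n)) (by omega) (n + j) (by omega)
  rw [Nat.add_sub_cancel' h4, hVm, if_neg (by omega)] at h5
  exact h5

end HalfSwap

/-! ### The Fock module is spanned by ordered monomials -/

section FockModule

variable {n : ℕ} {q : ℝ}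

theorem isQMatrix_zGen (n : ℕ) (q : ℝ) :
    IsQMatrix q (Matrix.of (zGen n q) : Matrix (Fin n) (Fin n) (PolMat n q)) :=
  (isQMatrix_map_iff (M := genMatrix n) (StarPresented.mk (PolRel n q))).mpr fun _ _ hxy =>
    StarPresented.mk_eq_of_rel (PolRel.hol hxy)

theorem star_zGen_mul_zGen (α β a b : Fin n) :
    star (zGen n q β b) * zGen n q α a =
      (q : ℂ) ^ 2 • (∑ a' : Fin n, ∑ b' : Fin n, ∑ α' : Fin n, ∑ β' : Fin n,
        (rCoeff q b a b' a' * rCoeff q β α β' α') • (zGen n q α' a' * star (zGen n q β' b'))) +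
        if a = b ∧ α = β then (1 - (q : ℂ) ^ 2) • 1 else 0 := by
  have h := StarPresented.mk_eq_of_rel (PolRel.mixed (q := q) α β a b)
  have hite : StarPresented.mk (PolRel n q) (if a = b ∧ α = β then (1 - (q : ℂ) ^ 2) • 1 else 0) =
      if a = b ∧ α = β then (1 - (q : ℂ) ^ 2) • 1 else 0 := by
    split_ifs
    · rw [map_smul, map_one]
    · rw [map_zero]
  rw [map_add, hite] at h
  simp only [map_mul, map_smul, map_sum, ← StarPresented.star_mk] at h
  exact h

/-- The row of a letter. -/
def rowOf (r : Fin (n ^ 2)) : Fin n := (exists_slotIdx r).choose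

/-- The column of a letter. -/
def colOf (r : Fin (n ^ 2)) : Fin n := (exists_slotIdx r).choose_spec.choose

theorem slotIdx_rowOf_colOf (r : Fin (n ^ 2)) : slotIdx (rowOf r) (colOf r) = r :=
  (exists_slotIdx r).choose_spec.choose_spec.symm

theorem rowOf_slotIdx (k ρ : Fin n) : rowOf (slotIdx k ρ) = k :=
  (slotIdx_injective (slotIdx_rowOf_colOf (slotIdx k ρ))).1

theorem colOf_slotIdx (k ρ : Fin n) : colOf (slotIdx k ρ) = ρ :=
  (slotIdx_injective (slotIdx_rowOf_colOf (slotIdx k ρ))).2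

theorem slotIdx_lt_slotIdx {k ρ k' ρ' : Fin n} (h : k < k' ∨ k = k' ∧ ρ < ρ') :
    slotIdx k ρ < slotIdx k' ρ' := by
  rw [Fin.lt_def]
  simp only [slotIdx]
  rcases h with h | ⟨rfl, h⟩
  · have := Nat.mul_le_mul_right n (Nat.succ_le_of_lt (Fin.lt_def.mp h))
    rw [Nat.succ_mul] at this
    have := ρ.isLt
    omega
  · have := Fin.lt_def.mp h
    omega

theorem lt_cases {r s : Fin (n ^ 2)} (h : r < s) :
    rowOf r < rowOf s ∨ rowOf r = rowOf s ∧ colOf r < colOf s := by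
  by_contra! hne
  obtain ⟨h1, h2⟩ := hne
  rcases h1.lt_or_eq with h3 | h3
  · have := slotIdx_lt_slotIdx (ρ := colOf s) (ρ' := colOf r) (Or.inl h3)
    rw [slotIdx_rowOf_colOf, slotIdx_rowOf_colOf] at this
    exact h.asymm this
  · rcases (h2 h3.symm).lt_or_eq with h4 | h4
    · have := slotIdx_lt_slotIdx (Or.inr ⟨h3, h4⟩)
      rw [slotIdx_rowOf_colOf, slotIdx_rowOf_colOf] at this
      exact h.asymm this
    · rw [← slotIdx_rowOf_colOf r, ← slotIdx_rowOf_colOf s, h3, h4] at h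
      exact lt_irrefl _ h

/-- The generators of `Pol(Mat_n)_q`, in the order given by rows and columns. -/
def zLetter (n : ℕ) (q : ℝ) (r : Fin (n ^ 2)) : PolMat n q := zGen n q (rowOf r) (colOf r)

theorem zLetter_slotIdx (i j : Fin n) : zLetter n q (slotIdx i j) = zGen n q i j := by
  rw [zLetter, rowOf_slotIdx, colOf_slotIdx]

/-- The commutation rule for letters in the wrong order. -/
theorem zLetter_mul_zLetter (hq : q ≠ 0) {p a : Fin (n ^ 2)} (hpa : p < a) :
    ∃ c d : ℂ, ∃ a' p' : Fin (n ^ 2),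
      zLetter n q p * zLetter n q a =
        c • (zLetter n q a * zLetter n q p) + d • (zLetter n q a' * zLetter n q p') ∧
      (d ≠ 0 → rowOf p < rowOf a' ∧ a' ≤ a ∧ p' ≤ a) := by
  have hq' : (q : ℂ) ≠ 0 := by exact_mod_cast hq
  have hM := isQMatrix_zGen n q
  rcases lt_cases hpa with hrow | ⟨hrow, hcol⟩
  · rcases lt_trichotomy (colOf p) (colOf a) with hcol | hcol | hcol
    -- The correction term exchanges the columns. Its first letter lies in the row of `a`, beyond
    -- that of `p`, which drives the induction on rows; neither letter exceeds `a`.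
    · refine ⟨1, (q : ℂ) - (q : ℂ)⁻¹, slotIdx (rowOf a) (colOf p), slotIdx (rowOf p) (colOf a),
        ?_, fun _ => ⟨by rwa [rowOf_slotIdx], ?_, ?_⟩⟩
      · rw [zLetter_slotIdx, zLetter_slotIdx, one_smul]
        exact hM.cross hrow hcol
      · have := slotIdx_lt_slotIdx (k := rowOf a) (Or.inr ⟨rfl, hcol⟩)
        rw [slotIdx_rowOf_colOf] at this
        exact this.le
      · have := slotIdx_lt_slotIdx (ρ := colOf a) (ρ' := colOf a) (Or.inl hrow)
        rw [slotIdx_rowOf_colOf] at this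
        exact this.le
    · refine ⟨q, 0, a, a, ?_, fun h => absurd rfl h⟩
      rw [zero_smul, add_zero]
      have := hM.col (colOf p) hrow
      simp only [Matrix.of_apply] at this
      rw [zLetter, zLetter, ← hcol, this]
    · refine ⟨1, 0, a, a, ?_, fun h => absurd rfl h⟩
      rw [zero_smul, add_zero, one_smul]
      exact hM.comm hrow hcol
  · refine ⟨q, 0, a, a, ?_, fun h => absurd rfl h⟩
    rw [zero_smul, add_zero]
    have := hM.row (rowOf p) hcol
    simp only [Matrix.of_apply] at this
    rw [zLetter, zLetter, ← hrow, this]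

/-- The vector `z_{r_1} ⋯ z_{r_k} v_0`. -/
def wordVec (n : ℕ) (q : ℝ) (l : List (Fin (n ^ 2))) : FockModule n q :=
  (l.map (zLetter n q)).prod • fockVacuum n q

theorem wordVec_nil : wordVec n q [] = fockVacuum n q := by
  rw [wordVec, List.map_nil, List.prod_nil, one_smul]

theorem wordVec_cons (p : Fin (n ^ 2)) (l : List (Fin (n ^ 2))) :
    wordVec n q (p :: l) = zLetter n q p • wordVec n q l := by
  rw [wordVec, List.map_cons, List.prod_cons, mul_smul, wordVec]

/-- The span of the ordered monomials of degree `k` in the letters up to `M`. -/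
def orderedSpan (n : ℕ) (q : ℝ) (M : Fin (n ^ 2)) (k : ℕ) : Submodule ℂ (FockModule n q) :=
  Submodule.span ℂ {v | ∃ l : List (Fin (n ^ 2)), l.Pairwise (· ≥ ·) ∧ (∀ x ∈ l, x ≤ M) ∧
    l.length = k ∧ wordVec n q l = v}

theorem orderedSpan_mono {M M' : Fin (n ^ 2)} (h : M ≤ M') (k : ℕ) :
    orderedSpan n q M k ≤ orderedSpan n q M' k :=
  Submodule.span_mono fun _ ⟨l, h1, h2, h3⟩ => ⟨l, h1, fun x hx => (h2 x hx).trans h, h3⟩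

theorem zLetter_smul_mem_of_forall {p : Fin (n ^ 2)} {S S' : Submodule ℂ (FockModule n q)}
    {s : Set (FockModule n q)} (hS : S = Submodule.span ℂ s)
    (h : ∀ v ∈ s, zLetter n q p • v ∈ S') {v : FockModule n q} (hv : v ∈ S) :
    zLetter n q p • v ∈ S' := by
  rw [hS] at hv
  induction hv using Submodule.span_induction with
  | mem v hv => exact h v hv
  | zero => rw [smul_zero]; exact S'.zero_mem
  | add v w _ _ hv hw => rw [smul_add]; exact S'.add_mem hv hw
  | smul c v _ hv => rw [smul_comm]; exact S'.smul_mem c hv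

theorem zLetter_smul_top_mem (p : Fin (n ^ 2)) (k : ℕ) {v : FockModule n q}
    (hv : v ∈ orderedSpan n q p k) : zLetter n q p • v ∈ orderedSpan n q p (k + 1) := by
  refine zLetter_smul_mem_of_forall rfl ?_ hv
  rintro _ ⟨l, h1, h2, h3, rfl⟩
  refine Submodule.subset_span ⟨p :: l, List.pairwise_cons.mpr ⟨h2, h1⟩, ?_, ?_, wordVec_cons p l⟩
  · intro x hx
    rcases List.mem_cons.mp hx with rfl | hx
    · exact le_rfl
    · exact h2 x hx
  · rw [List.length_cons, h3]

/-- Normal ordering by induction on the degree `k` and then on `d`, the distance of the row of `p`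
from the end. If `p` is smaller than the leading letter `a`, moving it past `a` leaves a word of
lower degree to treat, and the correction term starts with a letter of smaller `d`. The bound `M`
records that no letter above `a` is created, so that `a` may be put back in front. -/
theorem zLetter_smul_mem_orderedSpan (hq : q ≠ 0) (k : ℕ) : ∀ (d : ℕ) (p M : Fin (n ^ 2)),
    (rowOf p : ℕ) + d = n → p ≤ M → ∀ v ∈ orderedSpan n q M k,
      zLetter n q p • v ∈ orderedSpan n q M (k + 1) := by
  induction k with
  | zero =>
    intro d p M _ hpM v hv
    refine zLetter_smul_mem_of_forall rfl ?_ hv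
    rintro _ ⟨l, h1, h2, h3, rfl⟩
    rw [List.length_eq_zero_iff] at h3
    subst h3
    exact Submodule.subset_span ⟨[p], List.pairwise_singleton _ _, by simpa using hpM, rfl,
      wordVec_cons p []⟩
  | succ k ihk =>
    intro d
    induction d using Nat.strong_induction_on with
    | _ d ihd =>
      intro p M hd hpM v hv
      refine zLetter_smul_mem_of_forall rfl ?_ hv
      rintro _ ⟨l, h1, h2, h3, rfl⟩
      obtain ⟨a, l, rfl⟩ : ∃ a l', l = a :: l' := by
        cases l with
        | nil => simp at h3
        | cons a l => exact ⟨a, l, rfl⟩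
      have haM : a ≤ M := h2 a (by simp)
      have hl := List.pairwise_cons.mp h1
      rw [List.length_cons, Nat.add_right_cancel_iff] at h3
      have hmem : wordVec n q l ∈ orderedSpan n q a k :=
        Submodule.subset_span ⟨l, hl.2, hl.1, h3, rfl⟩
      rcases le_or_gt a p with hap | hpa
      · refine orderedSpan_mono hpM _ (zLetter_smul_top_mem p _ (Submodule.subset_span
          ⟨a :: l, h1, ?_, by rw [List.length_cons, h3], rfl⟩))
        intro x hx
        rcases List.mem_cons.mp hx with rfl | hx
        · exact hap
        · exact (hl.1 x hx).trans hap
      · obtain ⟨c, e, a', p', hrel, he⟩ := zLetter_mul_zLetter (q := q) hq hpa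
        refine orderedSpan_mono haM _ ?_
        rw [wordVec_cons, ← mul_smul, hrel, add_smul, smul_assoc, smul_assoc, mul_smul, mul_smul]
        refine Submodule.add_mem _ (Submodule.smul_mem _ _ (zLetter_smul_top_mem a _
          (ihk _ p a hd hpa.le _ hmem))) ?_
        by_cases he0 : e = 0
        · rw [he0, zero_smul]; exact Submodule.zero_mem _
        · obtain ⟨h4, h5, h6⟩ := he he0
          have h7 := Fin.lt_def.mp h4
          have h8 := (rowOf a').isLt
          exact Submodule.smul_mem _ _ (ihd (n - rowOf a') (by omega) a' a (by omega) h5 _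
            (ihk (n - rowOf p') p' a (by have := (rowOf p').isLt; omega) h6 _ hmem))

theorem fockVacuum_generates (u : FockModule n q) : ∃ f : PolMat n q, u = f • fockVacuum n q := by
  obtain ⟨f, rfl⟩ := Submodule.Quotient.mk_surjective _ u
  refine ⟨f, ?_⟩
  rw [fockVacuum, ← Submodule.Quotient.mk_smul, smul_eq_mul, mul_one]

theorem star_zGen_smul_fockVacuum (i j : Fin n) :
    star (zGen n q i j) • fockVacuum n q = 0 := by
  rw [fockVacuum, ← Submodule.Quotient.mk_smul, smul_eq_mul, mul_one, Submodule.Quotient.mk_eq_zero]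
  exact Submodule.subset_span ⟨(i, j), rfl⟩

/-- The ordered monomials span the Fock module. -/
theorem span_ordered_eq_top (hq : q ≠ 0) : Submodule.span ℂ
    {v | ∃ l : List (Fin (n ^ 2)), l.Pairwise (· ≥ ·) ∧ wordVec n q l = v} = ⊤ := by
  set S := Submodule.span ℂ
    {v | ∃ l : List (Fin (n ^ 2)), l.Pairwise (· ≥ ·) ∧ wordVec n q l = v} with hS
  have hle : ∀ M k, orderedSpan n q M k ≤ S := fun M k =>
    Submodule.span_mono fun _ ⟨l, h1, _, _, h4⟩ => ⟨l, h1, h4⟩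
  have hz' : ∀ p, ∀ v ∈ S, zLetter n q p • v ∈ S := by
    intro p v hv
    refine zLetter_smul_mem_of_forall hS ?_ hv
    rintro _ ⟨l, h1, rfl⟩
    have hpos : 0 < n ^ 2 := p.pos
    set M : Fin (n ^ 2) := ⟨n ^ 2 - 1, by omega⟩
    have hM : ∀ x : Fin (n ^ 2), x ≤ M := fun x => by
      rw [Fin.le_def]; have := x.isLt; simp only [M]; omega
    refine hle M (l.length + 1) (zLetter_smul_mem_orderedSpan hq _ (n - rowOf p) p M
      (by have := (rowOf p).isLt; omega) (hM p) _ ?_)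
    exact Submodule.subset_span ⟨l, h1, fun x _ => hM x, rfl, rfl⟩
  have hz : ∀ i j, ∀ v ∈ S, zGen n q i j • v ∈ S := fun i j v hv => by
    rw [← zLetter_slotIdx]; exact hz' _ v hv
  have hvac : fockVacuum n q ∈ S :=
    Submodule.subset_span ⟨[], List.Pairwise.nil, wordVec_nil⟩
  -- The mixed relation replaces the adjoint and the first letter by generators times adjoints, plus
  -- a constant; the adjoints then act on the shorter word, and `S` is already stable under the
  -- generators.
  have hstar : ∀ l : List (Fin (n ^ 2)), l.Pairwise (· ≥ ·) →
      ∀ i j, star (zGen n q i j) • wordVec n q l ∈ S := by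
    intro l
    induction l with
    | nil =>
      intro _ i j
      rw [wordVec_nil, star_zGen_smul_fockVacuum]
      exact S.zero_mem
    | cons p l ih =>
      intro hl i j
      have hl' := (List.pairwise_cons.mp hl).2
      rw [wordVec_cons, ← mul_smul, zLetter, star_zGen_mul_zGen, add_smul, smul_assoc]
      refine S.add_mem (S.smul_mem _ ?_) ?_
      · simp only [Finset.sum_smul, smul_assoc, mul_smul]
        exact S.sum_mem fun a' _ => S.sum_mem fun b' _ => S.sum_mem fun α' _ =>
          S.sum_mem fun β' _ => S.smul_mem _ (S.smul_mem _ (hz _ _ _ (ih hl' _ _)))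
      · split_ifs
        · rw [smul_assoc, one_smul]
          exact S.smul_mem _ (Submodule.subset_span ⟨l, hl', rfl⟩)
        · rw [zero_smul]; exact S.zero_mem
  have hstar' : ∀ i j, ∀ v ∈ S, star (zGen n q i j) • v ∈ S := by
    intro i j v hv
    rw [hS] at hv
    induction hv using Submodule.span_induction with
    | mem v hv => obtain ⟨l, h1, rfl⟩ := hv; exact hstar l h1 i j
    | zero => rw [smul_zero]; exact S.zero_mem
    | add v w _ _ hv hw => rw [smul_add]; exact S.add_mem hv hw
    | smul c v _ hv => rw [smul_comm]; exact S.smul_mem c hv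
  rw [eq_top_iff]
  intro u _
  obtain ⟨f, rfl⟩ := fockVacuum_generates u
  have : ∀ v ∈ S, f • v ∈ S := by
    refine StarPresented.induction (P := fun f : PolMat n q => ∀ v ∈ S, f • v ∈ S)
      ?_ ?_ ?_ ?_ ?_ f
    · intro c v hv
      rw [algebraMap_smul]
      exact S.smul_mem c hv
    · intro x v hv
      exact hz x.1 x.2 v hv
    · intro x v hv
      exact hstar' x.1 x.2 v hv
    · intro a b ha hb v hv
      rw [mul_smul]
      exact ha _ (hb _ hv)
    · intro a b ha hb v hv
      rw [add_smul]
      exact S.add_mem (ha _ hv) (hb _ hv)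
  exact this _ hvac

/-! ### Uniqueness of the Fock form -/

/-- `(v_0, z v) = (z* v_0, v) = 0`, so the functional `(v_0, ·)` is determined by its value at
`v_0`, and `(f v_0, v) = (v_0, f* v)` recovers the form. -/
theorem IsFockForm.unique (hq : q ≠ 0)
    {B B' : FockModule n q →ₗ⋆[ℂ] FockModule n q →ₗ[ℂ] ℂ} (h : IsFockForm B)
    (h' : IsFockForm B') (u v : FockModule n q) : B u v = B' u v := by
  have hzero : ∀ {B : FockModule n q →ₗ⋆[ℂ] FockModule n q →ₗ[ℂ] ℂ}, IsFockForm B →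
      ∀ i j v, B (fockVacuum n q) (zGen n q i j • v) = 0 := by
    intro B h i j v
    have := h.2 (star (zGen n q i j)) (fockVacuum n q) v
    rw [star_zGen_smul_fockVacuum, map_zero, LinearMap.zero_apply, star_star] at this
    exact this.symm
  have h1 : B (fockVacuum n q) = B' (fockVacuum n q) := by
    refine LinearMap.ext_on (span_ordered_eq_top hq) ?_
    rintro _ ⟨l, _, rfl⟩
    cases l with
    | nil => rw [wordVec_nil, h.1, h'.1]
    | cons p l => rw [wordVec_cons, zLetter, hzero h, hzero h']
  obtain ⟨f, rfl⟩ := fockVacuum_generates u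
  rw [h.2, h'.2, h1]

end FockModule

section Fock

variable {n : ℕ} {q : ℝ}

/-! ### The Fock module inside `ℓ²(ℤ₊)^{⊗ n²}` -/

/-- Reversal of the order of the columns. -/
def colRev (s : Fin (n ^ 2)) : Fin (n ^ 2) := slotIdx (rowOf s) (colOf s).rev

theorem colRev_colRev (s : Fin (n ^ 2)) : colRev (colRev s) = s := by
  rw [colRev, colRev, rowOf_slotIdx, colOf_slotIdx, Fin.rev_rev, slotIdx_rowOf_colOf]

/-- The exponents of a monomial. -/
def exponents (l : List (Fin (n ^ 2))) (s : Fin (n ^ 2)) : ℕ := l.count (colRev s)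

theorem exponents_cons (p : Fin (n ^ 2)) (l : List (Fin (n ^ 2))) :
    exponents (p :: l) =
      Function.update (exponents l) (colRev p) (exponents l (colRev p) + 1) := by
  funext s
  rw [exponents, List.count_cons]
  by_cases h : s = colRev p
  · rw [h, Function.update_self, exponents, colRev_colRev]
    simp
  · have : p ≠ colRev s := fun h' => h (by rw [h', colRev_colRev])
    rw [Function.update_of_ne h, exponents]
    simp [this]

/-- The word is the sorted multiset with the prescribed multiplicities. Columns are reversed because
the generator of column `j` raises the coordinate of column `j.rev`. -/
theorem exists_ordered (κ : Fin (n ^ 2) → ℕ) :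
    ∃ l : List (Fin (n ^ 2)), l.Pairwise (· ≥ ·) ∧ exponents l = κ := by
  set m : Multiset (Fin (n ^ 2)) :=
    Finsupp.toMultiset (Finsupp.equivFunOnFinite.symm fun s => κ (colRev s)) with hm
  refine ⟨m.sort (· ≥ ·), m.pairwise_sort _, ?_⟩
  funext s
  rw [exponents, ← Multiset.coe_count, Multiset.sort_eq, hm, Finsupp.count_toMultiset,
    Finsupp.equivFunOnFinite_symm_apply_apply, colRev_colRev]

theorem eq_of_exponents_eq {l l' : List (Fin (n ^ 2))} (hl : l.Pairwise (· ≥ ·))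
    (hl' : l'.Pairwise (· ≥ ·)) (h : exponents l = exponents l') : l = l' := by
  have hp : l.Perm l' := by
    rw [List.perm_iff_count]
    intro s
    have := congrFun h (colRev s)
    rwa [exponents, exponents, colRev_colRev] at this
  exact hp.eq_of_pairwise (fun a b _ _ h1 h2 => le_antisymm h2 h1) hl hl'

variable (hq : q ∈ Set.Ioo (0 : ℝ) 1)
  {T : PolMat n q →⋆ₐ[ℂ] (ℓ²(Fin (n ^ 2) → ℕ, ℂ) →L[ℂ] ℓ²(Fin (n ^ 2) → ℕ, ℂ))}

include hq

/-- The vectors obtained from the vacuum by ordered monomials are multiples of basis vectors. -/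
theorem ordered_monomial_basisVec
    (hT : ∀ i j, T (zGen n q i j) = (q : ℂ) ^ (((i : ℤ) + 1) - (n : ℤ)) •
      piUOp hq n (Fin.natAdd n i) (Fin.natAdd n j)) :
    ∀ l : List (Fin (n ^ 2)), l.Pairwise (· ≥ ·) → ∃ c : ℂ, c ≠ 0 ∧
      T (l.map (zLetter n q)).prod (basisVec 0) = c • basisVec (exponents l) := by
  have hq' : (q : ℂ) ≠ 0 := by exact_mod_cast hq.1.ne'
  intro l
  induction l with
  | nil =>
    intro _
    refine ⟨1, one_ne_zero, ?_⟩
    rw [List.map_nil, List.prod_nil, map_one, one_smul, one_apply_eq_self]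
    rfl
  | cons p l ih =>
    intro hl
    obtain ⟨hp, hl⟩ := List.pairwise_cons.mp hl
    obtain ⟨c, hc, h1⟩ := ih hl
    -- The letters of `l` are at most `p`, so the exponents vanish in the rows after that of `p`, as
    -- the single-path argument requires.
    obtain ⟨c', hc', h2⟩ := piUOp_basisVec hq (rowOf p) (colOf p) (exponents l) (by
      intro k ρ hk
      rw [exponents, List.count_eq_zero]
      intro hmem
      rw [colRev, rowOf_slotIdx, colOf_slotIdx] at hmem
      have h3 := slotIdx_lt_slotIdx (ρ := colOf p) (ρ' := ρ.rev) (Or.inl hk)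
      rw [slotIdx_rowOf_colOf] at h3
      exact (hp _ hmem).not_gt h3)
    refine ⟨c * ((q : ℂ) ^ (((rowOf p : ℕ) : ℤ) + 1 - (n : ℤ)) * c'),
      mul_ne_zero hc (mul_ne_zero (zpow_ne_zero _ hq') hc'), ?_⟩
    rw [List.map_cons, List.prod_cons, map_mul, mul_apply_eq_comp, h1, map_smul, zLetter, hT,
      smul_apply, h2, smul_smul, smul_smul, mul_assoc, exponents_cons]
    rfl

omit hq in
/-- A representation with a vector annihilated by the adjoints of the generators receives a linear
map from the Fock module. -/
theorem exists_fock_map {H : Type*} [NormedAddCommGroup H] [InnerProductSpace ℂ H]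
    [CompleteSpace H] (π : PolMat n q →⋆ₐ[ℂ] (H →L[ℂ] H)) (x : H)
    (hx : ∀ i j, π (star (zGen n q i j)) x = 0) :
    ∃ J : FockModule n q →ₗ[ℂ] H, ∀ f, J (f • fockVacuum n q) = π f x := by
  let L : PolMat n q →ₗ[ℂ] H :=
    { toFun := fun f => π f x
      map_add' := fun f g => by rw [map_add, add_apply]
      map_smul' := fun c f => by rw [map_smul, smul_apply, RingHom.id_apply] }
  have hker : (Submodule.span (PolMat n q) (Set.range fun p : Fin n × Fin n =>
      star (zGen n q p.1 p.2))).restrictScalars ℂ ≤ LinearMap.ker L := by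
    intro f hf
    rw [Submodule.restrictScalars_mem] at hf
    rw [LinearMap.mem_ker]
    induction hf using Submodule.span_induction with
    | mem f hf =>
      obtain ⟨p, rfl⟩ := hf
      exact hx p.1 p.2
    | zero => rw [map_zero]
    | add f g _ _ hf hg => rw [map_add, hf, hg, add_zero]
    | smul a f _ hf =>
      change π (a * f) x = 0
      rw [map_mul, mul_apply_eq_comp]
      change π a (L f) = 0
      rw [hf, map_zero]
  refine ⟨(Submodule.liftQ _ L hker).comp
    (Submodule.Quotient.restrictScalarsEquiv ℂ _).symm.toLinearMap, fun f => ?_⟩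
  rw [fockVacuum, ← Submodule.Quotient.mk_smul, smul_eq_mul, mul_one]
  rfl

omit hq in
theorem intertwines_of_fockVacuum {H : Type*} [NormedAddCommGroup H] [InnerProductSpace ℂ H]
    [CompleteSpace H] {π : PolMat n q →⋆ₐ[ℂ] (H →L[ℂ] H)} {x : H} {J : FockModule n q →ₗ[ℂ] H}
    (hJ : ∀ f, J (f • fockVacuum n q) = π f x) (f : PolMat n q) (u : FockModule n q) :
    J (f • u) = π f (J u) := by
  obtain ⟨g, rfl⟩ := fockVacuum_generates u
  rw [hJ, ← mul_smul, hJ, map_mul, mul_apply_eq_comp]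

/-- The embedding of the Fock module as a dense subspace of `ℓ²(ℤ₊)^{⊗ n²}`. -/
theorem exists_fock_embedding
    (hT : ∀ i j, T (zGen n q i j) = (q : ℂ) ^ (((i : ℤ) + 1) - (n : ℤ)) •
      piUOp hq n (Fin.natAdd n i) (Fin.natAdd n j)) :
    ∃ (J : FockModule n q →ₗ[ℂ] ℓ²(Fin (n ^ 2) → ℕ, ℂ))
      (b : (Fin (n ^ 2) → ℕ) → FockModule n q),
      (∀ f u, J (f • u) = T f (J u)) ∧ J (fockVacuum n q) = basisVec 0 ∧
      (∀ κ, J (b κ) = basisVec κ) ∧ Submodule.span ℂ (Set.range b) = ⊤ := by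
  obtain ⟨J, hJvac⟩ := exists_fock_map T (basisVec 0) fun i j => by
    rw [map_star, hT, star_smul, smul_apply, star_piUOp_basisVec_zero, smul_zero]
  have hJsmul := intertwines_of_fockVacuum hJvac
  choose lst hlst hexp using exists_ordered (n := n)
  choose c hc hcT using fun κ => ordered_monomial_basisVec hq hT (lst κ) (hlst κ)
  refine ⟨J, fun κ => (c κ)⁻¹ • wordVec n q (lst κ), hJsmul, ?_, fun κ => ?_, ?_⟩
  · have := hJvac 1
    rwa [one_smul, map_one, one_apply_eq_self] at this
  · rw [map_smul, wordVec, hJvac, hcT, smul_smul, inv_mul_cancel₀ (hc κ), one_smul, hexp]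
  · rw [← span_ordered_eq_top hq.1.ne', eq_comm]
    refine le_antisymm (Submodule.span_le.mpr ?_) ?_
    · rintro _ ⟨l, hl, rfl⟩
      have h1 : lst (exponents l) = l := eq_of_exponents_eq (hlst _) hl (hexp _)
      have h2 : wordVec n q l = c (exponents l) •
          ((c (exponents l))⁻¹ • wordVec n q (lst (exponents l))) := by
        rw [smul_smul, mul_inv_cancel₀ (hc _), one_smul, h1]
      rw [h2]
      exact Submodule.smul_mem _ _ (Submodule.subset_span ⟨_, rfl⟩)
    · refine Submodule.span_le.mpr ?_
      rintro _ ⟨κ, rfl⟩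
      exact Submodule.smul_mem _ _ (Submodule.subset_span ⟨lst κ, hlst κ, rfl⟩)

/-! ### The Fock representation -/

omit hq in
-- A spanning family with orthonormal images: pairing `J u` with `e_κ` reads off the coefficients of
-- `u`.
theorem injective_of_basis {J : FockModule n q →ₗ[ℂ] ℓ²(Fin (n ^ 2) → ℕ, ℂ)}
    {b : (Fin (n ^ 2) → ℕ) → FockModule n q} (hb : ∀ κ, J (b κ) = basisVec κ)
    (hspan : Submodule.span ℂ (Set.range b) = ⊤) {u : FockModule n q} (hu : J u = 0) : u = 0 := by
  have hmem : u ∈ Submodule.span ℂ (Set.range b) := by rw [hspan]; trivial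
  obtain ⟨c, rfl⟩ := (Finsupp.mem_span_range_iff_exists_finsupp).mp hmem
  have h0 : c = 0 := by
    ext κ
    have h1 := congrArg (fun f => inner ℂ (basisVec κ) f) hu
    simp only [Finsupp.sum, map_sum, map_smul, hb, inner_sum, inner_smul_right,
      inner_basisVec_left, inner_zero_right, basisVec_apply, mul_ite, mul_one, mul_zero,
      Finset.sum_ite_eq, Finsupp.mem_support_iff, ite_not] at h1
    split_ifs at h1 with h2
    · exact h2
    · exact h1
  rw [h0, Finsupp.sum_zero_index]

omit hq in
/-- The form induced on the Fock module by an intertwining map which preserves the vacuum. -/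
theorem exists_fockForm {H : Type*} [NormedAddCommGroup H] [InnerProductSpace ℂ H]
    [CompleteSpace H] (π : PolMat n q →⋆ₐ[ℂ] (H →L[ℂ] H)) (J : FockModule n q →ₗ[ℂ] H)
    (hJ : ∀ f u, J (f • u) = π f (J u)) (hvac : ‖J (fockVacuum n q)‖ = 1) :
    ∃ B : FockModule n q →ₗ⋆[ℂ] FockModule n q →ₗ[ℂ] ℂ,
      IsFockForm B ∧ ∀ u v, inner ℂ (J u) (J v) = B u v := by
  refine ⟨LinearMap.mk₂'ₛₗ (starRingEnd ℂ) (RingHom.id ℂ) (fun u v => inner ℂ (J u) (J v))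
    ?_ ?_ ?_ ?_, ⟨?_, ?_⟩, fun _ _ => rfl⟩
  · intro u u' v; rw [map_add, inner_add_left]
  · intro c u v; rw [map_smul, inner_smul_left, smul_eq_mul]
  · intro u v v'; rw [map_add, inner_add_right]
  · intro c u v; rw [map_smul, inner_smul_right, smul_eq_mul, RingHom.id_apply]
  · change inner ℂ (J (fockVacuum n q)) (J (fockVacuum n q)) = 1
    rw [inner_self_eq_norm_sq_to_K, hvac]
    simp
  · intro f u v
    change inner ℂ (J (f • u)) (J v) = inner ℂ (J u) (J (star f • v))
    rw [hJ, hJ, map_star, ContinuousLinearMap.star_eq_adjoint,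
      ContinuousLinearMap.adjoint_inner_right]

omit hq in
theorem norm_basisVec {α : Type} [DecidableEq α] (κ : α) : ‖(basisVec κ : ℓ²(α, ℂ))‖ = 1 := by
  rw [basisVec, lp.norm_single (by norm_num), norm_one]

/-- The form pulled back along the embedding is positive definite by injectivity, and the image is
dense because it contains all finite combinations of basis vectors. -/
theorem isFockRepresentation_of_piU
    (hT : ∀ i j, T (zGen n q i j) = (q : ℂ) ^ (((i : ℤ) + 1) - (n : ℤ)) •
      piUOp hq n (Fin.natAdd n i) (Fin.natAdd n j)) : IsFockRepresentation T := by
  obtain ⟨J, b, hJ, hvac, hb, hspan⟩ := exists_fock_embedding hq hT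
  obtain ⟨B, hB, hBJ⟩ := exists_fockForm T J hJ (by rw [hvac, norm_basisVec])
  refine ⟨B, hB, fun u hu => ?_, J, fun f => ?_, hBJ, fun f u => (hJ f u).symm⟩
  · rw [← hBJ, inner_self_eq_norm_sq_to_K]
    have h1 : J u ≠ 0 := fun h => hu (injective_of_basis hb hspan h)
    have h2 : 0 < ‖J u‖ ^ 2 := by positivity
    norm_cast
  · refine mem_closure_of_tendsto (hasSum_basisVec f) (Filter.Eventually.of_forall fun s => ?_)
    refine ⟨∑ κ ∈ s, f κ • b κ, ?_⟩
    rw [map_sum]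
    simp only [map_smul, hb]

/-- By uniqueness of the form, `J` and `J'` have the same inner products, so the vectors `J' (b κ)`
form a Hilbert basis of `H`; the unitary takes `e_κ` to `J' (b κ)`. -/
theorem unitarilyEquivalent_of_isFockRepresentation
    (hT : ∀ i j, T (zGen n q i j) = (q : ℂ) ^ (((i : ℤ) + 1) - (n : ℤ)) •
      piUOp hq n (Fin.natAdd n i) (Fin.natAdd n j))
    {H : Type*} [NormedAddCommGroup H] [InnerProductSpace ℂ H] [CompleteSpace H]
    {πF : PolMat n q →⋆ₐ[ℂ] (H →L[ℂ] H)} (hF : IsFockRepresentation πF) :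
    UnitarilyEquivalent T πF := by
  obtain ⟨J, b, hJ, hvac, hb, hspan⟩ := exists_fock_embedding hq hT
  obtain ⟨B, hB, hBJ⟩ := exists_fockForm T J hJ (by rw [hvac, norm_basisVec])
  obtain ⟨B', hB', -, J', hdense, hBJ', hJ'⟩ := hF
  have hinner : ∀ u v, inner ℂ (J' u) (J' v) = inner ℂ (J u) (J v) := fun u v => by
    rw [hBJ, hBJ', hB.unique hq.1.ne' hB']
  have hon : Orthonormal ℂ fun κ => J' (b κ) := by
    rw [orthonormal_iff_ite]
    intro κ κ'
    rw [hinner, hb, hb, inner_basisVec_left, basisVec_apply]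
  have htop : ⊤ ≤ (Submodule.span ℂ (Set.range fun κ => J' (b κ))).topologicalClosure := by
    intro x _
    have hrange : Set.range J' ⊆ Submodule.span ℂ (Set.range fun κ => J' (b κ)) := by
      rintro _ ⟨u, rfl⟩
      have hu : u ∈ Submodule.span ℂ (Set.range b) := by rw [hspan]; trivial
      have := Submodule.mem_map_of_mem (f := J') hu
      rwa [Submodule.map_span, ← Set.range_comp] at this
    exact closure_mono hrange (hdense x)
  set e := HilbertBasis.mk hon htop with he
  have heb : ∀ κ, e.repr.symm (basisVec κ) = J' (b κ) := fun κ => by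
    rw [basisVec, HilbertBasis.repr_symm_single, he, HilbertBasis.coe_mk]
  have heJ : ∀ u, e.repr.symm (J u) = J' u := by
    intro u
    have hu : u ∈ Submodule.span ℂ (Set.range b) := by rw [hspan]; trivial
    induction hu using Submodule.span_induction with
    | mem u hu => obtain ⟨κ, rfl⟩ := hu; rw [hb, heb]
    | zero => rw [map_zero, map_zero, map_zero]
    | add u v _ _ hu hv => rw [map_add, map_add, map_add, hu, hv]
    | smul c u _ hu => rw [map_smul, map_smul, map_smul, hu]
  refine ⟨e.repr.symm, fun a x => ?_⟩
  set U : ℓ²(Fin (n ^ 2) → ℕ, ℂ) →L[ℂ] H :=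
    (e.repr.symm.toContinuousLinearEquiv : ℓ²(Fin (n ^ 2) → ℕ, ℂ) →L[ℂ] H) with hU
  -- Both sides are bounded, so it suffices to compare them on basis vectors, which lie in the image
  -- of the Fock module.
  have h1 : U.comp (T a) = (πF a).comp U := by
    refine op_ext fun κ => ?_
    change e.repr.symm (T a (basisVec κ)) = πF a (e.repr.symm (basisVec κ))
    rw [← hb, ← hJ, heJ, heJ, hJ']
  exact congrArg (fun A : ℓ²(Fin (n ^ 2) → ℕ, ℂ) →L[ℂ] H => A x) h1

end Fock

end QMatBall

end

/-! ### Assembly of the theorem -/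

theorem mainTheorem4 (n : ℕ) (q : ℝ) (hq : q ∈ Set.Ioo (0 : ℝ) 1) :
    (∃! πu : QMatBall.CSU (n + n) q →⋆ₐ[ℂ]
        (ℓ²(Fin (n ^ 2) → ℕ, ℂ) →L[ℂ] ℓ²(Fin (n ^ 2) → ℕ, ℂ)),
      ∀ i j, πu (QMatBall.tGen (n + n) q i j) = QMatBall.piUOp hq n i j) ∧
    (∃! ι : QMatBall.PolMat n q →⋆ₐ[ℂ] QMatBall.CSU (n + n) q,
      ∀ i j, ι (QMatBall.zGen n q i j) = (q : ℂ) ^ (((i : ℤ) + 1) - (n : ℤ)) •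
        QMatBall.tGen (n + n) q (Fin.natAdd n i) (Fin.natAdd n j)) ∧
    (∃ (H : Type) (_ : NormedAddCommGroup H) (_ : InnerProductSpace ℂ H) (_ : CompleteSpace H)
      (πF : QMatBall.PolMat n q →⋆ₐ[ℂ] (H →L[ℂ] H)), QMatBall.IsFockRepresentation πF) ∧
    ∀ (πu : QMatBall.CSU (n + n) q →⋆ₐ[ℂ]
        (ℓ²(Fin (n ^ 2) → ℕ, ℂ) →L[ℂ] ℓ²(Fin (n ^ 2) → ℕ, ℂ)))
      (ι : QMatBall.PolMat n q →⋆ₐ[ℂ] QMatBall.CSU (n + n) q),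
      (∀ i j, πu (QMatBall.tGen (n + n) q i j) = QMatBall.piUOp hq n i j) →
      (∀ i j, ι (QMatBall.zGen n q i j) = (q : ℂ) ^ (((i : ℤ) + 1) - (n : ℤ)) •
        QMatBall.tGen (n + n) q (Fin.natAdd n i) (Fin.natAdd n j)) →
      ∀ (H : Type*) [NormedAddCommGroup H] [InnerProductSpace ℂ H] [CompleteSpace H]
        (πF : QMatBall.PolMat n q →⋆ₐ[ℂ] (H →L[ℂ] H)), QMatBall.IsFockRepresentation πF →
        QMatBall.UnitarilyEquivalent (πu.comp ι) πF := by
  have hcomp : ∀ (πu : QMatBall.CSU (n + n) q →⋆ₐ[ℂ]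
        (ℓ²(Fin (n ^ 2) → ℕ, ℂ) →L[ℂ] ℓ²(Fin (n ^ 2) → ℕ, ℂ)))
      (ι : QMatBall.PolMat n q →⋆ₐ[ℂ] QMatBall.CSU (n + n) q),
      (∀ i j, πu (QMatBall.tGen (n + n) q i j) = QMatBall.piUOp hq n i j) →
      (∀ i j, ι (QMatBall.zGen n q i j) = (q : ℂ) ^ (((i : ℤ) + 1) - (n : ℤ)) •
        QMatBall.tGen (n + n) q (Fin.natAdd n i) (Fin.natAdd n j)) →
      ∀ i j, (πu.comp ι) (QMatBall.zGen n q i j) = (q : ℂ) ^ (((i : ℤ) + 1) - (n : ℤ)) •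
        QMatBall.piUOp hq n (Fin.natAdd n i) (Fin.natAdd n j) := by
    intro πu ι hπ hι i j
    rw [StarAlgHom.comp_apply, hι, map_smul, hπ]
  refine ⟨QMatBall.existsUnique_piU hq n, QMatBall.existsUnique_embedding n hq.1.ne', ?_, ?_⟩
  · obtain ⟨πu, hπ, -⟩ := QMatBall.existsUnique_piU hq n
    obtain ⟨ι, hι, -⟩ := QMatBall.existsUnique_embedding n hq.1.ne'
    -- The Fock representation is realized by `π_u ∘ ι` itself.
    exact ⟨_, inferInstance, inferInstance, inferInstance, πu.comp ι,
      QMatBall.isFockRepresentation_of_piU hq (hcomp πu ι hπ hι)⟩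
  · intro πu ι hπ hι H _ _ _ πF hF
    exact QMatBall.unitarilyEquivalent_of_isFockRepresentation hq (hcomp πu ι hπ hι) hF
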